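/- **Theorem (Join connectivity theorem).** Work in Martin-Löf type theory with $\Pi$-, $\Sigma$- and identity types, $\emptyset$, $\mathbf 1$, $\mathbb N$ and disjoint sums (with the usual judgemental $\beta$-rules; no judgemental $\eta$-rule is used), with function extensionality for dependent function types of any size, and with a univalent universe $\mathcal U$ that contains these types and is closed under graph quotients: for $V:\mathcal U$ and $E:V\to V\to\mathcal U$ there is a type in $\mathcal U$ with a point for each $i:V$ and a path from the point of $i$ to the point of $j$ for each $e:E(i,j)$, satisfying the corresponding induction principle into type families of any size, with a judgemental computation rule on points and a propositional one on paths. Pushouts are the homotopy pushouts obtained from graph quotients. For types $M,A:\mathcal U$: * the join $M * N$ of $M,N:\mathcal U$ is the pushout of the projections $M\leftarrow M\times N\to N$; * $A$ is *$M$-local* if the map $\lambda a.\lambda x.\,a : A\to(M\to A)$ is an equivalence; * $A$ is *$M$-connected* if every $M$-local type in $\mathcal U$ is $A$-local; * a map $f:A\to X$ is *$M$-connected* if each of its fibers $\sum_{a:A} f(a)=x$, for $x:X$, is $M$-connected; * the *join* $f*g : A*_X B\to X$ of maps $f:A\to X$ and $g:B\to X$ is the map induced by $f$, $g$ and the homotopy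 of the pullback square, where $A*_XB$ is the pushout of the projections $A\leftarrow A\times_X B\to B$ of the pullback $A\times_X B=\sum_{a:A}\sum_{b:B} f(a)=g(b)$. Then, for all $M,N,A,B,X:\mathcal U$ and all maps $f:A\to X$ and $g:B\to X$: if $f$ is $M$-connected and $g$ is $N$-connected, then $f*g$ is $(M*N)$-connected. That is, the closed type $$\prod_{M,N,A,B,X:\mathcal U}\;\prod_{f:A\to X}\;\prod_{g:B\to X}\;\mathsf{isConn}_M(f)\to\mathsf{isConn}_N(g)\to\mathsf{isConn}_{M*N}(f*g)$$ has a closed element, derivable in this type theory. -/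

import Mathlib

/-!
# Martin-Löf type theory with a univalent universe closed under graph quotients

The object language of the result is a formal dependent type theory. It is defined here
as a deductive system: raw terms (de Bruijn indices), computation rules, typing rules.
-/

namespace HoTT

/-- The two sizes of types: members of the universe `𝒰` (`small`), and all types (`large`). -/
inductive Size : Type
  | small : Size
  | large : Size

/-- Raw terms and types, with de Bruijn indices. The arguments in which variables get bound are:
the codomain `B` of `pi`, `sigma`, `pair`, `split`, `funext` and the body of `lam` (one variable),
and the motives `C` of the eliminators (one variable for the eliminated object, two variables,
endpoint and path, for `J`). -/
inductive Tm : Type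
  | var (n : ℕ) : Tm
  /-- `sort small` is the universe `𝒰`; `Γ ⊢ A : sort large` is the judgement `Γ ⊢ A type`. -/
  | sort (s : Size) : Tm
  | pi (A B : Tm) : Tm
  | lam (A t : Tm) : Tm
  | app (f a : Tm) : Tm
  | sigma (A B : Tm) : Tm
  | pair (A B a b : Tm) : Tm
  /-- Induction for `sigma A B`. -/
  | split (A B C d p : Tm) : Tm
  | Id (A a b : Tm) : Tm
  | refl (A a : Tm) : Tm
  /-- Induction on paths in `A` with fixed starting point `a`. -/
  | J (A a C d b p : Tm) : Tm
  | empty : Tm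
  | emptyInd (C e : Tm) : Tm
  | unit : Tm
  | star : Tm
  | unitInd (C c u : Tm) : Tm
  | sum (A B : Tm) : Tm
  | inl (A B a : Tm) : Tm
  | inr (A B b : Tm) : Tm
  | sumInd (A B C l r u : Tm) : Tm
  | nat : Tm
  | zero : Tm
  | succ (n : Tm) : Tm
  | natInd (C z s n : Tm) : Tm
  /-- The graph quotient of the graph with vertices `V` and edges `E : V → V → 𝒰`. -/
  | gq (V E : Tm) : Tm
  /-- The point of the graph quotient given by the vertex `i`. -/
  | pt (V E i : Tm) : Tm
  /-- The path in the graph quotient given by the edge `e` from `i` to `j`. -/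
  | edge (V E i j e : Tm) : Tm
  /-- Induction for the graph quotient. -/
  | gqInd (V E C c d q : Tm) : Tm
  /-- The propositional computation rule of `gqInd` on edges. -/
  | gqIndEdge (V E C c d i j e : Tm) : Tm
  /-- Function extensionality for `pi A B`. -/
  | funext (A B : Tm) : Tm
  /-- Univalence of `𝒰`. -/
  | ua : Tm

namespace Tm

/-! ### Renaming and substitution -/

/-- Extend a renaming under one binder. -/
def liftRen (ρ : ℕ → ℕ) : ℕ → ℕ
  | 0 => 0
  | n + 1 => ρ n + 1

/-- Renaming of variables. -/
def rename (ρ : ℕ → ℕ) : Tm → Tm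
  | var n => var (ρ n)
  | sort s => sort s
  | pi A B => pi (A.rename ρ) (B.rename (liftRen ρ))
  | lam A t => lam (A.rename ρ) (t.rename (liftRen ρ))
  | app f a => app (f.rename ρ) (a.rename ρ)
  | sigma A B => sigma (A.rename ρ) (B.rename (liftRen ρ))
  | pair A B a b => pair (A.rename ρ) (B.rename (liftRen ρ)) (a.rename ρ) (b.rename ρ)
  | split A B C d p =>
      split (A.rename ρ) (B.rename (liftRen ρ)) (C.rename (liftRen ρ)) (d.rename ρ) (p.rename ρ)
  | Id A a b => Id (A.rename ρ) (a.rename ρ) (b.rename ρ)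
  | refl A a => refl (A.rename ρ) (a.rename ρ)
  | J A a C d b p =>
      J (A.rename ρ) (a.rename ρ) (C.rename (liftRen (liftRen ρ))) (d.rename ρ)
        (b.rename ρ) (p.rename ρ)
  | empty => empty
  | emptyInd C e => emptyInd (C.rename (liftRen ρ)) (e.rename ρ)
  | unit => unit
  | star => star
  | unitInd C c u => unitInd (C.rename (liftRen ρ)) (c.rename ρ) (u.rename ρ)
  | sum A B => sum (A.rename ρ) (B.rename ρ)
  | inl A B a => inl (A.rename ρ) (B.rename ρ) (a.rename ρ)
  | inr A B b => inr (A.rename ρ) (B.rename ρ) (b.rename ρ)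
  | sumInd A B C l r u =>
      sumInd (A.rename ρ) (B.rename ρ) (C.rename (liftRen ρ)) (l.rename ρ) (r.rename ρ)
        (u.rename ρ)
  | nat => nat
  | zero => zero
  | succ n => succ (n.rename ρ)
  | natInd C z s n => natInd (C.rename (liftRen ρ)) (z.rename ρ) (s.rename ρ) (n.rename ρ)
  | gq V E => gq (V.rename ρ) (E.rename ρ)
  | pt V E i => pt (V.rename ρ) (E.rename ρ) (i.rename ρ)
  | edge V E i j e =>
      edge (V.rename ρ) (E.rename ρ) (i.rename ρ) (j.rename ρ) (e.rename ρ)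
  | gqInd V E C c d q =>
      gqInd (V.rename ρ) (E.rename ρ) (C.rename (liftRen ρ)) (c.rename ρ) (d.rename ρ)
        (q.rename ρ)
  | gqIndEdge V E C c d i j e =>
      gqIndEdge (V.rename ρ) (E.rename ρ) (C.rename (liftRen ρ)) (c.rename ρ) (d.rename ρ)
        (i.rename ρ) (j.rename ρ) (e.rename ρ)
  | funext A B => funext (A.rename ρ) (B.rename (liftRen ρ))
  | ua => ua

/-- Weakening by `k` variables. -/
def up (k : ℕ) (t : Tm) : Tm := t.rename (fun n => n + k)

/-- Weakening by `k` variables below the last variable. -/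
def upUnder (k : ℕ) (t : Tm) : Tm := t.rename (liftRen (fun n => n + k))

/-- Extend a substitution under one binder. -/
def liftSub (σ : ℕ → Tm) : ℕ → Tm
  | 0 => var 0
  | n + 1 => (σ n).up 1

/-- Simultaneous capture-avoiding substitution. -/
def subst (σ : ℕ → Tm) : Tm → Tm
  | var n => σ n
  | sort s => sort s
  | pi A B => pi (A.subst σ) (B.subst (liftSub σ))
  | lam A t => lam (A.subst σ) (t.subst (liftSub σ))
  | app f a => app (f.subst σ) (a.subst σ)
  | sigma A B => sigma (A.subst σ) (B.subst (liftSub σ))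
  | pair A B a b => pair (A.subst σ) (B.subst (liftSub σ)) (a.subst σ) (b.subst σ)
  | split A B C d p =>
      split (A.subst σ) (B.subst (liftSub σ)) (C.subst (liftSub σ)) (d.subst σ) (p.subst σ)
  | Id A a b => Id (A.subst σ) (a.subst σ) (b.subst σ)
  | refl A a => refl (A.subst σ) (a.subst σ)
  | J A a C d b p =>
      J (A.subst σ) (a.subst σ) (C.subst (liftSub (liftSub σ))) (d.subst σ)
        (b.subst σ) (p.subst σ)
  | empty => empty
  | emptyInd C e => emptyInd (C.subst (liftSub σ)) (e.subst σ)
  | unit => unit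
  | star => star
  | unitInd C c u => unitInd (C.subst (liftSub σ)) (c.subst σ) (u.subst σ)
  | sum A B => sum (A.subst σ) (B.subst σ)
  | inl A B a => inl (A.subst σ) (B.subst σ) (a.subst σ)
  | inr A B b => inr (A.subst σ) (B.subst σ) (b.subst σ)
  | sumInd A B C l r u =>
      sumInd (A.subst σ) (B.subst σ) (C.subst (liftSub σ)) (l.subst σ) (r.subst σ)
        (u.subst σ)
  | nat => nat
  | zero => zero
  | succ n => succ (n.subst σ)
  | natInd C z s n => natInd (C.subst (liftSub σ)) (z.subst σ) (s.subst σ) (n.subst σ)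
  | gq V E => gq (V.subst σ) (E.subst σ)
  | pt V E i => pt (V.subst σ) (E.subst σ) (i.subst σ)
  | edge V E i j e =>
      edge (V.subst σ) (E.subst σ) (i.subst σ) (j.subst σ) (e.subst σ)
  | gqInd V E C c d q =>
      gqInd (V.subst σ) (E.subst σ) (C.subst (liftSub σ)) (c.subst σ) (d.subst σ)
        (q.subst σ)
  | gqIndEdge V E C c d i j e =>
      gqIndEdge (V.subst σ) (E.subst σ) (C.subst (liftSub σ)) (c.subst σ) (d.subst σ)
        (i.subst σ) (j.subst σ) (e.subst σ)
  | funext A B => funext (A.subst σ) (B.subst (liftSub σ))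
  | ua => ua

/-- The substitution `0 ↦ u`, `n + 1 ↦ var n`. -/
def single (u : Tm) : ℕ → Tm
  | 0 => u
  | n + 1 => var n

/-- `t.inst u` is `t[u]`: the last variable of `t` is replaced by `u`. -/
def inst (t u : Tm) : Tm := t.subst (single u)

/-- The substitution `0 ↦ v`, `1 ↦ u`, `n + 2 ↦ var n`. -/
def double (u v : Tm) : ℕ → Tm
  | 0 => v
  | 1 => u
  | n + 2 => var n

/-- `t.inst₂ u v` is `t[u, v]`: the last two variables of `t` are replaced by `u` and `v`. -/
def inst₂ (t u v : Tm) : Tm := t.subst (double u v)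

/-- For `C` over `nat`, the family `(n : nat), C(n) ⊢ C(n + 1)`. -/
def natStep (C : Tm) : Tm :=
  C.subst fun
    | 0 => succ (var 1)
    | n + 1 => var (n + 2)

/-! ### Definable operations

In what follows, a construction takes terms of an arbitrary context `Γ` to a term of `Γ`.
An argument named `C` or a codomain `B` of `sigma A B` lives in `Γ` extended by one variable. -/

/-- The universe `𝒰`. -/
def univ : Tm := sort Size.small

/-- The function type `A → B`. -/
def arrow (A B : Tm) : Tm := pi A (B.up 1)

/-- The product type `A × B`. -/
def prod (A B : Tm) : Tm := sigma A (B.up 1)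

/-- First projection of `p : Σ (x : A), B(x)`. -/
def fst (A B p : Tm) : Tm := split A B (A.up 1) (lam A (lam B (var 1))) p

/-- Second projection of `p : Σ (x : A), B(x)`, an element of `B(fst p)`. -/
def snd (A B p : Tm) : Tm :=
  split A B ((B.upUnder 1).inst (fst (A.up 1) (B.upUnder 1) (var 0))) (lam A (lam B (var 0))) p

/-- Transport of `u : C(a)` along `p : a = b` in `A`. -/
def tr (A C a b p u : Tm) : Tm := J A a (C.up 1) u b p

/-- The inverse of a path `p : a = b`. -/
def inv (A a b p : Tm) : Tm := J A a (Id (A.up 2) (var 1) (a.up 2)) (refl A a) b p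

/-- The concatenation of paths `p : a = b` and `q : b = c`. -/
def concat (A a b c p q : Tm) : Tm := J A b (Id (A.up 2) (a.up 2) (var 1)) p c q

/-- The action of `f : A → B` on a path `p : a = b`, a path `f a = f b`. -/
def ap (A B f a b p : Tm) : Tm :=
  J A a (Id (B.up 2) (app (f.up 2) (a.up 2)) (app (f.up 2) (var 1))) (refl B (app f a)) b p

/-- The action of a section `f : Π (x : A), C(x)` on a path `p : a = b`,
a path `tr p (f a) = f b` in `C(b)`. -/
def apd (A C f a b p : Tm) : Tm :=
  J A a
    (Id (C.up 1)
      (tr (A.up 2) (C.upUnder 2) (a.up 2) (var 1) (var 0) (app (f.up 2) (a.up 2)))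
      (app (f.up 2) (var 1)))
    (refl (C.inst a) (app f a)) b p

/-- The path `tr p u = u` for `u : T` and the constant family `T` over `A`. -/
def trConst (A T a b p u : Tm) : Tm :=
  J A a (Id (T.up 2) (tr (A.up 2) (T.up 3) (a.up 2) (var 1) (var 0) (u.up 2)) (u.up 2))
    (refl T u) b p

/-- The fiber `Σ (x : A), f x = y` of `f : A → B` at `y : B`. -/
def fib (A B f y : Tm) : Tm := sigma A (Id (B.up 1) (app (f.up 1) (var 0)) (y.up 1))

/-- `f : A → B` has a right inverse: `Σ (s : B → A), Π (y : B), f (s y) = y`. -/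
def hasSec (A B f : Tm) : Tm :=
  sigma (arrow B A)
    (pi (B.up 1) (Id (B.up 2) (app (f.up 2) (app (var 1) (var 0))) (var 0)))

/-- `f : A → B` has a left inverse: `Σ (r : B → A), Π (x : A), r (f x) = x`. -/
def hasRetr (A B f : Tm) : Tm :=
  sigma (arrow B A)
    (pi (A.up 1) (Id (A.up 2) (app (var 1) (app (f.up 2) (var 0))) (var 0)))

/-- `f : A → B` is an equivalence: it has a right inverse and a left inverse. -/
def isEquiv (A B f : Tm) : Tm := prod (hasSec A B f) (hasRetr A B f)

/-- The type `A ≃ B` of equivalences. -/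
def equiv (A B : Tm) : Tm := sigma (arrow A B) (isEquiv (A.up 1) (B.up 1) (var 0))

/-- The identity function of `A`. -/
def idFun (A : Tm) : Tm := lam A (var 0)

/-- The pair of the identity function of `A` with a proof that it is inverse to itself;
`(r, H)` with `H x : r (id x) = x` and with `H x : id (r x) = x` are given by the same term. -/
def idEquiv (A : Tm) : Tm :=
  let F := lam A (refl (A.up 1) (var 0))
  let A' := A.up 1
  let s := pair (arrow A A)
    (pi A' (Id (A.up 2) (app (idFun (A.up 2)) (app (var 1) (var 0))) (var 0))) (idFun A) F
  let r := pair (arrow A A)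
    (pi A' (Id (A.up 2) (app (var 1) (app (idFun (A.up 2)) (var 0))) (var 0))) (idFun A) F
  pair (arrow A A) (isEquiv A' A' (var 0)) (idFun A)
    (pair (hasSec A A (idFun A)) ((hasRetr A A (idFun A)).up 1) s r)

/-- The canonical map `(A = B) → (A ≃ B)`, for `A B : 𝒰`. -/
def idToEquiv (A B : Tm) : Tm :=
  lam (Id univ A B)
    (J univ (A.up 1) (equiv (A.up 3) (var 1)) (idEquiv (A.up 1)) (B.up 1) (var 0))

/-- The univalence axiom: `idToEquiv A B` is an equivalence for all `A B : 𝒰`. -/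
def univalence : Tm :=
  pi univ (pi univ
    (isEquiv (Id univ (var 1) (var 0)) (equiv (var 1) (var 0)) (idToEquiv (var 1) (var 0))))

/-- Pointwise equality `Π (x : A), f x = g x` of `f g : Π (x : A), B(x)`. -/
def homotopy (A B f g : Tm) : Tm := pi A (Id B (app (f.up 1) (var 0)) (app (g.up 1) (var 0)))

/-- The canonical map `(f = g) → Π (x : A), f x = g x`. -/
def happly (A B f g : Tm) : Tm :=
  lam (Id (pi A B) f g)
    (J ((pi A B).up 1) (f.up 1)
      (homotopy (A.up 3) (B.upUnder 3) (f.up 3) (var 1))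
      (lam (A.up 1) (refl (B.upUnder 1) (app (f.up 2) (var 0))))
      (g.up 1) (var 0))

/-- Function extensionality for `Π (x : A), B(x)`: the map `happly f g` is an equivalence
for all `f g`. -/
def funextType (A B : Tm) : Tm :=
  let P := pi A B
  pi P (pi (P.up 1)
    (isEquiv (Id (P.up 2) (var 1) (var 0))
      (homotopy (A.up 2) (B.upUnder 2) (var 1) (var 0))
      (happly (A.up 2) (B.upUnder 2) (var 1) (var 0))))

/-- The type of the datum of `gqInd` over edges, for `C` over `gq V E` and the datum
`c : Π (i : V), C(pt i)` over vertices: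
`Π (i j : V) (e : E i j), tr C (edge e) (c i) = c j`. -/
def gqEdgeData (V E C c : Tm) : Tm :=
  pi V (pi (V.up 1) (pi (app (app (E.up 2) (var 1)) (var 0))
    (let V' := V.up 3
     let E' := E.up 3
     let i := var 2
     let j := var 1
     let e := var 0
     Id ((C.upUnder 3).inst (pt V' E' j))
       (tr (gq V' E') (C.upUnder 3) (pt V' E' i) (pt V' E' j) (edge V' E' i j e)
         (app (c.up 3) i))
       (app (c.up 3) j))))

/-- The section `λ q, gqInd V E C c d q` of `C`. -/
def gqSec (V E C c d : Tm) : Tm :=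
  lam (gq V E) (gqInd (V.up 1) (E.up 1) (C.upUnder 1) (c.up 1) (d.up 1) (var 0))

end Tm

open Tm

/-! ### Judgemental equality -/

/-- Convertibility: the congruence generated by the computation (`β`) rules. No `η` rule is
assumed, so that derivability is derivability from fewer rules. -/
inductive Conv : Tm → Tm → Prop
  | rfl (t) : Conv t t
  | symm {t u} : Conv t u → Conv u t
  | trans {t u v} : Conv t u → Conv u v → Conv t v
  -- computation rules
  | app_lam (A t a) : Conv (app (lam A t) a) (t.inst a)
  | split_pair (A B C d A' B' a b) :
      Conv (split A B C d (pair A' B' a b)) (app (app d a) b)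
  | J_refl (A a C d b A' a') : Conv (J A a C d b (refl A' a')) d
  | unitInd_star (C c) : Conv (unitInd C c star) c
  | sumInd_inl (A B C l r A' B' a) : Conv (sumInd A B C l r (inl A' B' a)) (app l a)
  | sumInd_inr (A B C l r A' B' b) : Conv (sumInd A B C l r (inr A' B' b)) (app r b)
  | natInd_zero (C z s) : Conv (natInd C z s zero) z
  | natInd_succ (C z s n) :
      Conv (natInd C z s (succ n)) (app (app s n) (natInd C z s n))
  | gqInd_pt (V E C c d V' E' i) : Conv (gqInd V E C c d (pt V' E' i)) (app c i)
  -- congruence rules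
  | pi {A A' B B'} : Conv A A' → Conv B B' → Conv (pi A B) (pi A' B')
  | lam {A A' t t'} : Conv A A' → Conv t t' → Conv (lam A t) (lam A' t')
  | app {f f' a a'} : Conv f f' → Conv a a' → Conv (app f a) (app f' a')
  | sigma {A A' B B'} : Conv A A' → Conv B B' → Conv (sigma A B) (sigma A' B')
  | pair {A A' B B' a a' b b'} : Conv A A' → Conv B B' → Conv a a' → Conv b b' →
      Conv (pair A B a b) (pair A' B' a' b')
  | split {A A' B B' C C' d d' p p'} : Conv A A' → Conv B B' → Conv C C' → Conv d d' →
      Conv p p' → Conv (split A B C d p) (split A' B' C' d' p')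
  | Id {A A' a a' b b'} : Conv A A' → Conv a a' → Conv b b' → Conv (Id A a b) (Id A' a' b')
  | refl {A A' a a'} : Conv A A' → Conv a a' → Conv (refl A a) (refl A' a')
  | J {A A' a a' C C' d d' b b' p p'} : Conv A A' → Conv a a' → Conv C C' → Conv d d' →
      Conv b b' → Conv p p' → Conv (J A a C d b p) (J A' a' C' d' b' p')
  | emptyInd {C C' e e'} : Conv C C' → Conv e e' → Conv (emptyInd C e) (emptyInd C' e')
  | unitInd {C C' c c' u u'} : Conv C C' → Conv c c' → Conv u u' →
      Conv (unitInd C c u) (unitInd C' c' u')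
  | sum {A A' B B'} : Conv A A' → Conv B B' → Conv (sum A B) (sum A' B')
  | inl {A A' B B' a a'} : Conv A A' → Conv B B' → Conv a a' →
      Conv (inl A B a) (inl A' B' a')
  | inr {A A' B B' b b'} : Conv A A' → Conv B B' → Conv b b' →
      Conv (inr A B b) (inr A' B' b')
  | sumInd {A A' B B' C C' l l' r r' u u'} : Conv A A' → Conv B B' → Conv C C' →
      Conv l l' → Conv r r' → Conv u u' →
      Conv (sumInd A B C l r u) (sumInd A' B' C' l' r' u')
  | succ {n n'} : Conv n n' → Conv (succ n) (succ n')
  | natInd {C C' z z' s s' n n'} : Conv C C' → Conv z z' → Conv s s' → Conv n n' →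
      Conv (natInd C z s n) (natInd C' z' s' n')
  | gq {V V' E E'} : Conv V V' → Conv E E' → Conv (gq V E) (gq V' E')
  | pt {V V' E E' i i'} : Conv V V' → Conv E E' → Conv i i' →
      Conv (pt V E i) (pt V' E' i')
  | edge {V V' E E' i i' j j' e e'} : Conv V V' → Conv E E' → Conv i i' → Conv j j' →
      Conv e e' → Conv (edge V E i j e) (edge V' E' i' j' e')
  | gqInd {V V' E E' C C' c c' d d' q q'} : Conv V V' → Conv E E' → Conv C C' →
      Conv c c' → Conv d d' → Conv q q' →
      Conv (gqInd V E C c d q) (gqInd V' E' C' c' d' q')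
  | gqIndEdge {V V' E E' C C' c c' d d' i i' j j' e e'} : Conv V V' → Conv E E' →
      Conv C C' → Conv c c' → Conv d d' → Conv i i' → Conv j j' → Conv e e' →
      Conv (gqIndEdge V E C c d i j e) (gqIndEdge V' E' C' c' d' i' j' e')
  | funext {A A' B B'} : Conv A A' → Conv B B' → Conv (funext A B) (funext A' B')

/-! ### Typing -/

/-- A context lists the types of its variables, the last variable first. -/
abbrev Ctx : Type := List Tm

/-- The typing judgement `Γ ⊢ t : T`. For `T = sort small` it says that `t` is a type in `𝒰`,
for `T = sort large` that `t` is a type. Each rule that extends a context by a type also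
requires that type to be well-formed, so a derivation with empty context at its root
visits well-formed contexts only. -/
inductive HasType : Ctx → Tm → Tm → Prop
  | var {Γ n A} : Γ[n]? = some A → HasType Γ (var n) (A.up (n + 1))
  | conv {Γ t A B s} : HasType Γ t A → HasType Γ B (sort s) → Conv A B → HasType Γ t B
  -- the universe is a type, and its members are types
  | univ {Γ} : HasType Γ (sort .small) (sort .large)
  | el {Γ A} : HasType Γ A (sort .small) → HasType Γ A (sort .large)
  -- dependent function types
  | pi {Γ A B s} : HasType Γ A (sort s) → HasType (A :: Γ) B (sort s) →
      HasType Γ (pi A B) (sort s)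
  | lam {Γ A B t} : HasType Γ A (sort .large) → HasType (A :: Γ) B (sort .large) →
      HasType (A :: Γ) t B → HasType Γ (lam A t) (pi A B)
  | app {Γ A B f a} : HasType Γ f (pi A B) → HasType Γ a A → HasType Γ (app f a) (B.inst a)
  -- dependent pair types
  | sigma {Γ A B s} : HasType Γ A (sort s) → HasType (A :: Γ) B (sort s) →
      HasType Γ (sigma A B) (sort s)
  | pair {Γ A B a b} : HasType Γ A (sort .large) → HasType (A :: Γ) B (sort .large) →
      HasType Γ a A → HasType Γ b (B.inst a) → HasType Γ (pair A B a b) (sigma A B)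
  | split {Γ A B C d p} : HasType Γ A (sort .large) → HasType (A :: Γ) B (sort .large) →
      HasType (sigma A B :: Γ) C (sort .large) →
      HasType Γ d (pi A (pi B
        ((C.upUnder 2).inst (pair (A.up 2) (B.upUnder 2) (var 1) (var 0))))) →
      HasType Γ p (sigma A B) → HasType Γ (split A B C d p) (C.inst p)
  -- identity types
  | Id {Γ A a b s} : HasType Γ A (sort s) → HasType Γ a A → HasType Γ b A →
      HasType Γ (Id A a b) (sort s)
  | refl {Γ A a} : HasType Γ A (sort .large) → HasType Γ a A →
      HasType Γ (refl A a) (Id A a a)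
  | J {Γ A a C d b p} : HasType Γ A (sort .large) → HasType Γ a A →
      HasType (Id (A.up 1) (a.up 1) (var 0) :: A :: Γ) C (sort .large) →
      HasType Γ d (C.inst₂ a (refl A a)) → HasType Γ b A → HasType Γ p (Id A a b) →
      HasType Γ (J A a C d b p) (C.inst₂ b p)
  -- the empty type
  | empty {Γ} : HasType Γ empty (sort .small)
  | emptyInd {Γ C e} : HasType (Tm.empty :: Γ) C (sort .large) → HasType Γ e Tm.empty →
      HasType Γ (emptyInd C e) (C.inst e)
  -- the unit type
  | unit {Γ} : HasType Γ unit (sort .small)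
  | star {Γ} : HasType Γ star Tm.unit
  | unitInd {Γ C c u} : HasType (Tm.unit :: Γ) C (sort .large) →
      HasType Γ c (C.inst Tm.star) → HasType Γ u Tm.unit →
      HasType Γ (unitInd C c u) (C.inst u)
  -- disjoint sums
  | sum {Γ A B s} : HasType Γ A (sort s) → HasType Γ B (sort s) →
      HasType Γ (sum A B) (sort s)
  | inl {Γ A B a} : HasType Γ A (sort .large) → HasType Γ B (sort .large) →
      HasType Γ a A → HasType Γ (inl A B a) (sum A B)
  | inr {Γ A B b} : HasType Γ A (sort .large) → HasType Γ B (sort .large) →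
      HasType Γ b B → HasType Γ (inr A B b) (sum A B)
  | sumInd {Γ A B C l r u} : HasType Γ A (sort .large) → HasType Γ B (sort .large) →
      HasType (sum A B :: Γ) C (sort .large) →
      HasType Γ l (pi A ((C.upUnder 1).inst (inl (A.up 1) (B.up 1) (var 0)))) →
      HasType Γ r (pi B ((C.upUnder 1).inst (inr (A.up 1) (B.up 1) (var 0)))) →
      HasType Γ u (sum A B) → HasType Γ (sumInd A B C l r u) (C.inst u)
  -- natural numbers
  | nat {Γ} : HasType Γ nat (sort .small)
  | zero {Γ} : HasType Γ zero Tm.nat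
  | succ {Γ n} : HasType Γ n Tm.nat → HasType Γ (succ n) Tm.nat
  | natInd {Γ C z s n} : HasType (Tm.nat :: Γ) C (sort .large) →
      HasType Γ z (C.inst Tm.zero) → HasType Γ s (pi Tm.nat (pi C (natStep C))) →
      HasType Γ n Tm.nat → HasType Γ (natInd C z s n) (C.inst n)
  -- graph quotients
  | gq {Γ V E} : HasType Γ V (sort .small) → HasType Γ E (arrow V (arrow V univ)) →
      HasType Γ (gq V E) (sort .small)
  | pt {Γ V E i} : HasType Γ V (sort .small) → HasType Γ E (arrow V (arrow V univ)) →
      HasType Γ i V → HasType Γ (pt V E i) (gq V E)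
  | edge {Γ V E i j e} : HasType Γ V (sort .small) → HasType Γ E (arrow V (arrow V univ)) →
      HasType Γ i V → HasType Γ j V → HasType Γ e (app (app E i) j) →
      HasType Γ (edge V E i j e) (Id (gq V E) (pt V E i) (pt V E j))
  | gqInd {Γ V E C c d q} : HasType Γ V (sort .small) →
      HasType Γ E (arrow V (arrow V univ)) →
      HasType (gq V E :: Γ) C (sort .large) →
      HasType Γ c (pi V ((C.upUnder 1).inst (pt (V.up 1) (E.up 1) (var 0)))) →
      HasType Γ d (gqEdgeData V E C c) → HasType Γ q (gq V E) →
      HasType Γ (gqInd V E C c d q) (C.inst q)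
  | gqIndEdge {Γ V E C c d i j e} : HasType Γ V (sort .small) →
      HasType Γ E (arrow V (arrow V univ)) →
      HasType (gq V E :: Γ) C (sort .large) →
      HasType Γ c (pi V ((C.upUnder 1).inst (pt (V.up 1) (E.up 1) (var 0)))) →
      HasType Γ d (gqEdgeData V E C c) →
      HasType Γ i V → HasType Γ j V → HasType Γ e (app (app E i) j) →
      HasType Γ (gqIndEdge V E C c d i j e)
        (Id
          (Id (C.inst (pt V E j))
            (tr (gq V E) C (pt V E i) (pt V E j) (edge V E i j e) (app c i)) (app c j))
          (apd (gq V E) C (gqSec V E C c d) (pt V E i) (pt V E j) (edge V E i j e))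
          (app (app (app d i) j) e))
  -- function extensionality, for dependent function types of any size, and univalence
  | funext {Γ A B} : HasType Γ A (sort .large) → HasType (A :: Γ) B (sort .large) →
      HasType Γ (funext A B) (funextType A B)
  | ua {Γ} : HasType Γ ua univalence

/-- A closed type is inhabited, that is, provable in the type theory,
if it has a closed element. -/
def IsInhabited (T : Tm) : Prop := ∃ t : Tm, HasType [] t T

namespace Tm

/-! ### Pushouts, joins, connectedness -/

/-- In the context with `c : C` as last variable, the type
`(inl (f c) = v) × (inr (g c) = w)`, for `v w : A + B`. -/
def pushoutEqs (A B f g v w : Tm) : Tm :=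
  let A' := A.up 1
  let B' := B.up 1
  prod
    (Id (sum A' B') (inl A' B' (app (f.up 1) (var 0))) (v.up 1))
    (Id (sum A' B') (inr A' B' (app (g.up 1) (var 0))) (w.up 1))

/-- The edges of the graph with vertices `A + B` whose graph quotient is the pushout of
`f : C → A` and `g : C → B`: the type of edges from `v` to `w` is
`Σ (c : C), (inl (f c) = v) × (inr (g c) = w)`. -/
def pushoutEdges (A B C f g v w : Tm) : Tm := sigma C (pushoutEqs A B f g v w)

/-- The edge relation `λ v w, pushoutEdges v w`. -/
def pushoutRel (A B C f g : Tm) : Tm :=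
  lam (sum A B) (lam ((sum A B).up 1)
    (pushoutEdges (A.up 2) (B.up 2) (C.up 2) (f.up 2) (g.up 2) (var 1) (var 0)))

/-- The pushout of `f : C → A` and `g : C → B`, as a graph quotient. -/
def pushout (A B C f g : Tm) : Tm := gq (sum A B) (pushoutRel A B C f g)

/-- The map `A + B → T` given by `h : A → T` and `k : B → T`. -/
def sumRec (A B T h k : Tm) : Tm :=
  lam (sum A B) (sumInd (A.up 1) (B.up 1) (T.up 2) (h.up 1) (k.up 1) (var 0))

/-- In a context with vertices `v w` and an edge `e` from `v` to `w`, the path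
`tr (edge e) (sumRec h k v) = sumRec h k w` obtained by concatenating
`tr (edge e) (sumRec h k v) = sumRec h k v = h (f c) = k (g c) = sumRec h k w`, where
`c : C` is the first component of `e`, and `H : Π (c : C), h (f c) = k (g c)`. -/
def pushoutRecPath (A B C f g T h k H v w e : Tm) : Tm :=
  let V := sum A B
  let E := pushoutRel A B C f g
  let m := sumRec A B T h k
  let S := pushoutEqs A B f g v w
  let Pv := fun c : Tm => Id V (inl A B (app f c)) v
  let Pw := fun c : Tm => Id V (inr A B (app g c)) w
  let c := fst C S e
  let p := fst (Pv c) ((Pw c).up 1) (snd C S e)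
  let q := snd (Pv c) ((Pw c).up 1) (snd C S e)
  let x₀ := tr (gq V E) (T.up 1) (pt V E v) (pt V E w) (edge V E v w e) (app m v)
  let x₁ := app m v
  let x₂ := app h (app f c)
  let x₃ := app k (app g c)
  let x₄ := app m w
  concat T x₀ x₁ x₄ (trConst (gq V E) T (pt V E v) (pt V E w) (edge V E v w e) x₁)
    (concat T x₁ x₂ x₄ (inv T x₂ x₁ (ap V T m (inl A B (app f c)) v p))
      (concat T x₂ x₃ x₄ (app H c) (ap V T m (inr A B (app g c)) w q)))

/-- The map `pushout A B C f g → T` induced by `h : A → T`, `k : B → T` and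
`H : Π (c : C), h (f c) = k (g c)`. -/
def pushoutRec (A B C f g T h k H : Tm) : Tm :=
  gqSec (sum A B) (pushoutRel A B C f g) (T.up 1) (sumRec A B T h k)
    (lam (sum A B) (lam ((sum A B).up 1)
      (lam (app (app ((pushoutRel A B C f g).up 2) (var 1)) (var 0))
        (pushoutRecPath (A.up 3) (B.up 3) (C.up 3) (f.up 3) (g.up 3) (T.up 3) (h.up 3)
          (k.up 3) (H.up 3) (var 2) (var 1) (var 0)))))

/-- The join `A * B`: the pushout of the projections of `A × B`. -/
def join (A B : Tm) : Tm :=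
  pushout A B (prod A B)
    (lam (prod A B) (fst (A.up 1) (B.up 2) (var 0)))
    (lam (prod A B) (snd (A.up 1) (B.up 2) (var 0)))

/-- In the context with `a : A` as last variable, the type `Σ (b : B), f a = g b`. -/
def pullbackOver (B X f g : Tm) : Tm :=
  sigma (B.up 1) (Id (X.up 2) (app (f.up 2) (var 1)) (app (g.up 2) (var 0)))

/-- The pullback `A ×_X B`, that is `Σ (a : A), Σ (b : B), f a = g b`. -/
def pullback (A B X f g : Tm) : Tm := sigma A (pullbackOver B X f g)

/-- The first component in `A` of `z : A ×_X B`. -/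
def pullbackFst (A B X f g z : Tm) : Tm := fst A (pullbackOver B X f g) z

/-- The equation `f a = g b` for `a` the first component of `z`, as a family over `b : B`. -/
def pullbackEq (A B X f g z : Tm) : Tm :=
  Id (X.up 1) (app (f.up 1) ((pullbackFst A B X f g z).up 1)) (app (g.up 1) (var 0))

/-- The second component in `B` of `z : A ×_X B`. -/
def pullbackSnd (A B X f g z : Tm) : Tm :=
  fst B (pullbackEq A B X f g z) (snd A (pullbackOver B X f g) z)

/-- The path `f (pullbackFst z) = g (pullbackSnd z)` for `z : A ×_X B`. -/
def pullbackPath (A B X f g z : Tm) : Tm :=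
  snd B (pullbackEq A B X f g z) (snd A (pullbackOver B X f g) z)

/-- The projection `π₁ : A ×_X B → A`. -/
def pullbackπ₁ (A B X f g : Tm) : Tm :=
  lam (pullback A B X f g)
    (pullbackFst (A.up 1) (B.up 1) (X.up 1) (f.up 1) (g.up 1) (var 0))

/-- The projection `π₂ : A ×_X B → B`. -/
def pullbackπ₂ (A B X f g : Tm) : Tm :=
  lam (pullback A B X f g)
    (pullbackSnd (A.up 1) (B.up 1) (X.up 1) (f.up 1) (g.up 1) (var 0))

/-- The homotopy `f ∘ π₁ ~ g ∘ π₂`. -/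
def pullbackHtpy (A B X f g : Tm) : Tm :=
  lam (pullback A B X f g)
    (pullbackPath (A.up 1) (B.up 1) (X.up 1) (f.up 1) (g.up 1) (var 0))

/-- The domain `A *_X B` of the join of `f : A → X` and `g : B → X`:
the pushout of the projections of `A ×_X B`. -/
def joinDomain (A B X f g : Tm) : Tm :=
  pushout A B (pullback A B X f g) (pullbackπ₁ A B X f g) (pullbackπ₂ A B X f g)

/-- The join `f * g : A *_X B → X` of `f : A → X` and `g : B → X`: the map induced by
`f`, `g` and the homotopy of the pullback square. -/
def joinMap (A B X f g : Tm) : Tm :=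
  pushoutRec A B (pullback A B X f g) (pullbackπ₁ A B X f g) (pullbackπ₂ A B X f g)
    X f g (pullbackHtpy A B X f g)

/-- `A` is `M`-local: the map `λ a x, a : A → (M → A)` is an equivalence. -/
def isLocal (M A : Tm) : Tm := isEquiv A (arrow M A) (lam A (lam (M.up 1) (var 1)))

/-- The type `A` is `M`-connected: every `M`-local type in `𝒰` is `A`-local. -/
def isConn (M A : Tm) : Tm :=
  pi univ (arrow (isLocal (M.up 1) (var 0)) (isLocal (A.up 1) (var 0)))

/-- The map `f : A → X` is `M`-connected: all its fibers are `M`-connected. -/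
def isConnMap (M A X f : Tm) : Tm :=
  pi X (isConn (M.up 1) (fib (A.up 1) (X.up 1) (f.up 1) (var 0)))

/-- If `f : A → X` is `M`-connected and `g : B → X` is `N`-connected, then `f * g` is
`(M * N)`-connected. -/
def joinConn (M N A B X f g : Tm) : Tm :=
  arrow (isConnMap M A X f) (arrow (isConnMap N B X g)
    (isConnMap (join M N) (joinDomain A B X f g) X (joinMap A B X f g)))

/-- The closed type
`Π (M N A B X : 𝒰) (f : A → X) (g : B → X), joinConn M N A B X f g`. -/
def joinConnectivity : Tm :=
  pi univ (pi univ (pi univ (pi univ (pi univ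
    (pi (arrow (var 2) (var 0)) (pi (arrow (var 2) (var 1))
      (joinConn (var 6) (var 5) (var 4) (var 3) (var 2) (var 1) (var 0))))))))

end Tm

end HoTT

namespace HoTT

namespace Tm

/-! ### The substitution calculus -/

/-! Mathematical argument. Call `Ext K Z` the property that every map `K → Z` is homotopic to a
constant one. Together with a weak form of it for the path types of `Z` it makes `Z` a `K`-local
type (`localOfExt`), and path types of local types are local (`localPath`). A map out of `M * N`
into `Z` amounts to `v : N → Z` and a map from `M` to the type of cones over `v`, that is, of points
`z` with a homotopy from the constant map at `z` to `v`. `JoinExt M N Z` says that all such maps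
from `M` are constant. It follows from `(M * N)`-locality of `Z` (`localJoinExt`) and is symmetric
in `M` and `N` (`joinExtSwap`). If it holds for all `K`-local `Z`, then cone types over `K`-local
types are `M`-local (`coneLocal`), hence `F`-local for every `M`-connected `F`; so `M` may be
replaced by `F` (`joinExtOfConn`). For `K = M * N` and the fibers `F`, `G` of `f`, `g` at `x`,
replacing `M` by `F` and, after a swap, `N` by `G` shows that every `K`-local `Z` satisfies `JoinExt
F G Z` (`connOfJoinExt`).

It remains to extend maps `ψ : W → Z` from the fiber `W` of `f * g` at `x` (`fibExt`); the
equivalence of `W` with `F * G` is not needed for this. The map `ψ` restricts to `F` and `G`, and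
any point `(a, r)` of `F` is joined in `W` to any point `(b, s)` of `G`, through the point `(a, b,
e)` of the pullback with `r = e ∙ s`. `JoinExt F G Z` yields a point `z` with compatible homotopies
to both restrictions, and pushout induction turns these into paths `z = ψ (y, r)` for all `(y, r)`
in `W`.

Formal argument. Derivability is established by reflection: a type checker is proved sound
(`infer_sound`), and each lemma of the object theory is a closed type for which an elaborated term
passes the checker when evaluated by the kernel. Earlier lemmas enter as variables of the context
and are eliminated by substitution (`cut`), which rests on the stability of typing under
substitution. -/

theorem liftSub_var (ρ : ℕ → ℕ) :
    liftSub (fun n => var (ρ n)) = fun n => var (liftRen ρ n) := by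
  funext n; cases n <;> simp [liftSub, liftRen, up, rename]

/-- The fusion laws have to come in the order renaming as substitution, substitution after renaming,
renaming after substitution, substitution after substitution: each one supplies the binder case of
the next. -/
theorem rename_eq_subst (t : Tm) : ∀ ρ : ℕ → ℕ, t.rename ρ = t.subst fun n => var (ρ n) := by
  induction t <;> intro ρ <;> simp [rename, subst, liftSub_var, *]

theorem liftSub_comp_liftRen (ρ : ℕ → ℕ) (σ : ℕ → Tm) :
    (fun n => liftSub σ (liftRen ρ n)) = liftSub fun n => σ (ρ n) := by
  funext n; cases n <;> simp [liftSub, liftRen]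

theorem subst_rename (t : Tm) : ∀ (ρ : ℕ → ℕ) (σ : ℕ → Tm),
    (t.rename ρ).subst σ = t.subst fun n => σ (ρ n) := by
  induction t <;> intro ρ σ <;> simp [rename, subst, liftSub_comp_liftRen, *]

theorem rename_rename (t : Tm) (ρ ρ' : ℕ → ℕ) :
    (t.rename ρ).rename ρ' = t.rename fun n => ρ' (ρ n) := by
  rw [rename_eq_subst _ ρ', subst_rename, rename_eq_subst]

theorem rename_liftSub (ρ : ℕ → ℕ) (σ : ℕ → Tm) :
    (fun n => (liftSub σ n).rename (liftRen ρ)) = liftSub fun n => (σ n).rename ρ := by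
  funext n; cases n <;> simp [liftSub, liftRen, rename, up, rename_rename]

theorem rename_subst (t : Tm) : ∀ (ρ : ℕ → ℕ) (σ : ℕ → Tm),
    (t.subst σ).rename ρ = t.subst fun n => (σ n).rename ρ := by
  induction t <;> intro ρ σ <;> simp [rename, subst, rename_liftSub, *]

theorem subst_liftSub (σ τ : ℕ → Tm) :
    (fun n => (liftSub σ n).subst (liftSub τ)) = liftSub fun n => (σ n).subst τ := by
  funext n; cases n <;> simp [liftSub, subst, up, subst_rename, rename_subst]

theorem subst_subst (t : Tm) : ∀ σ τ : ℕ → Tm,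
    (t.subst σ).subst τ = t.subst fun n => (σ n).subst τ := by
  induction t <;> intro σ τ <;> simp [subst, subst_liftSub, *]

theorem subst_var (t : Tm) : t.subst var = t := by
  have h : liftSub var = var := by funext n; cases n <;> simp [liftSub, up, rename]
  induction t <;> simp [subst, *]

/-- `liftSub` iterated `k` times. -/
def liftSubs : ℕ → (ℕ → Tm) → ℕ → Tm
  | 0, σ => σ
  | k + 1, σ => liftSub (liftSubs k σ)

theorem liftSubs_add (k : ℕ) (σ : ℕ → Tm) (n : ℕ) : liftSubs k σ (n + k) = (σ n).up k := by
  induction k generalizing n with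
  | zero => simp [liftSubs, up, rename_eq_subst, subst_var]
  | succ k ih =>
    rw [liftSubs, ← Nat.add_assoc, liftSub, ih, up, up, up, rename_rename]; rfl

theorem up_subst_liftSubs (k : ℕ) (t : Tm) (σ : ℕ → Tm) :
    (t.up k).subst (liftSubs k σ) = (t.subst σ).up k := by
  simp only [up, subst_rename, rename_subst, liftSubs_add]

theorem up_subst₁ (t : Tm) (σ : ℕ → Tm) :
    (t.up 1).subst (liftSub σ) = (t.subst σ).up 1 := up_subst_liftSubs 1 t σ

theorem up_subst₂ (t : Tm) (σ : ℕ → Tm) :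
    (t.up 2).subst (liftSub (liftSub σ)) = (t.subst σ).up 2 := up_subst_liftSubs 2 t σ

theorem up_subst₃ (t : Tm) (σ : ℕ → Tm) :
    (t.up 3).subst (liftSub (liftSub (liftSub σ))) = (t.subst σ).up 3 :=
  up_subst_liftSubs 3 t σ

theorem upUnder_subst_liftSubs (k : ℕ) (t : Tm) (σ : ℕ → Tm) :
    (t.upUnder k).subst (liftSub (liftSubs k σ)) = (t.subst (liftSub σ)).upUnder k := by
  simp only [upUnder, subst_rename, rename_subst]
  congr 1; funext n
  cases n with
  | zero => simp [liftSub, liftRen, rename]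
  | succ n => simp [liftSub, liftRen, up, rename_rename, liftSubs_add]

theorem upUnder_subst₁ (t : Tm) (σ : ℕ → Tm) :
    (t.upUnder 1).subst (liftSub (liftSub σ)) = (t.subst (liftSub σ)).upUnder 1 :=
  upUnder_subst_liftSubs 1 t σ

theorem upUnder_subst₂ (t : Tm) (σ : ℕ → Tm) :
    (t.upUnder 2).subst (liftSub (liftSub (liftSub σ))) = (t.subst (liftSub σ)).upUnder 2 :=
  upUnder_subst_liftSubs 2 t σ

theorem upUnder_subst₃ (t : Tm) (σ : ℕ → Tm) :
    (t.upUnder 3).subst (liftSub (liftSub (liftSub (liftSub σ)))) =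
      (t.subst (liftSub σ)).upUnder 3 :=
  upUnder_subst_liftSubs 3 t σ

theorem up_subst_single (t u : Tm) : (t.up 1).subst (single u) = t := by
  simp only [up, subst_rename]; exact subst_var t

theorem inst_subst (t u : Tm) (σ : ℕ → Tm) :
    (t.inst u).subst σ = (t.subst (liftSub σ)).inst (u.subst σ) := by
  simp only [inst, subst_subst]
  congr 1; funext n
  cases n with
  | zero => simp [liftSub, single, subst]
  | succ n => simp [liftSub, single, subst, up_subst_single]

theorem inst₂_subst (t u v : Tm) (σ : ℕ → Tm) :
    (t.inst₂ u v).subst σ = (t.subst (liftSub (liftSub σ))).inst₂ (u.subst σ) (v.subst σ) := by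
  simp only [inst₂, subst_subst]
  congr 1; funext n
  rcases n with _ | _ | n
  · simp [liftSub, double, subst]
  · simp [liftSub, double, subst, up, rename]
  · simp only [liftSub, double, subst, up, rename_rename, subst_rename]
    exact (subst_var _).symm

theorem natStep_subst (C : Tm) (σ : ℕ → Tm) :
    (natStep C).subst (liftSub (liftSub σ)) = natStep (C.subst (liftSub σ)) := by
  simp only [natStep, subst_subst]
  congr 1; funext n
  cases n with
  | zero => simp [liftSub, subst, up, rename]
  | succ n => simp [liftSub, subst, up, rename_eq_subst, subst_subst]

theorem liftSub_zero (σ : ℕ → Tm) : liftSub σ 0 = var 0 := rfl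

theorem liftSub_one (σ : ℕ → Tm) : liftSub (liftSub σ) 1 = var 1 := rfl

theorem univ_subst (σ : ℕ → Tm) : univ.subst σ = univ := rfl

theorem arrow_subst (A B : Tm) (σ : ℕ → Tm) :
    (arrow A B).subst σ = arrow (A.subst σ) (B.subst σ) := by
  simp only [arrow, subst, up_subst₁]

theorem prod_subst (A B : Tm) (σ : ℕ → Tm) :
    (prod A B).subst σ = prod (A.subst σ) (B.subst σ) := by
  simp only [prod, subst, up_subst₁]

/-- This law and those below it, for the operations that occur in the types of typing rules, are
what the corresponding cases of `HasType.subst_of_class` need. -/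
theorem tr_subst (A C a b p u : Tm) (σ : ℕ → Tm) :
    (tr A C a b p u).subst σ = tr (A.subst σ) (C.subst (liftSub σ)) (a.subst σ) (b.subst σ)
      (p.subst σ) (u.subst σ) := by
  simp only [tr, subst, up_subst₁]

theorem apd_subst (A C f a b p : Tm) (σ : ℕ → Tm) :
    (apd A C f a b p).subst σ = apd (A.subst σ) (C.subst (liftSub σ)) (f.subst σ) (a.subst σ)
      (b.subst σ) (p.subst σ) := by
  simp only [apd, subst, tr_subst, up_subst₁, up_subst₂, upUnder_subst₂, inst_subst]
  simp [liftSub, up, rename]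

theorem hasSec_subst (A B f : Tm) (σ : ℕ → Tm) :
    (hasSec A B f).subst σ = hasSec (A.subst σ) (B.subst σ) (f.subst σ) := by
  simp only [hasSec, subst, arrow_subst, up_subst₁, up_subst₂]; simp [liftSub, up, rename]

theorem hasRetr_subst (A B f : Tm) (σ : ℕ → Tm) :
    (hasRetr A B f).subst σ = hasRetr (A.subst σ) (B.subst σ) (f.subst σ) := by
  simp only [hasRetr, subst, arrow_subst, up_subst₁, up_subst₂]; simp [liftSub, up, rename]

theorem isEquiv_subst (A B f : Tm) (σ : ℕ → Tm) :
    (isEquiv A B f).subst σ = isEquiv (A.subst σ) (B.subst σ) (f.subst σ) := by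
  simp only [isEquiv, prod_subst, hasSec_subst, hasRetr_subst]

theorem homotopy_subst (A B f g : Tm) (σ : ℕ → Tm) :
    (homotopy A B f g).subst σ =
      homotopy (A.subst σ) (B.subst (liftSub σ)) (f.subst σ) (g.subst σ) := by
  simp only [homotopy, subst, up_subst₁]; simp [liftSub]

theorem happly_subst (A B f g : Tm) (σ : ℕ → Tm) :
    (happly A B f g).subst σ =
      happly (A.subst σ) (B.subst (liftSub σ)) (f.subst σ) (g.subst σ) := by
  simp only [happly, subst, homotopy_subst, up_subst₁, up_subst₂, up_subst₃, upUnder_subst₁,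
    upUnder_subst₃]
  simp [liftSub, up, rename, rename_eq_subst, subst, subst_subst, upUnder]

theorem funextType_subst (A B : Tm) (σ : ℕ → Tm) :
    (funextType A B).subst σ = funextType (A.subst σ) (B.subst (liftSub σ)) := by
  simp only [funextType, subst, isEquiv_subst, homotopy_subst, happly_subst, up_subst₁, up_subst₂,
    upUnder_subst₂]
  simp [liftSub, up, rename]

theorem gqEdgeData_subst (V E C c : Tm) (σ : ℕ → Tm) :
    (gqEdgeData V E C c).subst σ =
      gqEdgeData (V.subst σ) (E.subst σ) (C.subst (liftSub σ)) (c.subst σ) := by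
  simp only [gqEdgeData, subst, tr_subst, inst_subst, up_subst₁, up_subst₂, up_subst₃,
    upUnder_subst₃]
  simp [liftSub, up, rename]

theorem gqSec_subst (V E C c d : Tm) (σ : ℕ → Tm) :
    (gqSec V E C c d).subst σ = gqSec (V.subst σ) (E.subst σ) (C.subst (liftSub σ)) (c.subst σ)
      (d.subst σ) := by
  simp only [gqSec, subst, up_subst₁, upUnder_subst₁]; simp [liftSub]

theorem equiv_subst (A B : Tm) (σ : ℕ → Tm) :
    (equiv A B).subst σ = equiv (A.subst σ) (B.subst σ) := by
  simp only [equiv, subst, arrow_subst, isEquiv_subst, up_subst₁]; simp [liftSub]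

theorem idFun_subst (A : Tm) (σ : ℕ → Tm) : (idFun A).subst σ = idFun (A.subst σ) := by
  simp only [idFun, subst, liftSub]

theorem idEquiv_subst (A : Tm) (σ : ℕ → Tm) : (idEquiv A).subst σ = idEquiv (A.subst σ) := by
  simp only [idEquiv, subst, arrow_subst, isEquiv_subst, hasSec_subst, hasRetr_subst, idFun_subst,
    up_subst₁, up_subst₂]
  simp [liftSub, up, rename]

theorem idToEquiv_subst (A B : Tm) (σ : ℕ → Tm) :
    (idToEquiv A B).subst σ = idToEquiv (A.subst σ) (B.subst σ) := by
  simp only [idToEquiv, subst, equiv_subst, idEquiv_subst, up_subst₁, up_subst₃, univ]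
  simp [liftSub, up, rename]

theorem univalence_subst (σ : ℕ → Tm) : univalence.subst σ = univalence := by
  simp only [univalence, subst, isEquiv_subst, equiv_subst, idToEquiv_subst, univ]
  simp [liftSub, up, rename]

end Tm

/-! ### Stability of conversion and typing under substitution -/

open Tm

theorem Conv.subst {t u : Tm} (h : Conv t u) : ∀ σ : ℕ → Tm, Conv (t.subst σ) (u.subst σ) := by
  induction h <;> intro σ
  case rfl => exact Conv.rfl _
  case symm ih => exact (ih σ).symm
  case trans ih₁ ih₂ => exact (ih₁ σ).trans (ih₂ σ)
  case app_lam => rw [inst_subst]; exact Conv.app_lam _ _ _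
  case split_pair => exact Conv.split_pair ..
  case J_refl => exact Conv.J_refl ..
  case unitInd_star => exact Conv.unitInd_star ..
  case sumInd_inl => exact Conv.sumInd_inl ..
  case sumInd_inr => exact Conv.sumInd_inr ..
  case natInd_zero => exact Conv.natInd_zero ..
  case natInd_succ => exact Conv.natInd_succ ..
  case gqInd_pt => exact Conv.gqInd_pt ..
  all_goals
    simp only [Tm.subst]
    first
      | apply Conv.pi | apply Conv.lam | apply Conv.app | apply Conv.sigma | apply Conv.pair
      | apply Conv.split | apply Conv.Id | apply Conv.refl | apply Conv.J | apply Conv.emptyInd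
      | apply Conv.unitInd | apply Conv.sum | apply Conv.inl | apply Conv.inr | apply Conv.sumInd
      | apply Conv.succ | apply Conv.natInd | apply Conv.gq | apply Conv.pt | apply Conv.edge
      | apply Conv.gqInd | apply Conv.gqIndEdge | apply Conv.funext
  all_goals apply_assumption

theorem liftSub_up (t : Tm) (σ : ℕ → Tm) (k : ℕ) :
    (t.up (k + 1)).subst (liftSub σ) = ((t.up k).subst σ).up 1 := by
  simp only [up, subst_rename, rename_subst]; rfl

/-- Derivability is stable under a class of substitutions that is closed under `liftSub`. -/
theorem HasType.subst_of_class (P : Ctx → Ctx → (ℕ → Tm) → Prop)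
    (hvar : ∀ {Γ Δ σ n A}, P Γ Δ σ → Γ[n]? = some A → HasType Δ (σ n) ((A.up (n + 1)).subst σ))
    (hlift : ∀ {Γ Δ σ} A, P Γ Δ σ → P (A :: Γ) (A.subst σ :: Δ) (liftSub σ))
    {Γ t A} (h : HasType Γ t A) :
    ∀ {Δ σ}, P Γ Δ σ → HasType Δ (t.subst σ) (A.subst σ) := by
  induction h <;> intro Δ σ hσ
  case var h => exact hvar hσ h
  case conv hc ih₁ ih₂ => exact HasType.conv (ih₁ hσ) (ih₂ hσ) (hc.subst σ)
  case univ => exact HasType.univ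
  case el ih => exact HasType.el (ih hσ)
  case pi ih₁ ih₂ => exact HasType.pi (ih₁ hσ) (ih₂ (hlift _ hσ))
  case lam ih₁ ih₂ ih₃ => exact HasType.lam (ih₁ hσ) (ih₂ (hlift _ hσ)) (ih₃ (hlift _ hσ))
  case app ih₁ ih₂ => rw [inst_subst]; exact HasType.app (ih₁ hσ) (ih₂ hσ)
  case sigma ih₁ ih₂ => exact HasType.sigma (ih₁ hσ) (ih₂ (hlift _ hσ))
  case pair ih₁ ih₂ ih₃ ih₄ =>
    refine HasType.pair (ih₁ hσ) (ih₂ (hlift _ hσ)) (ih₃ hσ) ?_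
    rw [← inst_subst]; exact ih₄ hσ
  case split ih₁ ih₂ ih₃ ih₄ ih₅ =>
    rw [inst_subst]
    refine HasType.split (ih₁ hσ) (ih₂ (hlift _ hσ)) (ih₃ (hlift _ hσ)) ?_ (ih₅ hσ)
    simpa only [Tm.subst, inst_subst, up_subst₂, upUnder_subst₂, liftSub_zero, liftSub_one] using ih₄ hσ
  case Id ih₁ ih₂ ih₃ => exact HasType.Id (ih₁ hσ) (ih₂ hσ) (ih₃ hσ)
  case refl ih₁ ih₂ => exact HasType.refl (ih₁ hσ) (ih₂ hσ)
  case J ih₁ ih₂ ih₃ ih₄ ih₅ ih₆ =>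
    rw [inst₂_subst]
    refine HasType.J (ih₁ hσ) (ih₂ hσ) ?_ ?_ (ih₅ hσ) (ih₆ hσ)
    · simpa only [Tm.subst, up_subst₁, liftSub] using ih₃ (hlift _ (hlift _ hσ))
    · simpa only [Tm.subst, inst₂_subst] using ih₄ hσ
  case empty => exact HasType.empty
  case emptyInd ih₁ ih₂ => rw [inst_subst]; exact HasType.emptyInd (ih₁ (hlift _ hσ)) (ih₂ hσ)
  case unit => exact HasType.unit
  case star => exact HasType.star
  case unitInd ih₁ ih₂ ih₃ =>
    rw [inst_subst]
    refine HasType.unitInd (ih₁ (hlift _ hσ)) ?_ (ih₃ hσ)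
    simpa only [Tm.subst, inst_subst] using ih₂ hσ
  case sum ih₁ ih₂ => exact HasType.sum (ih₁ hσ) (ih₂ hσ)
  case inl ih₁ ih₂ ih₃ => exact HasType.inl (ih₁ hσ) (ih₂ hσ) (ih₃ hσ)
  case inr ih₁ ih₂ ih₃ => exact HasType.inr (ih₁ hσ) (ih₂ hσ) (ih₃ hσ)
  case sumInd ih₁ ih₂ ih₃ ih₄ ih₅ ih₆ =>
    rw [inst_subst]
    refine HasType.sumInd (ih₁ hσ) (ih₂ hσ) (ih₃ (hlift _ hσ)) ?_ ?_ (ih₆ hσ)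
    · simpa only [Tm.subst, inst_subst, up_subst₁, upUnder_subst₁, liftSub] using ih₄ hσ
    · simpa only [Tm.subst, inst_subst, up_subst₁, upUnder_subst₁, liftSub] using ih₅ hσ
  case nat => exact HasType.nat
  case zero => exact HasType.zero
  case succ ih => exact HasType.succ (ih hσ)
  case natInd ih₁ ih₂ ih₃ ih₄ =>
    rw [inst_subst]
    refine HasType.natInd (ih₁ (hlift _ hσ)) ?_ ?_ (ih₄ hσ)
    · simpa only [Tm.subst, inst_subst] using ih₂ hσ
    · simpa only [Tm.subst, natStep_subst] using ih₃ hσ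
  case gq ih₁ ih₂ =>
    refine HasType.gq (ih₁ hσ) ?_
    simpa only [arrow_subst, univ_subst] using ih₂ hσ
  case pt ih₁ ih₂ ih₃ =>
    refine HasType.pt (ih₁ hσ) ?_ (ih₃ hσ)
    simpa only [arrow_subst, univ_subst] using ih₂ hσ
  case edge ih₁ ih₂ ih₃ ih₄ ih₅ =>
    refine HasType.edge (ih₁ hσ) ?_ (ih₃ hσ) (ih₄ hσ) (ih₅ hσ)
    simpa only [arrow_subst, univ_subst] using ih₂ hσ
  case gqInd ih₁ ih₂ ih₃ ih₄ ih₅ ih₆ =>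
    rw [inst_subst]
    refine HasType.gqInd (ih₁ hσ) ?_ (ih₃ (hlift _ hσ)) ?_ ?_ (ih₆ hσ)
    · simpa only [arrow_subst, univ_subst] using ih₂ hσ
    · simpa only [Tm.subst, inst_subst, up_subst₁, upUnder_subst₁, liftSub] using ih₄ hσ
    · simpa only [gqEdgeData_subst] using ih₅ hσ
  case gqIndEdge ih₁ ih₂ ih₃ ih₄ ih₅ ih₆ ih₇ ih₈ =>
    simp only [Tm.subst, inst_subst, tr_subst, apd_subst, gqSec_subst]
    refine HasType.gqIndEdge (ih₁ hσ) ?_ (ih₃ (hlift _ hσ)) ?_ ?_ (ih₆ hσ) (ih₇ hσ) (ih₈ hσ)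
    · simpa only [arrow_subst, univ_subst] using ih₂ hσ
    · simpa only [Tm.subst, inst_subst, up_subst₁, upUnder_subst₁, liftSub] using ih₄ hσ
    · simpa only [gqEdgeData_subst] using ih₅ hσ
  case funext ih₁ ih₂ =>
    rw [funextType_subst]; exact HasType.funext (ih₁ hσ) (ih₂ (hlift _ hσ))
  case ua => rw [univalence_subst]; exact HasType.ua

/-- Renamings between contexts. -/
def IsRen (Γ Δ : Ctx) (σ : ℕ → Tm) : Prop :=
  ∃ ρ : ℕ → ℕ, σ = (fun n => Tm.var (ρ n)) ∧ ∀ n A, Γ[n]? = some A →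
    ∃ A', Δ[ρ n]? = some A' ∧ A'.up (ρ n + 1) = (A.up (n + 1)).subst σ

/-- Renamings come before general substitutions: lifting a typed substitution under a binder weakens
its terms, and weakening is an instance of this lemma. -/
theorem HasType.rename {Γ Δ t A σ} (h : HasType Γ t A) (hσ : IsRen Γ Δ σ) :
    HasType Δ (t.subst σ) (A.subst σ) := by
  refine HasType.subst_of_class IsRen ?_ ?_ h hσ
  · rintro Γ Δ _ n A ⟨ρ, rfl, hρ⟩ hn
    obtain ⟨A', h₁, h₂⟩ := hρ n A hn
    rw [← h₂]; exact HasType.var h₁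
  · rintro Γ Δ _ B ⟨ρ, rfl, hρ⟩
    refine ⟨liftRen ρ, liftSub_var ρ, ?_⟩
    rintro (_ | n) A hn
    · obtain rfl : B = A := by simpa using hn
      exact ⟨_, rfl, (liftSub_up _ _ 0).symm ▸ by simp [liftRen, up, rename_eq_subst, subst_subst, Tm.subst]⟩
    · obtain ⟨A', h₁, h₂⟩ := hρ n A (by simpa using hn)
      refine ⟨A', by simpa [liftRen] using h₁, ?_⟩
      rw [liftSub_up, ← h₂, liftRen]
      simp [up, rename_rename, Nat.add_assoc]

theorem HasType.weaken {Γ t A} (h : HasType Γ t A) (B : Tm) :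
    HasType (B :: Γ) (t.up 1) (A.up 1) := by
  rw [up, up, rename_eq_subst, rename_eq_subst]
  refine h.rename ⟨fun n => n + 1, rfl, fun n A hn => ⟨A, by simpa using hn, ?_⟩⟩
  simp [up, rename_eq_subst, subst_subst, Tm.subst, Nat.add_assoc]

/-- Typed substitutions between contexts. -/
def IsSub (Γ Δ : Ctx) (σ : ℕ → Tm) : Prop :=
  ∀ n A, Γ[n]? = some A → HasType Δ (σ n) ((A.up (n + 1)).subst σ)

theorem IsSub.lift {Γ Δ σ} (h : IsSub Γ Δ σ) (B : Tm) :
    IsSub (B :: Γ) (B.subst σ :: Δ) (liftSub σ) := by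
  rintro (_ | n) A hn
  · obtain rfl : B = A := by simpa using hn
    rw [liftSub_up]
    have : (B.up 0).subst σ = B.subst σ := by simp [up, rename_eq_subst, subst_subst, Tm.subst]
    rw [this]; exact HasType.var rfl
  · rw [liftSub_up]; exact (h n A (by simpa using hn)).weaken _

theorem HasType.subst {Γ Δ t A σ} (h : HasType Γ t A) (hσ : IsSub Γ Δ σ) :
    HasType Δ (t.subst σ) (A.subst σ) :=
  HasType.subst_of_class IsSub (fun h hn => h _ _ hn) (fun B h => h.lift B) h hσ

theorem IsSub.id (Γ : Ctx) : IsSub Γ Γ Tm.var := fun n A hn => by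
  rw [subst_var]; exact HasType.var hn

theorem up_succ_subst (A : Tm) (n : ℕ) (σ : ℕ → Tm) :
    (A.up (n + 1)).subst σ = (A.up n).subst fun k => σ (k + 1) := by
  simp [up, subst_rename, Nat.add_assoc]

theorem IsSub.cons {Γ Δ σ B} (h : IsSub Γ Δ fun n => σ (n + 1))
    (h₀ : HasType Δ (σ 0) (B.subst fun n => σ (n + 1))) : IsSub (B :: Γ) Δ σ := by
  rintro (_ | n) A hn
  · obtain rfl : B = A := by simpa using hn
    rw [up_succ_subst]; simpa [up, rename_eq_subst, subst_subst, Tm.subst] using h₀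
  · rw [up_succ_subst]; exact h n A (by simpa using hn)

theorem IsSub.single {Γ B u} (h : HasType Γ u B) : IsSub (B :: Γ) Γ (single u) :=
  IsSub.cons (IsSub.id Γ) (by change HasType Γ u (B.subst Tm.var); rwa [subst_var])

theorem HasType.inst {Γ B t A u} (h : HasType (B :: Γ) t A) (hu : HasType Γ u B) :
    HasType Γ (t.inst u) (A.inst u) := h.subst (IsSub.single hu)

end HoTT

namespace HoTT
open Tm

/-! ### A type checker -/

namespace Tm

/-- Compare two terms with `r` one level below the head. -/
def cong (r : Tm → Tm → Bool) (t u : Tm) : Bool :=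
  match t with
  | var n => match u with
    | var m => Nat.beq n m
    | _ => false
  | sort .small => match u with
    | sort .small => true
    | _ => false
  | pi A B => match u with
    | pi A' B' => r A A' && r B B'
    | _ => false
  | lam A B => match u with
    | lam A' B' => r A A' && r B B'
    | _ => false
  | app A B => match u with
    | app A' B' => r A A' && r B B'
    | _ => false
  | sigma A B => match u with
    | sigma A' B' => r A A' && r B B'
    | _ => false
  | pair A B a b => match u with
    | pair A' B' a' b' => r A A' && (r B B' && (r a a' && r b b'))
    | _ => false
  | split A B C d p => match u with
    | split A' B' C' d' p' => r A A' && (r B B' && (r C C' && (r d d' && r p p')))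
    | _ => false
  | Id A a b => match u with
    | Id A' a' b' => r A A' && (r a a' && r b b')
    | _ => false
  | refl A a => match u with
    | refl A' a' => r A A' && r a a'
    | _ => false
  | J A a C d b p => match u with
    | J A' a' C' d' b' p' =>
      r A A' && (r a a' && (r C C' && (r d d' && (r b b' && r p p'))))
    | _ => false
  | sum A B => match u with
    | sum A' B' => r A A' && r B B'
    | _ => false
  | inl A B a => match u with
    | inl A' B' a' => r A A' && (r B B' && r a a')
    | _ => false
  | inr A B a => match u with
    | inr A' B' a' => r A A' && (r B B' && r a a')
    | _ => false
  | sumInd A B C c d q => match u with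
    | sumInd A' B' C' c' d' q' =>
      r A A' && (r B B' && (r C C' && (r c c' && (r d d' && r q q'))))
    | _ => false
  | gq A B => match u with
    | gq A' B' => r A A' && r B B'
    | _ => false
  | pt A B a => match u with
    | pt A' B' a' => r A A' && (r B B' && r a a')
    | _ => false
  | edge A B C d p => match u with
    | edge A' B' C' d' p' => r A A' && (r B B' && (r C C' && (r d d' && r p p')))
    | _ => false
  | gqInd A B C c d q => match u with
    | gqInd A' B' C' c' d' q' =>
      r A A' && (r B B' && (r C C' && (r c c' && (r d d' && r q q'))))
    | _ => false
  | funext A B => match u with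
    | funext A' B' => r A A' && r B B'
    | _ => false
  | _ => false

/-- Only this direction matters. Term formers that `cong` leaves out compare as different, which can
only make the checker reject more. -/
theorem cong_sound {r : Tm → Tm → Bool} (hr : ∀ t u, r t u = true → Conv t u) {t u : Tm}
    (h : cong r t u = true) : Conv t u := by
  unfold cong at h
  split at h <;> try split at h
  all_goals try simp only [Bool.and_eq_true, Bool.false_eq_true] at h
  · rw [Nat.eq_of_beq_eq_true h]; exact Conv.rfl _
  · exact Conv.rfl _
  · exact Conv.pi (hr _ _ h.1) (hr _ _ h.2)
  · exact Conv.lam (hr _ _ h.1) (hr _ _ h.2)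
  · exact Conv.app (hr _ _ h.1) (hr _ _ h.2)
  · exact Conv.sigma (hr _ _ h.1) (hr _ _ h.2)
  · exact Conv.pair (hr _ _ h.1) (hr _ _ h.2.1) (hr _ _ h.2.2.1) (hr _ _ h.2.2.2)
  · exact Conv.split (hr _ _ h.1) (hr _ _ h.2.1) (hr _ _ h.2.2.1) (hr _ _ h.2.2.2.1)
      (hr _ _ h.2.2.2.2)
  · exact Conv.Id (hr _ _ h.1) (hr _ _ h.2.1) (hr _ _ h.2.2)
  · exact Conv.refl (hr _ _ h.1) (hr _ _ h.2)
  · exact Conv.J (hr _ _ h.1) (hr _ _ h.2.1) (hr _ _ h.2.2.1) (hr _ _ h.2.2.2.1)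
      (hr _ _ h.2.2.2.2.1) (hr _ _ h.2.2.2.2.2)
  · exact Conv.sum (hr _ _ h.1) (hr _ _ h.2)
  · exact Conv.inl (hr _ _ h.1) (hr _ _ h.2.1) (hr _ _ h.2.2)
  · exact Conv.inr (hr _ _ h.1) (hr _ _ h.2.1) (hr _ _ h.2.2)
  · exact Conv.sumInd (hr _ _ h.1) (hr _ _ h.2.1) (hr _ _ h.2.2.1) (hr _ _ h.2.2.2.1)
      (hr _ _ h.2.2.2.2.1) (hr _ _ h.2.2.2.2.2)
  · exact Conv.gq (hr _ _ h.1) (hr _ _ h.2)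
  · exact Conv.pt (hr _ _ h.1) (hr _ _ h.2.1) (hr _ _ h.2.2)
  · exact Conv.edge (hr _ _ h.1) (hr _ _ h.2.1) (hr _ _ h.2.2.1) (hr _ _ h.2.2.2.1)
      (hr _ _ h.2.2.2.2)
  · exact Conv.gqInd (hr _ _ h.1) (hr _ _ h.2.1) (hr _ _ h.2.2.1) (hr _ _ h.2.2.2.1)
      (hr _ _ h.2.2.2.2.1) (hr _ _ h.2.2.2.2.2)
  · exact Conv.funext (hr _ _ h.1) (hr _ _ h.2)

/-- Syntactic equality, up to depth `k`. -/
def beq : ℕ → Tm → Tm → Bool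
  | 0 => fun _ _ => false
  | k + 1 => fun t u => cong (beq k) t u

/-- Weak head reduction, with fuel `k`. -/
def whnf : ℕ → Tm → Tm
  | 0 => fun t => t
  | k + 1 => fun t => match t with
    | app f a => match whnf k f with
      | lam _ b => whnf k (b.inst a)
      | f' => app f' a
    | split A B C d p => match whnf k p with
      | pair _ _ a b => whnf k (app (app d a) b)
      | p' => split A B C d p'
    | J A a C d b p => match whnf k p with
      | refl _ _ => whnf k d
      | p' => J A a C d b p'
    | sumInd A B C l r u => match whnf k u with
      | inl _ _ a => whnf k (app l a)
      | inr _ _ b => whnf k (app r b)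
      | u' => sumInd A B C l r u'
    | gqInd V E C c d q => match whnf k q with
      | pt _ _ i => whnf k (app c i)
      | q' => gqInd V E C c d q'
    | t => t

/-- Every step is a computation rule below a congruence, so this holds for untyped terms and at
every fuel; neither normalization nor confluence is involved. -/
theorem whnf_sound (k : ℕ) : ∀ t, Conv t (whnf k t) := by
  induction k with
  | zero => exact fun t => Conv.rfl t
  | succ k ih =>
    intro t
    cases t <;> simp only [whnf] <;> try exact Conv.rfl _
    case app f a =>
      have h := ih f
      split
      · next e => rw [e] at h; exact ((Conv.app h (Conv.rfl _)).trans (Conv.app_lam ..)).trans (ih _)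
      · exact Conv.app h (Conv.rfl _)
    case split A B C d p =>
      have h := Conv.split (Conv.rfl A) (Conv.rfl B) (Conv.rfl C) (Conv.rfl d) (ih p)
      split
      · next e => rw [e] at h; exact (h.trans (Conv.split_pair ..)).trans (ih _)
      · exact h
    case J A a C d b p =>
      have h := Conv.J (Conv.rfl A) (Conv.rfl a) (Conv.rfl C) (Conv.rfl d) (Conv.rfl b) (ih p)
      split
      · next e => rw [e] at h; exact (h.trans (Conv.J_refl ..)).trans (ih _)
      · exact h
    case sumInd A B C l r u =>
      have h := Conv.sumInd (Conv.rfl A) (Conv.rfl B) (Conv.rfl C) (Conv.rfl l) (Conv.rfl r) (ih u)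
      split
      · next e => rw [e] at h; exact (h.trans (Conv.sumInd_inl ..)).trans (ih _)
      · next e => rw [e] at h; exact (h.trans (Conv.sumInd_inr ..)).trans (ih _)
      · exact h
    case gqInd V E C c d q =>
      have h := Conv.gqInd (Conv.rfl V) (Conv.rfl E) (Conv.rfl C) (Conv.rfl c) (Conv.rfl d) (ih q)
      split
      · next e => rw [e] at h; exact (h.trans (Conv.gqInd_pt ..)).trans (ih _)
      · exact h

/-- The recursion depth of the functions below. -/
def fuel : ℕ := 1000

/-- Convertibility test: compare, and if that fails, compare the weak head normal forms. -/
def conv : ℕ → Tm → Tm → Bool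
  | 0 => fun _ _ => false
  | k + 1 => fun t u => beq fuel t u || cong (conv k) (whnf fuel t) (whnf fuel u)

theorem beq_sound (k : ℕ) : ∀ t u, beq k t u = true → Conv t u := by
  induction k with
  | zero => simp [beq]
  | succ k ih => exact fun t u h => cong_sound ih h

theorem conv_sound (k : ℕ) : ∀ t u, conv k t u = true → Conv t u := by
  induction k with
  | zero => simp [conv]
  | succ k ih =>
    intro t u h
    rcases (Bool.or_eq_true _ _).mp h with h | h
    · exact beq_sound _ _ _ h
    · exact ((whnf_sound _ t).trans (cong_sound ih h)).trans (whnf_sound _ u).symm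

end Tm

/-- A way to find the type of a term. -/
abbrev Infer : Type := Ctx → Tm → Option Tm

/-! ### Type inference -/

namespace Infer

/-- The size of a type. -/
def sortOf (I : Infer) (Γ : Ctx) (A : Tm) : Option Size :=
  (I Γ A).bind fun T => match T with
    | sort s => some s
    | T => match whnf fuel T with
      -- The rule `HasType.conv` needs a type for the target, and `sort .large` has none; so only
      -- `sort .small` can be reached by reduction.
      | sort .small => some .small
      | _ => none

/-- Run `k` if `A` is a type. -/
def withTy {α : Type} (I : Infer) (Γ : Ctx) (A : Tm) (k : Option α) : Option α :=
  (sortOf I Γ A).bind fun _ => k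

/-- Run `k` if `t` has type `A`. -/
def withElem {α : Type} (I : Infer) (Γ : Ctx) (t A : Tm) (k : Option α) : Option α :=
  (I Γ t).bind fun A' => cond (conv fuel A' A) k none

/-- Run `k` on the domain and the codomain of a dependent function type. -/
def withPi (I : Infer) (Γ : Ctx) (T : Tm) (k : Tm → Tm → Option Tm) : Option Tm :=
  match T with
  | pi A B => k A B
  | T => match whnf fuel T with
    -- Preservation of types by reduction is never proved, so the reduct is checked to be a type
    -- before converting to it.
    | pi A B => withTy I Γ (pi A B) (k A B)
    | _ => none

/-- The larger of two sizes. -/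
def lub : Size → Size → Size
  | .small, s => s
  | .large, _ => .large

/-- One step of type inference. -/
def step (I : Infer) (Γ : Ctx) (t : Tm) : Option Tm :=
  match t with
  | var n => Γ[n]?.map (up (n + 1))
  | sort .small => some (sort .large)
  | pi A B => (sortOf I Γ A).bind fun s => (sortOf I (A :: Γ) B).bind fun s' =>
      some (sort (lub s s'))
  | sigma A B => (sortOf I Γ A).bind fun s => (sortOf I (A :: Γ) B).bind fun s' =>
      some (sort (lub s s'))
  | sum A B => (sortOf I Γ A).bind fun s => (sortOf I Γ B).bind fun s' => some (sort (lub s s'))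
  | lam A t => withTy I Γ A <| (I (A :: Γ) t).bind fun B => match B with
      -- The codomain of a function type must itself be a type, which `sort .large` is not.
      | sort .large => none
      | B => some (pi A B)
  | app f a => (I Γ f).bind fun F => withPi I Γ F fun A B => withElem I Γ a A (some (B.inst a))
  | pair A B a b => withTy I Γ A <| withTy I (A :: Γ) B <| withElem I Γ a A <|
      withElem I Γ b (B.inst a) <| some (sigma A B)
  | split A B C d p => withTy I Γ A <| withTy I (A :: Γ) B <| withTy I (sigma A B :: Γ) C <|
      withElem I Γ d (pi A (pi B
        ((C.upUnder 2).inst (pair (A.up 2) (B.upUnder 2) (var 1) (var 0))))) <|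
      withElem I Γ p (sigma A B) <| some (C.inst p)
  | .Id A a b => (sortOf I Γ A).bind fun s => withElem I Γ a A <| withElem I Γ b A <|
      some (sort s)
  | .refl A a => withTy I Γ A <| withElem I Γ a A <| some (.Id A a a)
  | J A a C d b p => withTy I Γ A <| withElem I Γ a A <|
      withTy I (.Id (A.up 1) (a.up 1) (var 0) :: A :: Γ) C <|
      withElem I Γ d (C.inst₂ a (.refl A a)) <| withElem I Γ b A <|
      withElem I Γ p (.Id A a b) <| some (C.inst₂ b p)
  | inl A B a => withTy I Γ A <| withTy I Γ B <| withElem I Γ a A <| some (sum A B)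
  | inr A B b => withTy I Γ A <| withTy I Γ B <| withElem I Γ b B <| some (sum A B)
  | sumInd A B C l r u => withTy I Γ A <| withTy I Γ B <| withTy I (sum A B :: Γ) C <|
      withElem I Γ l (pi A ((C.upUnder 1).inst (inl (A.up 1) (B.up 1) (var 0)))) <|
      withElem I Γ r (pi B ((C.upUnder 1).inst (inr (A.up 1) (B.up 1) (var 0)))) <|
      withElem I Γ u (sum A B) <| some (C.inst u)
  | gq V E => withElem I Γ V univ <| withElem I Γ E (arrow V (arrow V univ)) <|
      some univ
  | pt V E i => withElem I Γ V univ <| withElem I Γ E (arrow V (arrow V univ)) <|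
      withElem I Γ i V <| some (gq V E)
  | edge V E i j e => withElem I Γ V univ <| withElem I Γ E (arrow V (arrow V univ)) <|
      withElem I Γ i V <| withElem I Γ j V <| withTy I Γ (app (app E i) j) <|
      withElem I Γ e (app (app E i) j) <| some (.Id (gq V E) (pt V E i) (pt V E j))
  -- That the types `c'` and `d'` of the data are well-formed is checked by `withTy` at run time,
  -- which saves proving it in general.
  | gqInd V E C c d q =>
      let c' := pi V ((C.upUnder 1).inst (pt (V.up 1) (E.up 1) (var 0)))
      let d' := gqEdgeData V E C c
      withElem I Γ V univ <| withElem I Γ E (arrow V (arrow V univ)) <|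
      withTy I (gq V E :: Γ) C <| withTy I Γ c' <| withElem I Γ c c' <|
      withTy I Γ d' <| withElem I Γ d d' <| withElem I Γ q (gq V E) <| some (C.inst q)
  | gqIndEdge V E C c d i j e =>
      let c' := pi V ((C.upUnder 1).inst (pt (V.up 1) (E.up 1) (var 0)))
      let d' := gqEdgeData V E C c
      let T := .Id
          (.Id (C.inst (pt V E j))
            (tr (gq V E) C (pt V E i) (pt V E j) (edge V E i j e) (app c i)) (app c j))
          (apd (gq V E) C (gqSec V E C c d) (pt V E i) (pt V E j) (edge V E i j e))
          (app (app (app d i) j) e)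
      withElem I Γ V univ <| withElem I Γ E (arrow V (arrow V univ)) <|
      withTy I (gq V E :: Γ) C <| withTy I Γ c' <| withElem I Γ c c' <|
      withTy I Γ d' <| withElem I Γ d d' <| withElem I Γ i V <| withElem I Γ j V <|
      withTy I Γ (app (app E i) j) <| withElem I Γ e (app (app E i) j) <|
      withTy I Γ T <| some T
  | .funext A B => withTy I Γ A <| withTy I (A :: Γ) B <| withTy I Γ (funextType A B) <|
      some (funextType A B)
  | _ => none

end Infer

/-- The type of a term, with fuel `k`. -/
def infer : ℕ → Infer
  | 0 => fun _ _ => none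
  | k + 1 => Infer.step (infer k)

end HoTT

namespace HoTT
open Tm

/-! ### Soundness of the type checker -/

/-- The types in a context are types. -/
def WfCtx (Γ : Ctx) : Prop := ∀ (n : ℕ) (A : Tm), Γ[n]? = some A → HasType Γ (Tm.up (n + 1) A) (sort .large)

theorem WfCtx.nil : WfCtx [] := fun n A h => by simp at h

theorem WfCtx.cons {Γ A} (h : WfCtx Γ) (hA : HasType Γ A (sort .large)) : WfCtx (A :: Γ) := by
  rintro (_ | n) B hn
  · obtain rfl : A = B := by simpa using hn
    exact hA.weaken _
  · have := (h n B (by simpa using hn)).weaken A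
    simpa [up, rename_rename, Tm.rename, Nat.add_assoc] using this

theorem HasType.large {Γ A s} (h : HasType Γ A (sort s)) : HasType Γ A (sort .large) := by
  cases s
  · exact h.el
  · exact h

theorem HasType.lub_left {Γ A s} (s') (h : HasType Γ A (sort s)) :
    HasType Γ A (sort (Infer.lub s s')) := by
  cases s
  · cases s'
    · exact h
    · exact h.el
  · exact h

theorem HasType.lub_right {Γ A s'} (s) (h : HasType Γ A (sort s')) :
    HasType Γ A (sort (Infer.lub s s')) := by
  cases s
  · exact h
  · exact h.large

/-- Apart from the formation rule, only `conv` and `el` can end a derivation whose subject is a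
function type, and both keep the subject. -/
theorem HasType.pi_inv {Γ T S} (h : HasType Γ T S) : ∀ {A B : Tm}, T = Tm.pi A B →
    HasType Γ A (sort .large) ∧ HasType (A :: Γ) B (sort .large) := by
  induction h <;> intro A B e <;> try exact Tm.noConfusion e
  case conv ih _ => exact ih e
  case el ih => exact ih e
  case pi h₁ h₂ _ _ => cases e; exact ⟨h₁.large, h₂.large⟩

theorem IsSub.weaken (Γ : Ctx) (A : Tm) : IsSub Γ (A :: Γ) fun n => Tm.var (n + 1) := by
  intro n B hn
  have := HasType.var (Γ := A :: Γ) (n := n + 1) (A := B) (by simpa using hn)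
  simpa [up, rename_eq_subst, subst_subst, Tm.subst, Nat.add_assoc] using this

theorem IsSub.weaken₂ (Γ : Ctx) (A B : Tm) : IsSub Γ (B :: A :: Γ) fun n => Tm.var (n + 2) := by
  intro n C hn
  have := HasType.var (Γ := B :: A :: Γ) (n := n + 2) (A := C) (by simpa using hn)
  simpa [up, rename_eq_subst, subst_subst, Tm.subst, Nat.add_assoc] using this

theorem up_eq_subst (k : ℕ) (t : Tm) : t.up k = t.subst fun n => Tm.var (n + k) :=
  rename_eq_subst _ _

theorem HasType.inst_upUnder₁ {Γ X C A u} (hC : HasType (X :: Γ) C (sort .large))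
    (hu : HasType (A :: Γ) u (X.up 1)) :
    HasType (A :: Γ) ((C.upUnder 1).inst u) (sort .large) := by
  have e : (C.upUnder 1).inst u = C.subst fun | 0 => u | n + 1 => Tm.var (n + 1) := by
    simp only [Tm.inst, upUnder, subst_rename]
    congr 1; funext n; cases n <;> rfl
  rw [e]
  rw [up_eq_subst] at hu
  exact hC.subst (IsSub.cons (IsSub.weaken Γ A) hu)

theorem HasType.inst_upUnder₂ {Γ X C A B u} (hC : HasType (X :: Γ) C (sort .large))
    (hu : HasType (B :: A :: Γ) u (X.up 2)) :
    HasType (B :: A :: Γ) ((C.upUnder 2).inst u) (sort .large) := by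
  have e : (C.upUnder 2).inst u = C.subst fun | 0 => u | n + 1 => Tm.var (n + 2) := by
    simp only [Tm.inst, upUnder, subst_rename]
    congr 1; funext n; cases n <;> rfl
  rw [e]
  rw [up_eq_subst] at hu
  exact hC.subst (IsSub.cons (IsSub.weaken₂ Γ A B) hu)

theorem HasType.inst₂ {Γ A a C b p}
    (hC : HasType (Tm.Id (A.up 1) (a.up 1) (Tm.var 0) :: A :: Γ) C (sort .large))
    (hb : HasType Γ b A) (hp : HasType Γ p (Tm.Id A a b)) :
    HasType Γ (C.inst₂ b p) (sort .large) := by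
  have e : (fun n => double b p (n + 1)) = single b := by funext n; cases n <;> rfl
  refine hC.subst (IsSub.cons (by rw [e]; exact IsSub.single hb) ?_)
  rw [e]
  simpa only [Tm.subst, up_subst_single, single, double] using hp

theorem HasType.arrow {Γ A B} (hA : HasType Γ A (sort .large)) (hB : HasType Γ B (sort .large)) :
    HasType Γ (Tm.arrow A B) (sort .large) :=
  hA.pi (hB.weaken A)

theorem HasType.pi_wf {Γ A B} (h : HasType Γ (Tm.pi A B) (sort .large)) :
    HasType Γ A (sort .large) ∧ HasType (A :: Γ) B (sort .large) := h.pi_inv rfl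

namespace Infer

/-- A typed term, whose type is a type unless it is `sort large`. -/
def Valid (Γ : Ctx) (t A : Tm) : Prop :=
  HasType Γ t A ∧ (A = sort .large ∨ HasType Γ A (sort .large))

/-- `I` finds correct types only. -/
def Sound (I : Infer) : Prop := ∀ Γ t A, WfCtx Γ → I Γ t = some A → Valid Γ t A

variable {I : Infer} (hI : Sound I)
include hI

theorem sortOf_sound {Γ A s} (hΓ : WfCtx Γ) (h : sortOf I Γ A = some s) :
    HasType Γ A (sort s) := by
  obtain ⟨T, hT, h⟩ := Option.bind_eq_some_iff.mp h
  have h' := (hI _ _ _ hΓ hT).1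
  split at h
  · cases h; exact h'
  · split at h
    · next e =>
      cases h; exact h'.conv HasType.univ (e ▸ whnf_sound fuel T)
    · cases h

theorem withTy_sound {α : Type} {Γ A} {k : Option α} {x : α} (hΓ : WfCtx Γ)
    (h : withTy I Γ A k = some x) : HasType Γ A (sort .large) ∧ k = some x := by
  obtain ⟨s, hs, h⟩ := Option.bind_eq_some_iff.mp h
  exact ⟨(sortOf_sound hI hΓ hs).large, h⟩

/-- The first part is an implication because `HasType.conv` asks for the target to be a type. In
`step_sound` this is supplied from the parts of the term that have been checked before. -/
theorem withElem_sound {α : Type} {Γ t A} {k : Option α} {x : α} (hΓ : WfCtx Γ)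
    (h : withElem I Γ t A k = some x) :
    (HasType Γ A (sort .large) → HasType Γ t A) ∧ k = some x := by
  obtain ⟨A', hA', h⟩ := Option.bind_eq_some_iff.mp h
  cases hc : Tm.conv fuel A' A <;> rw [hc] at h
  · cases h
  · exact ⟨fun hA => (hI _ _ _ hΓ hA').1.conv hA (conv_sound _ _ _ hc), h⟩

theorem withPi_sound {Γ t T x} {k : Tm → Tm → Option Tm} (hΓ : WfCtx Γ) (ht : Valid Γ t T)
    (h : withPi I Γ T k = some x) : ∃ A B, HasType Γ t (Tm.pi A B) ∧
      HasType Γ A (sort .large) ∧ HasType (A :: Γ) B (sort .large) ∧ k A B = some x := by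
  unfold withPi at h
  split at h
  · next A B =>
    obtain ⟨hA, hB⟩ := (ht.2.resolve_left (by simp)).pi_wf
    exact ⟨A, B, ht.1, hA, hB, h⟩
  · split at h
    · next A B e =>
      obtain ⟨hAB, h⟩ := withTy_sound hI hΓ h
      exact ⟨A, B, ht.1.conv hAB (e ▸ whnf_sound fuel T), hAB.pi_wf.1, hAB.pi_wf.2, h⟩
    · cases h

theorem step_sound : Sound (step I) := by
  intro Γ t T hΓ h
  unfold step at h
  split at h
  · obtain ⟨A, hA, rfl⟩ := Option.map_eq_some_iff.mp h
    exact ⟨HasType.var hA, .inr (hΓ _ _ hA)⟩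
  · cases h; exact ⟨HasType.univ, .inl rfl⟩
  · obtain ⟨s, hs, h⟩ := Option.bind_eq_some_iff.mp h
    obtain ⟨s', hs', h⟩ := Option.bind_eq_some_iff.mp h
    have hA := sortOf_sound hI hΓ hs
    have hB := sortOf_sound hI (hΓ.cons hA.large) hs'
    cases h
    refine ⟨HasType.pi (hA.lub_left s') (hB.lub_right s), ?_⟩
    cases lub s s'
    · exact .inr HasType.univ
    · exact .inl rfl
  · obtain ⟨s, hs, h⟩ := Option.bind_eq_some_iff.mp h
    obtain ⟨s', hs', h⟩ := Option.bind_eq_some_iff.mp h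
    have hA := sortOf_sound hI hΓ hs
    have hB := sortOf_sound hI (hΓ.cons hA.large) hs'
    cases h
    refine ⟨HasType.sigma (hA.lub_left s') (hB.lub_right s), ?_⟩
    cases lub s s'
    · exact .inr HasType.univ
    · exact .inl rfl
  · obtain ⟨s, hs, h⟩ := Option.bind_eq_some_iff.mp h
    obtain ⟨s', hs', h⟩ := Option.bind_eq_some_iff.mp h
    have hA := sortOf_sound hI hΓ hs
    have hB := sortOf_sound hI hΓ hs'
    cases h
    refine ⟨HasType.sum (hA.lub_left s') (hB.lub_right s), ?_⟩
    cases lub s s'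
    · exact .inr HasType.univ
    · exact .inl rfl
  · obtain ⟨hA, h⟩ := withTy_sound hI hΓ h
    obtain ⟨B, hB, h⟩ := Option.bind_eq_some_iff.mp h
    have ht := hI _ _ _ (hΓ.cons hA) hB
    split at h
    · cases h
    · next hne =>
      cases h
      have hB' := ht.2.resolve_left hne
      exact ⟨HasType.lam hA hB' ht.1, .inr (HasType.pi hA hB')⟩
  · obtain ⟨F, hF, h⟩ := Option.bind_eq_some_iff.mp h
    obtain ⟨A, B, hf, hA, hB, h⟩ := withPi_sound hI hΓ (hI _ _ _ hΓ hF) h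
    obtain ⟨ha, h⟩ := withElem_sound hI hΓ h
    cases h
    exact ⟨HasType.app hf (ha hA), .inr (hB.inst (ha hA))⟩
  · obtain ⟨hA, h⟩ := withTy_sound hI hΓ h
    obtain ⟨hB, h⟩ := withTy_sound hI (hΓ.cons hA) h
    obtain ⟨ha, h⟩ := withElem_sound hI hΓ h
    obtain ⟨hb, h⟩ := withElem_sound hI hΓ h
    cases h
    exact ⟨HasType.pair hA hB (ha hA) (hb (hB.inst (ha hA))), .inr (HasType.sigma hA hB)⟩
  · next A B C d p =>
    obtain ⟨hA, h⟩ := withTy_sound hI hΓ h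
    obtain ⟨hB, h⟩ := withTy_sound hI (hΓ.cons hA) h
    have hAB := HasType.sigma hA hB
    obtain ⟨hC, h⟩ := withTy_sound hI (hΓ.cons hAB) h
    obtain ⟨hd, h⟩ := withElem_sound hI hΓ h
    obtain ⟨hp, h⟩ := withElem_sound hI hΓ h
    cases h
    have w := IsSub.weaken₂ Γ A B
    have hA' := hA.subst w
    have hB' := hB.subst (w.lift A)
    have e : B.subst (liftSub fun n => var (n + 2)) = B.upUnder 2 := by
      rw [upUnder, rename_eq_subst, liftSub_var]
    rw [← up_eq_subst] at hA' hB'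
    rw [e] at hB'
    have hpair : HasType (B :: A :: Γ) (pair (A.up 2) (B.upUnder 2) (var 1) (var 0))
        ((sigma A B).up 2) := by
      have : (sigma A B).up 2 = sigma (A.up 2) (B.upUnder 2) := rfl
      rw [this]
      refine HasType.pair hA' hB' (HasType.var rfl) ?_
      have h₀ := HasType.var (Γ := B :: A :: Γ) (n := 0) rfl
      convert h₀ using 1
      simp only [Tm.inst, upUnder, subst_rename]
      rw [up_eq_subst]
      congr 1; funext n; cases n <;> rfl
    have hd' := HasType.pi hA (HasType.pi hB (HasType.inst_upUnder₂ hC hpair))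
    exact ⟨HasType.split hA hB hC (hd hd') (hp hAB), .inr (hC.inst (hp hAB))⟩
  · obtain ⟨s, hs, h⟩ := Option.bind_eq_some_iff.mp h
    have hA := sortOf_sound hI hΓ hs
    obtain ⟨ha, h⟩ := withElem_sound hI hΓ h
    obtain ⟨hb, h⟩ := withElem_sound hI hΓ h
    cases h
    refine ⟨HasType.Id hA (ha hA.large) (hb hA.large), ?_⟩
    cases s
    · exact .inr HasType.univ
    · exact .inl rfl
  · obtain ⟨hA, h⟩ := withTy_sound hI hΓ h
    obtain ⟨ha, h⟩ := withElem_sound hI hΓ h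
    cases h
    exact ⟨HasType.refl hA (ha hA), .inr (HasType.Id hA (ha hA) (ha hA))⟩
  · obtain ⟨hA, h⟩ := withTy_sound hI hΓ h
    obtain ⟨ha, h⟩ := withElem_sound hI hΓ h
    have ha := ha hA
    obtain ⟨hC, h⟩ := withTy_sound hI ((hΓ.cons hA).cons
      (HasType.Id (hA.weaken _) (ha.weaken _) (HasType.var rfl))) h
    obtain ⟨hd, h⟩ := withElem_sound hI hΓ h
    obtain ⟨hb, h⟩ := withElem_sound hI hΓ h
    obtain ⟨hp, h⟩ := withElem_sound hI hΓ h
    cases h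
    have hb := hb hA
    have hp := hp (HasType.Id hA ha hb)
    have hd := hd (hC.inst₂ ha (HasType.refl hA ha))
    exact ⟨HasType.J hA ha hC hd hb hp, .inr (hC.inst₂ hb hp)⟩
  · obtain ⟨hA, h⟩ := withTy_sound hI hΓ h
    obtain ⟨hB, h⟩ := withTy_sound hI hΓ h
    obtain ⟨ha, h⟩ := withElem_sound hI hΓ h
    cases h
    exact ⟨HasType.inl hA hB (ha hA), .inr (HasType.sum hA hB)⟩
  · obtain ⟨hA, h⟩ := withTy_sound hI hΓ h
    obtain ⟨hB, h⟩ := withTy_sound hI hΓ h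
    obtain ⟨hb, h⟩ := withElem_sound hI hΓ h
    cases h
    exact ⟨HasType.inr hA hB (hb hB), .inr (HasType.sum hA hB)⟩
  · next A B C l r u =>
    obtain ⟨hA, h⟩ := withTy_sound hI hΓ h
    obtain ⟨hB, h⟩ := withTy_sound hI hΓ h
    have hAB := HasType.sum hA hB
    obtain ⟨hC, h⟩ := withTy_sound hI (hΓ.cons hAB) h
    obtain ⟨hl, h⟩ := withElem_sound hI hΓ h
    obtain ⟨hr, h⟩ := withElem_sound hI hΓ h
    obtain ⟨hu, h⟩ := withElem_sound hI hΓ h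
    cases h
    have hl := hl (HasType.pi hA (HasType.inst_upUnder₁ hC
      (HasType.inl (hA.weaken A) (hB.weaken A) (HasType.var rfl))))
    have hr := hr (HasType.pi hB (HasType.inst_upUnder₁ hC
      (HasType.inr (hA.weaken B) (hB.weaken B) (HasType.var rfl))))
    exact ⟨HasType.sumInd hA hB hC hl hr (hu hAB), .inr (hC.inst (hu hAB))⟩
  · obtain ⟨hV, h⟩ := withElem_sound hI hΓ h
    have hV := hV HasType.univ
    obtain ⟨hE, h⟩ := withElem_sound hI hΓ h
    have hE := hE (hV.el.arrow (hV.el.arrow HasType.univ))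
    cases h
    exact ⟨HasType.gq hV hE, .inr HasType.univ⟩
  · obtain ⟨hV, h⟩ := withElem_sound hI hΓ h
    have hV := hV HasType.univ
    obtain ⟨hE, h⟩ := withElem_sound hI hΓ h
    have hE := hE (hV.el.arrow (hV.el.arrow HasType.univ))
    obtain ⟨hi, h⟩ := withElem_sound hI hΓ h
    cases h
    exact ⟨HasType.pt hV hE (hi hV.el), .inr (HasType.gq hV hE).el⟩
  · obtain ⟨hV, h⟩ := withElem_sound hI hΓ h
    have hV := hV HasType.univ
    obtain ⟨hE, h⟩ := withElem_sound hI hΓ h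
    have hE := hE (hV.el.arrow (hV.el.arrow HasType.univ))
    obtain ⟨hi, h⟩ := withElem_sound hI hΓ h
    obtain ⟨hj, h⟩ := withElem_sound hI hΓ h
    obtain ⟨hT, h⟩ := withTy_sound hI hΓ h
    obtain ⟨he, h⟩ := withElem_sound hI hΓ h
    cases h
    exact ⟨HasType.edge hV hE (hi hV.el) (hj hV.el) (he hT), .inr (HasType.Id
      (HasType.gq hV hE).el (HasType.pt hV hE (hi hV.el)) (HasType.pt hV hE (hj hV.el)))⟩
  · obtain ⟨hV, h⟩ := withElem_sound hI hΓ h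
    have hV := hV HasType.univ
    obtain ⟨hE, h⟩ := withElem_sound hI hΓ h
    have hE := hE (hV.el.arrow (hV.el.arrow HasType.univ))
    have hQ := (HasType.gq hV hE).el
    obtain ⟨hC, h⟩ := withTy_sound hI (hΓ.cons hQ) h
    obtain ⟨hc', h⟩ := withTy_sound hI hΓ h
    obtain ⟨hc, h⟩ := withElem_sound hI hΓ h
    obtain ⟨hd', h⟩ := withTy_sound hI hΓ h
    obtain ⟨hd, h⟩ := withElem_sound hI hΓ h
    obtain ⟨hq, h⟩ := withElem_sound hI hΓ h
    cases h
    exact ⟨HasType.gqInd hV hE hC (hc hc') (hd hd') (hq hQ), .inr (hC.inst (hq hQ))⟩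
  · obtain ⟨hV, h⟩ := withElem_sound hI hΓ h
    have hV := hV HasType.univ
    obtain ⟨hE, h⟩ := withElem_sound hI hΓ h
    have hE := hE (hV.el.arrow (hV.el.arrow HasType.univ))
    have hQ := (HasType.gq hV hE).el
    obtain ⟨hC, h⟩ := withTy_sound hI (hΓ.cons hQ) h
    obtain ⟨hc', h⟩ := withTy_sound hI hΓ h
    obtain ⟨hc, h⟩ := withElem_sound hI hΓ h
    obtain ⟨hd', h⟩ := withTy_sound hI hΓ h
    obtain ⟨hd, h⟩ := withElem_sound hI hΓ h
    obtain ⟨hi, h⟩ := withElem_sound hI hΓ h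
    obtain ⟨hj, h⟩ := withElem_sound hI hΓ h
    obtain ⟨he', h⟩ := withTy_sound hI hΓ h
    obtain ⟨he, h⟩ := withElem_sound hI hΓ h
    obtain ⟨hT, h⟩ := withTy_sound hI hΓ h
    cases h
    exact ⟨HasType.gqIndEdge hV hE hC (hc hc') (hd hd') (hi hV.el) (hj hV.el) (he he'), .inr hT⟩
  · obtain ⟨hA, h⟩ := withTy_sound hI hΓ h
    obtain ⟨hB, h⟩ := withTy_sound hI (hΓ.cons hA) h
    obtain ⟨hT, h⟩ := withTy_sound hI hΓ h
    cases h
    exact ⟨HasType.funext hA hB, .inr hT⟩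
  · cases h

end Infer

theorem infer_sound (k : ℕ) : (infer k).Sound := by
  induction k with
  | zero => exact fun Γ t A _ h => by cases h
  | succ k ih => exact Infer.step_sound ih

end HoTT

namespace HoTT
open Tm

/-! ### Provable closed types -/

namespace Tm

/-- All free variables of a term are closedAt `k`. -/
def closedAt (k : ℕ) : Tm → Bool
  | var n => n.blt k
  | pi A B | lam A B | sigma A B | funext A B => A.closedAt k && B.closedAt (k + 1)
  | app A B | sum A B | gq A B | refl A B => A.closedAt k && B.closedAt k
  | pair A B a b => A.closedAt k && B.closedAt (k + 1) && a.closedAt k && b.closedAt k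
  | split A B C d p =>
    A.closedAt k && B.closedAt (k + 1) && C.closedAt (k + 1) && d.closedAt k && p.closedAt k
  | Id A a b | inl A a b | inr A a b | pt A a b => A.closedAt k && a.closedAt k && b.closedAt k
  | J A a C d b p =>
    A.closedAt k && a.closedAt k && C.closedAt (k + 2) && d.closedAt k && b.closedAt k && p.closedAt k
  | sumInd A B C l r u =>
    A.closedAt k && B.closedAt k && C.closedAt (k + 1) && l.closedAt k && r.closedAt k && u.closedAt k
  | edge V E i j e => V.closedAt k && E.closedAt k && i.closedAt k && j.closedAt k && e.closedAt k
  | gqInd V E C c d q =>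
    V.closedAt k && E.closedAt k && C.closedAt (k + 1) && c.closedAt k && d.closedAt k && q.closedAt k
  | sort _ => true
  -- A conservative answer for the remaining term formers: `closedAt` is only used when it is true.
  | _ => false

theorem liftSub_eq_var {k : ℕ} {σ : ℕ → Tm} (h : ∀ n < k, σ n = var n) :
    ∀ n < k + 1, liftSub σ n = var n := by
  rintro (_ | n) hn
  · rfl
  · rw [liftSub, h n (by omega)]; rfl

theorem subst_of_closedAt (t : Tm) : ∀ (k : ℕ) (σ : ℕ → Tm), t.closedAt k = true →
    (∀ n < k, σ n = var n) → t.subst σ = t := by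
  induction t <;> intro k σ h hσ <;> simp only [closedAt, Bool.and_eq_true, Bool.false_eq_true] at h
  case var n => exact hσ n (by simpa using h)
  all_goals
    have hσ₁ := liftSub_eq_var hσ
    have hσ₂ := liftSub_eq_var hσ₁
    simp only [subst]
  all_goals casesm* _ ∧ _
  all_goals congr 1 <;> apply_assumption <;> assumption

end Tm

/-- The closed type `T` has a closed element. -/
structure Provable (T : Tm) : Prop where
  closed : T.closedAt 0 = true
  isType : HasType [] T (sort .large)
  inhabited : ∃ t, HasType [] t T

end HoTT
namespace HoTT
open Tm

theorem Tm.up_of_closed {T : Tm} (h : T.closedAt 0 = true) (k : ℕ) : T.up k = T := by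
  rw [up, rename_eq_subst]; exact subst_of_closedAt T 0 _ h (by simp)

theorem Tm.inst_of_closed {T : Tm} (h : T.closedAt 0 = true) (u : Tm) : T.inst u = T :=
  subst_of_closedAt T 0 _ h (by simp)

/-- The second clause records that a closed subject is unchanged by weakening. It is needed when the
subject is itself a type to be used in `Γ`, as in `Provable.isType_in`. -/
theorem HasType.weaken_closed {A T : Tm} {t : Tm} (hA : A.closedAt 0 = true)
    (h : HasType [] t A) (Γ : Ctx) : ∃ t', HasType Γ t' A ∧ (t = T → T.closedAt 0 = true → t' = T) := by
  induction Γ with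
  | nil => exact ⟨t, h, fun e _ => e⟩
  | cons B Γ ih =>
    obtain ⟨t', h', e⟩ := ih
    refine ⟨t'.up 1, ?_, fun e₁ e₂ => by rw [e e₁ e₂, up_of_closed e₂]⟩
    simpa only [up_of_closed hA] using h'.weaken B

theorem Provable.isType_in {T : Tm} (h : Provable T) (Γ : Ctx) : HasType Γ T (sort .large) := by
  obtain ⟨t, ht, e⟩ := HasType.weaken_closed (T := T) rfl h.isType Γ
  exact e rfl h.closed ▸ ht

theorem WfCtx.of_provable {Γ : Ctx} (h : ∀ T ∈ Γ, Provable T) : WfCtx Γ := by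
  induction Γ with
  | nil => exact WfCtx.nil
  | cons T Γ ih =>
    exact (ih fun S hS => h S (List.mem_cons_of_mem _ hS)).cons
      ((h T List.mem_cons_self).isType_in Γ)

/-- Provable types may be used as hypotheses. -/
theorem cut {Γ : Ctx} (h : ∀ T ∈ Γ, Provable T) {T t : Tm} (hT : T.closedAt 0 = true)
    (ht : HasType Γ t T) : ∃ t, HasType [] t T := by
  induction Γ generalizing t with
  | nil => exact ⟨t, ht⟩
  | cons S Γ ih =>
    have hS := h S List.mem_cons_self
    obtain ⟨s, hs⟩ := hS.inhabited
    obtain ⟨s', hs', -⟩ := HasType.weaken_closed (T := s) hS.closed hs Γ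
    -- The last hypothesis is replaced by a proof of it, weakened from the empty context; `T` is
    -- closed and stays the same.
    have := ht.inst hs'
    rw [inst_of_closed hT] at this
    exact ih (fun S hS => h S (List.mem_cons_of_mem _ hS)) this

/-- A proof of `T` from provable hypotheses, as found by the type checker. -/
theorem Provable.of_check {Γ : Ctx} (hΓ : ∀ T ∈ Γ, Provable T) {T t : Tm}
    (hc : T.closedAt 0 = true)
    (h : Infer.withTy (infer fuel) [] T (Infer.withElem (infer fuel) Γ t T (some ())) = some ()) :
    Provable T := by
  obtain ⟨hT, h⟩ := Infer.withTy_sound (infer_sound _) WfCtx.nil h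
  obtain ⟨ht, -⟩ := Infer.withElem_sound (infer_sound _) (WfCtx.of_provable hΓ) h
  obtain ⟨S, hS, e⟩ := HasType.weaken_closed (T := T) rfl hT Γ
  exact ⟨hc, hT, cut hΓ hc (ht (e rfl hc ▸ hS))⟩

/-! ### Elaboration -/

/-- The result of an elaboration; failures carry the terms that caused them. -/
abbrev Res : Type → Type := Except (ℕ × List Tm)

/-- An expression of the surface language: it takes a context, and possibly an expected type,
to a term and its type. Elaboration is not trusted: its result is type checked. -/
structure Ex where
  /-- Elaborate an expression. -/
  run : Ctx → Option Tm → Res (Tm × Tm)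

/-- An argument of an application, possibly implicit. -/
inductive Arg
  | hole : Arg
  | ex (e : Ex) : Arg

instance : Coe Ex Arg := ⟨Arg.ex⟩

namespace Ex

/-- The variable with de Bruijn level `l`. -/
def lvl (l : ℕ) : Ex := ⟨fun Γ _ =>
  let n := Γ.length - 1 - l
  match Γ[n]? with
  | some A => .ok (var n, A.up (n + 1))
  | none => .error (0, [])⟩

/-- The last variable of a context that extends `Γ` by one variable. -/
def last (Γ : Ctx) : Ex := lvl Γ.length

/-- Elaborate a type under a binder. -/
def under (Γ : Ctx) (A : Tm) (B : Ex → Ex) (T : Option Tm) : Res (Tm × Tm) :=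
  (B (last Γ)).run (A :: Γ) T

def U : Ex := ⟨fun _ _ => .ok (univ, sort .large)⟩

/-- The reported type `univ` is wrong when the product is large. This is harmless, since sorts are
recomputed by the checker. -/
def Pi (A : Ex) (B : Ex → Ex) : Ex := ⟨fun Γ _ => do
  let (A, _) ← A.run Γ none
  let (B, _) ← under Γ A B none
  .ok (pi A B, univ)⟩

def Sig (A : Ex) (B : Ex → Ex) : Ex := ⟨fun Γ _ => do
  let (A, _) ← A.run Γ none
  let (B, _) ← under Γ A B none
  .ok (sigma A B, univ)⟩

def arr (A B : Ex) : Ex := Pi A fun _ => B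

/-- The domain and codomain of a dependent function type. -/
def asPi (T : Tm) : Res (Tm × Tm) :=
  match T with
  | pi A B => .ok (A, B)
  | T => match whnf fuel T with
    | pi A B => .ok (A, B)
    | T => .error (1, [T])

def asSigma (T : Tm) : Res (Tm × Tm) :=
  match T with
  | sigma A B => .ok (A, B)
  | T => match whnf fuel T with
    | sigma A B => .ok (A, B)
    | T => .error (2, [T])

def asId (T : Tm) : Res (Tm × Tm × Tm) :=
  match T with
  | Tm.Id A a b => .ok (A, a, b)
  | T => match whnf fuel T with
    | Tm.Id A a b => .ok (A, a, b)
    | T => .error (3, [T])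

def expected (T : Option Tm) : Res Tm :=
  match T with
  | some T => .ok T
  | none => .error (4, [])

/-- A function whose domain is determined by the expected type. -/
def lam (t : Ex → Ex) : Ex := ⟨fun Γ T => do
  let (A, B) ← asPi (← expected T)
  let (t, B) ← under Γ A t (some B)
  .ok (Tm.lam A t, pi A B)⟩

/-- A function with given domain. -/
def fn (A : Ex) (t : Ex → Ex) : Ex := ⟨fun Γ _ => do
  let (A, _) ← A.run Γ none
  let (t, B) ← under Γ A t none
  .ok (Tm.lam A t, pi A B)⟩

/-- Type ascription. -/
def asc (A e : Ex) : Ex := ⟨fun Γ _ => do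
  let (A, _) ← A.run Γ none
  let (t, _) ← e.run Γ (some A)
  .ok (t, A)⟩

/-- A pair; its type is the expected type. -/
def pair (a b : Ex) : Ex := ⟨fun Γ T => do
  let (A, B) ← asSigma (← expected T)
  let (a, _) ← a.run Γ (some A)
  let (b, _) ← b.run Γ (some (B.inst a))
  .ok (Tm.pair A B a b, sigma A B)⟩

def fst (p : Ex) : Ex := ⟨fun Γ _ => do
  let (p, P) ← p.run Γ none
  let (A, B) ← asSigma P
  .ok (Tm.fst A B p, A)⟩

def snd (p : Ex) : Ex := ⟨fun Γ _ => do
  let (p, P) ← p.run Γ none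
  let (A, B) ← asSigma P
  .ok (Tm.snd A B p, B.inst (Tm.fst A B p))⟩

def Id (a b : Ex) : Ex := ⟨fun Γ _ => do
  let (a, A) ← a.run Γ none
  let (b, _) ← b.run Γ (some A)
  .ok (Tm.Id A a b, univ)⟩

/-- The constant path at `a`. -/
def rfl (a : Ex) : Ex := ⟨fun Γ _ => do
  let (a, A) ← a.run Γ none
  .ok (Tm.refl A a, Tm.Id A a a)⟩

def inv (p : Ex) : Ex := ⟨fun Γ _ => do
  let (p, P) ← p.run Γ none
  let (A, a, b) ← asId P
  .ok (Tm.inv A a b p, Tm.Id A b a)⟩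

def concat (p q : Ex) : Ex := ⟨fun Γ _ => do
  let (p, P) ← p.run Γ none
  let (q, Q) ← q.run Γ none
  let (A, a, b) ← asId P
  let (_, _, c) ← asId Q
  .ok (Tm.concat A a b c p q, Tm.Id A a c)⟩

/-- The action of a function on a path. -/
def ap (f p : Ex) : Ex := ⟨fun Γ _ => do
  let (p, P) ← p.run Γ none
  let (A, a, b) ← asId P
  let (f, F) ← f.run Γ none
  let (_, B) ← asPi F
  let B := B.inst a
  .ok (Tm.ap A B f a b p, Tm.Id B (app f a) (app f b))⟩

/-- The action on a path of the function that takes `x` to `t x`. -/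
def apFn (t : Ex → Ex) (p : Ex) : Ex := ⟨fun Γ _ => do
  let (p, P) ← p.run Γ none
  let (A, a, b) ← asId P
  let (t, B) ← under Γ A t none
  let f := Tm.lam A t
  let B := B.inst a
  .ok (Tm.ap A B f a b p, Tm.Id B (app f a) (app f b))⟩

/-- Transport of `u : C a` along `p : a = b`. -/
def tr (C : Ex → Ex) (p u : Ex) : Ex := ⟨fun Γ _ => do
  let (p, P) ← p.run Γ none
  let (A, a, b) ← asId P
  let (C, _) ← under Γ A C none
  let (u, _) ← u.run Γ (some (C.inst a))
  .ok (Tm.tr A C a b p u, C.inst b)⟩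

/-- Path induction, for a path with variable right end, with the expected type as motive. -/
def ind (p d : Ex) : Ex := ⟨fun Γ T => do
  let T ← expected T
  let (p, P) ← p.run Γ none
  let (A, a, b) ← asId P
  match p, b with
  | var i, var j =>
    -- The motive abstracts the path as variable `0` and its endpoint as variable `1`. Anything that
    -- depends on them must still be bound in the goal, which dictates the order of the binders in
    -- the statements of lemmas.
    let C := T.subst fun n =>
      cond (Nat.beq n i) (var 0) (cond (Nat.beq n j) (var 1) (var (n + 2)))
    let (d, _) ← d.run Γ (some (C.inst₂ a (Tm.refl A a)))
    .ok (Tm.J A a C d b p, T)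
  | p, b => .error (5, [p, b])⟩

/-- Induction for pairs, for a variable, with the expected type as motive. -/
def cases (p : Ex) (d : Ex → Ex → Ex) : Ex := ⟨fun Γ T => do
  let T ← expected T
  let (p, P) ← p.run Γ none
  let (A, B) ← asSigma P
  match p with
  | var i =>
    let C := T.subst fun n => cond (Nat.beq n i) (var 0) (var (n + 1))
    let (d, _) ← (lam fun a => lam fun b => d a b).run Γ (some (pi A (pi B
        ((C.upUnder 2).inst (Tm.pair (A.up 2) (B.upUnder 2) (var 1) (var 0))))))
    .ok (Tm.split A B C d p, T)
  | p => .error (6, [p])⟩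

/-- Name the components of a pair, for an expected type that does not depend on it. -/
def unpack (p : Ex) (d : Ex → Ex → Ex) : Ex := ⟨fun Γ T => do
  let T ← expected T
  let (p, P) ← p.run Γ none
  let (A, B) ← asSigma P
  let (d, _) ← (lam fun a => lam fun b => d a b).run Γ (some (pi A (pi B (T.up 2))))
  .ok (Tm.split A B (T.up 1) d p, T)⟩

/-- A local lemma. -/
def have' (A a : Ex) (t : Ex → Ex) : Ex := ⟨fun Γ T => do
  let (A, _) ← A.run Γ none
  let (a, _) ← a.run Γ (some A)
  let (t, B) ← under Γ A t (T.map (up 1))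
  .ok (app (Tm.lam A t) a, B.inst a)⟩

/-- The direct subterms of a term, with the number of variables that get bound in them. -/
def parts : Tm → List (ℕ × Tm)
  | Tm.pi A B | Tm.lam A B | sigma A B | Tm.funext A B => [(0, A), (1, B)]
  | app A B | sum A B | gq A B | Tm.refl A B => [(0, A), (0, B)]
  | Tm.pair A B a b => [(0, A), (1, B), (0, a), (0, b)]
  | split A B C d p => [(0, A), (1, B), (1, C), (0, d), (0, p)]
  | Tm.Id A a b | inl A a b | inr A a b | pt A a b => [(0, A), (0, a), (0, b)]
  | J A a C d b p => [(0, A), (0, a), (2, C), (0, d), (0, b), (0, p)]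
  | sumInd A B C l r u => [(0, A), (0, B), (1, C), (0, l), (0, r), (0, u)]
  | edge V E i j e => [(0, V), (0, E), (0, i), (0, j), (0, e)]
  | gqInd V E C c d q => [(0, V), (0, E), (1, C), (0, c), (0, d), (0, q)]
  | _ => []

/-- The variables from `metas` on stand for implicit arguments. -/
def metas : ℕ := 100000

/-- Values of implicit arguments. -/
abbrev Sol : Type := List (ℕ × Tm)

def Sol.find (s : Sol) (i : ℕ) : Option Tm :=
  match s with
  | [] => none
  | (j, t) :: s => cond (Nat.beq i j) (some t) (Sol.find s i)

/-- Fill in the known implicit arguments. -/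
def Sol.fill (s : Sol) (t : Tm) : Tm := t.subst fun n =>
  cond (Nat.ble metas n) ((s.find (n - metas)).getD (var n)) (var n)

/-- First order matching of `p` against `t`, below `d` binders. -/
def unify : ℕ → ℕ → Tm → Tm → Sol → Sol
  | 0 => fun _ _ _ s => s
  | k + 1 => fun d p t s =>
    match p with
    | var n => cond (Nat.ble metas n)
        (match s.find (n - d - metas) with
          | some _ => s
          -- The truncated subtraction gives a wrong term if `t` mentions one of the `d` bound
          -- variables; the checker would then reject the result.
          | none => (n - d - metas, t.rename fun m => m - d) :: s) s
    | p => match cong (fun _ _ => true) p t with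
      | true => (List.zip (parts p) (parts t)).foldl
          (fun s x => unify k (d + x.1.1) x.1.2 x.2.2 s) s
      | false =>
        let p' := whnf fuel p
        let t' := whnf fuel t
        match cong (fun _ _ => true) p' t' with
        | true => (List.zip (parts p') (parts t')).foldl
          (fun s x => unify k (d + x.1.1) x.1.2 x.2.2 s) s
        | false => s

/-- The types of the arguments, and the type of the application, in terms of variables
for the arguments. -/
def telescope (i : ℕ) (T : Tm) (args : List Arg) : Res (List (ℕ × Arg × Tm) × Tm) :=
  match args with
  | [] => .ok ([], T)
  | a :: args => do
    let (A, B) ← asPi T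
    let (l, R) ← telescope (i + 1) (B.inst (var (metas + i))) args
    .ok ((i, a, A) :: l, R)

/-- Whether all implicit arguments have been found. -/
def Sol.complete (s : Sol) (args : List (ℕ × Arg × Tm)) : Bool :=
  args.all fun x => match x.2.1 with
    | .hole => (s.find x.1).isSome
    | .ex _ => true

/-- Elaborate the arguments `l` of an application with arguments `args`. -/
def elabArgs (Γ : Ctx) (args l : List (ℕ × Arg × Tm)) (s : Sol) : Res Sol :=
  match l with
  | [] => .ok s
  | (_, .hole, _) :: l => elabArgs Γ args l s
  | (i, .ex e, P) :: l => do
    let P := s.fill P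
    let (a, S) ← e.run Γ (some P)
    elabArgs Γ args l (cond (s.complete args) ((i, a) :: s) (unify fuel 0 P S ((i, a) :: s)))

def applyArgs (s : Sol) (f : Tm) (l : List (ℕ × Arg × Tm)) : Res Tm :=
  match l with
  | [] => .ok f
  | (i, _, P) :: l => match s.find i with
    | some a => applyArgs s (app f a) l
    | none => .error (7, [var i, P])

/-- Application to arguments, some of which may be implicit. -/
def app (f : Ex) (args : List Arg) : Ex := ⟨fun Γ T => do
  let (f, F) ← f.run Γ none
  let (l, R) ← telescope 0 F args
  let s := match T with
    | some T => unify fuel 0 R T []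
    | none => []
  let s ← elabArgs Γ l l s
  .ok (← applyArgs s f l, s.fill R)⟩

/-- Application to explicit arguments. -/
def apps (Γ : Ctx) (f F : Tm) (args : List Arg) : Res (Tm × Tm) :=
  match args with
  | [] => .ok (f, F)
  | .hole :: _ => .error (8, [])
  | .ex e :: args => do
    let (A, B) ← asPi F
    let (a, _) ← e.run Γ (some A)
    apps Γ (Tm.app f a) (B.inst a) args

def isHole : Arg → Bool
  | .hole => true
  | .ex _ => false

/-- Application to arguments. -/
def call (f : Ex) (args : List Arg) : Ex :=
  cond (args.any isHole) (app f args) ⟨fun Γ _ => do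
    let (f, F) ← f.run Γ none
    apps Γ f F args⟩

instance : CoeFun Ex fun _ => List Arg → Ex := ⟨call⟩

end Ex

/-- The term of a closed expression. -/
def Ex.toTm (e : Ex) : Tm :=
  match e.run [] none with
  | .ok (t, _) => t
  | .error _ => star

/-- A type together with a proof that it is provable. -/
abbrev Fact : Type := {T : Tm // Provable T}

/-- The context of hypotheses given by a list of facts. -/
def hyps (l : List Fact) : Ctx := (l.map Subtype.val).reverse

/-- Elaborate and check a proof of `T` which uses some facts. -/
def checkProof (Γ : Ctx) (T : Tm) (e : (ℕ → Ex) → Ex) : Bool :=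
  T.closedAt 0 && match (e Ex.lvl).run Γ (some T) with
    | .ok (t, _) =>
      (Infer.withTy (infer fuel) [] T (Infer.withElem (infer fuel) Γ t T (some ()))).isSome
    | .error _ => false

/-- The reflection principle behind all lemmas of the object theory. `hyps` reverses the list, so
that `e` reaches fact number `i` of `l` as the variable of level `i`. -/
theorem prove (l : List Fact) {T : Tm} (e : (ℕ → Ex) → Ex)
    (h : checkProof (hyps l) T e = true) : Provable T := by
  rw [checkProof, Bool.and_eq_true] at h
  obtain ⟨hc, h⟩ := h
  split at h
  · refine Provable.of_check (Γ := hyps l) (fun S hS => ?_) hc (Option.isSome_iff_exists.mp h).choose_spec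
    obtain ⟨x, -, rfl⟩ := List.mem_map.mp (List.mem_reverse.mp hS)
    exact x.2
  · cases h

end HoTT

namespace HoTT
namespace Ex

/-- An argument to be found by unification. -/
abbrev imp : Arg := .hole

/-! ### Paths -/

def reflConcatType : Tm := toTm <|
  Pi U fun A => Pi A fun a => Pi A fun b => Pi (Id a b) fun p => Id (concat (rfl a) p) p

/-- `concat` is defined by induction on its second path: `concat p refl` computes to `p`, while this
other unit law is only propositional. -/
theorem reflConcat : Provable reflConcatType := prove [] (fun _ =>
  lam fun _ => lam fun a => lam fun _ => lam fun p => ind p (rfl (rfl a)))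
  (by decide +kernel)

def concatInvType : Tm := toTm <|
  Pi U fun A => Pi A fun a => Pi A fun b => Pi (Id a b) fun p => Id (rfl a) (concat p (inv p))

theorem concatInv : Provable concatInvType := prove [] (fun _ =>
  lam fun _ => lam fun a => lam fun _ => lam fun p => ind p (rfl (rfl a)))
  (by decide +kernel)

def moveInvType : Tm := toTm <|
  Pi U fun A => Pi A fun x => Pi A fun y => Pi (Id x y) fun p => Pi A fun z =>
  Pi (Id y z) fun q => Pi (Id x z) fun r => arr (Id p (concat r (inv q))) (Id (concat p q) r)

/-- When `q` is constant, both equations compute to `p = r`. -/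
theorem moveInv : Provable moveInvType := prove [] (fun _ =>
  lam fun _ => lam fun _ => lam fun _ => lam fun _ => lam fun _ => lam fun q =>
  ind q (lam fun _ => lam fun h => h))
  (by decide +kernel)

def reflConjType : Tm := toTm <|
  Pi U fun A => Pi A fun x => Pi A fun y => Pi (Id x y) fun q =>
  Id (rfl y) (concat (inv q) (concat (rfl x) q))

theorem reflConj : Provable reflConjType := prove [] (fun _ =>
  lam fun _ => lam fun x => lam fun _ => lam fun q => ind q (rfl (rfl x)))
  (by decide +kernel)

/-- A map with a left inverse acts injectively on paths. -/
def retractPathType : Tm := toTm <|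
  Pi U fun A => Pi U fun B => Pi (arr A B) fun f => Pi (arr B A) fun r =>
  Pi (Pi A fun x => Id (r [f [x]]) x) fun η => Pi A fun x => Pi A fun y => Pi (Id x y) fun p =>
  Id p (concat (inv (η [x])) (concat (ap r (ap f p)) (η [y])))

/-- Naturality of `η : r ∘ f ~ id`, solved for `p`; this recovers `p` from `ap f p`. -/
theorem retractPath : Provable retractPathType := prove [⟨_, reflConj⟩] (fun v =>
  lam fun _ => lam fun _ => lam fun _ => lam fun _ => lam fun η => lam fun x => lam fun _ =>
  lam fun p => ind p (v 0 [imp, imp, imp, η [x]]))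
  (by decide +kernel)

def conjCancelType : Tm := toTm <|
  Pi U fun A => Pi A fun u => Pi A fun v => Pi (Id u v) fun p => Pi (Id u v) fun q =>
  Pi A fun x => Pi (Id u x) fun s => Pi A fun y => Pi (Id v y) fun t =>
  arr (Id (concat (inv s) (concat p t)) (concat (inv s) (concat q t))) (Id p q)

theorem conjCancel : Provable conjCancelType := prove [⟨_, reflConcat⟩] (fun v =>
  lam fun _ => lam fun _ => lam fun _ => lam fun p => lam fun q => lam fun _ => lam fun s =>
  lam fun _ => lam fun t => ind t (ind s (lam fun h =>
    concat (concat (inv (v 0 [imp, imp, imp, p])) h) (v 0 [imp, imp, imp, q]))))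
  (by decide +kernel)

end Ex
end HoTT

namespace HoTT
namespace Ex

/-! ### Function extensionality -/

/-- A primitive term, with its type, as a function of two terms. -/
def prim₂ (F T : Tm → Tm → Tm) (a b : Ex) : Ex := ⟨fun Γ _ => do
  let (a, _) ← a.run Γ none
  let (b, _) ← b.run Γ none
  .ok (F a b, T a b)⟩

/-- The value at `x` of the homotopy given by a path between functions. -/
def at' (e : Ex) (x : Ex) : Ex := apFn (fun φ => φ [x]) e

/-- The family of types given by a function `B : A → U`. -/
def family (B : Tm) : Tm := .app (B.up 1) (.var 0)

def funextOf (A B : Ex) : Ex :=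
  prim₂ (fun A B => Tm.funext A (family B)) (fun A B => Tm.funextType A (family B)) A B

def happlyOf (A B f g : Ex) : Ex := ⟨fun Γ _ => do
  let (A, _) ← A.run Γ none
  let (B, _) ← B.run Γ none
  let (f, _) ← f.run Γ none
  let (g, _) ← g.run Γ none
  .ok (Tm.happly A (family B) f g,
    Tm.arrow (Tm.Id (Tm.pi A (family B)) f g) (Tm.homotopy A (family B) f g))⟩

def happlyAtType : Tm := toTm <|
  Pi U fun A => Pi (arr A U) fun B => Pi (Pi A fun x => B [x]) fun f =>
  Pi (Pi A fun x => B [x]) fun g => Pi (Id f g) fun e => Pi A fun x =>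
  Id (at' e x) (happlyOf A B f g [e, x])

/-- The axiom speaks of `happly`; `at'`, the action on paths of evaluation at a point, is the form
used everywhere else. -/
theorem happlyAt : Provable happlyAtType := prove [] (fun _ =>
  lam fun _ => lam fun _ => lam fun f => lam fun _ => lam fun e => ind e (lam fun x =>
    rfl (rfl (f [x]))))
  (by decide +kernel)

def funExtType : Tm := toTm <|
  Pi U fun A => Pi (arr A U) fun B => Pi (Pi A fun x => B [x]) fun f =>
  Pi (Pi A fun x => B [x]) fun g => Pi (Pi A fun x => Id (f [x]) (g [x])) fun h =>
  Sig (Id f g) fun e => Pi A fun x => Id (at' e x) (h [x])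

theorem funExt : Provable funExtType := prove [⟨_, happlyAt⟩] (fun v =>
  lam fun A => lam fun B => lam fun f => lam fun g => lam fun h =>
    unpack (fst (funextOf A B [f, g])) fun s ε =>
    pair (s [h]) (lam fun x => concat (v 0 [A, B, f, g, s [h], x]) (at' (ε [h]) x)))
  (by decide +kernel)

/-- A map with a left inverse is injective. -/
def retractInjType : Tm := toTm <|
  Pi U fun A => Pi U fun B => Pi (arr A B) fun f => Pi (arr B A) fun r =>
  Pi (Pi A fun x => Id (r [f [x]]) x) fun _ => Pi A fun x => Pi A fun y =>
  arr (Id (f [x]) (f [y])) (Id x y)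

theorem retractInj : Provable retractInjType := prove [] (fun _ =>
  lam fun _ => lam fun _ => lam fun _ => lam fun r => lam fun η => lam fun x => lam fun y =>
  lam fun p => concat (inv (η [x])) (concat (ap r p) (η [y])))
  (by decide +kernel)

def funExtInjType : Tm := toTm <|
  Pi U fun A => Pi (arr A U) fun B => Pi (Pi A fun x => B [x]) fun f =>
  Pi (Pi A fun x => B [x]) fun g => Pi (Id f g) fun e => Pi (Id f g) fun e' =>
  arr (Pi A fun x => Id (at' e x) (at' e' x)) (Id e e')

/-- `happly` has a left inverse, hence is injective; the two homotopies to be compared are equal by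
function extensionality. -/
theorem funExtInj : Provable funExtInjType :=
  prove [⟨_, happlyAt⟩, ⟨_, funExt⟩, ⟨_, retractInj⟩] (fun v =>
  lam fun A => lam fun B => lam fun f => lam fun g => lam fun e => lam fun e' => lam fun h =>
    let H := happlyOf A B f g
    unpack (snd (funextOf A B [f, g])) fun r η =>
    v 2 [Id f g, Pi A fun x => Id (f [x]) (g [x]), H, r, η, e, e',
      fst (v 1 [A, fn A fun x => Id (f [x]) (g [x]), H [e], H [e'], lam fun x =>
        concat (inv (v 0 [A, B, f, g, e, x])) (concat (h [x]) (v 0 [A, B, f, g, e', x]))])])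
  (by decide +kernel)

/-- A map with a left inverse acts injectively on paths. -/
def retractPathInjType : Tm := toTm <|
  Pi U fun A => Pi U fun B => Pi (arr A B) fun f => Pi (arr B A) fun r =>
  Pi (Pi A fun x => Id (r [f [x]]) x) fun _ => Pi A fun x => Pi A fun y =>
  Pi (Id x y) fun p => Pi (Id x y) fun q => arr (Id (ap f p) (ap f q)) (Id p q)

theorem retractPathInj : Provable retractPathInjType := prove [⟨_, retractPath⟩] (fun v =>
  lam fun A => lam fun B => lam fun f => lam fun r => lam fun η => lam fun x => lam fun y =>
  lam fun p => lam fun q => lam fun h =>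
    concat (v 0 [A, B, f, r, η, x, y, p])
      (concat (apFn (fun t => concat (inv (η [x])) (concat (ap r t) (η [y]))) h)
        (inv (v 0 [A, B, f, r, η, x, y, q]))))
  (by decide +kernel)

/-- An equivalence acts surjectively on paths. -/
def equivPathSurjType : Tm := toTm <|
  Pi U fun A => Pi U fun B => Pi (arr A B) fun f => Pi (arr B A) fun s =>
  Pi (Pi B fun y => Id (f [s [y]]) y) fun _ => Pi (arr B A) fun r =>
  Pi (Pi A fun x => Id (r [f [x]]) x) fun _ => Pi A fun x => Pi A fun y =>
  Pi (Id (f [x]) (f [y])) fun e => Sig (Id x y) fun p => Id (ap f p) e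

theorem equivPathSurj : Provable equivPathSurjType :=
  prove [⟨_, retractPath⟩, ⟨_, retractPathInj⟩, ⟨_, conjCancel⟩] (fun v =>
  lam fun A => lam fun B => lam fun f => lam fun s => lam fun ε => lam fun r => lam fun η =>
  lam fun x => lam fun y => lam fun e =>
    -- The right inverse is also a left inverse: `s (f x) = r (f (s (f x))) = r (f x) = x`.
    have' (Pi A fun x => Id (s [f [x]]) x)
      (lam fun x => concat (inv (η [s [f [x]]])) (concat (ap r (ε [f [x]])) (η [x]))) fun θ =>
    let P := concat (inv (θ [x])) (concat (ap s e) (θ [y]))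
    -- Since `s` has the left inverse `f`, it suffices to compare `ap s (ap f P)` with `ap s e`.
    -- Conjugated by `θ` both become `P`, the first by `retractPath` and the second by definition.
    pair P (v 1 [B, A, s, f, ε, f [x], f [y], ap f P, e,
      v 2 [A, s [f [x]], s [f [y]], ap s (ap f P), ap s e, x, θ [x], y, θ [y],
        inv (v 0 [A, B, f, s, θ, x, y, P])]]))
  (by decide +kernel)

end Ex
end HoTT

namespace HoTT
namespace Ex

/-! ### Local types -/

/-- A type built from two types. -/
def type₂ (F : Tm → Tm → Tm) (a b : Ex) : Ex := prim₂ F (fun _ _ => Tm.univ) a b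

def IsLocal (K Z : Ex) : Ex := type₂ Tm.isLocal K Z

def IsConn (K Z : Ex) : Ex := type₂ Tm.isConn K Z

/-- Every map `K → Z` is constant. -/
def Ext (K Z : Ex) : Ex :=
  Pi (arr K Z) fun φ => Sig Z fun z => Pi K fun k => Id z (φ [k])

/-- The map that takes `z : Z` to the constant map `K → Z`. -/
def const (K Z : Ex) : Ex := fn Z fun z => fn K fun _ => z

def localExtType : Tm := toTm <| Pi U fun K => Pi U fun Z => arr (IsLocal K Z) (Ext K Z)

theorem localExt : Provable localExtType := prove [] (fun _ =>
  lam fun _ => lam fun _ => lam fun l => lam fun φ =>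
    pair (fst (fst l) [φ]) (lam fun k => at' (snd (fst l) [φ]) k))
  (by decide +kernel)

def localOfExtType : Tm := toTm <|
  Pi U fun K => Pi U fun Z => Pi (Ext K Z) fun _ =>
  Pi (Pi Z fun z => Pi Z fun z' => arr (arr K (Id z z')) (Id z z')) fun _ => IsLocal K Z

/-- The chosen constant value `s φ` of `φ` gives both inverses of `z ↦ const z`. The values `s
(const z)` and `z` are related by a path for each point of `K`, and the second hypothesis removes
the dependence on that point. -/
theorem localOfExt : Provable localOfExtType := prove [⟨_, funExt⟩] (fun v =>
  lam fun K => lam fun Z => lam fun e => lam fun w =>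
    let s := lam fun φ => fst (e [φ])
    pair
      (pair s (lam fun φ => fst (v 0 [K, fn K fun _ => Z, fn K fun _ => fst (e [φ]), φ,
        lam fun k => snd (e [φ]) [k]])))
      (pair s (lam fun z =>
        let c := fn K fun _ => z
        w [fst (e [c]), z, snd (e [c])])))
  (by decide +kernel)

def constApType : Tm := toTm <|
  Pi U fun K => Pi U fun Z => Pi Z fun z => Pi Z fun z' => Pi (Id z z') fun p => Pi K fun k =>
  Id p (at' (ap (const K Z) p) k)

theorem constAp : Provable constApType := prove [] (fun _ =>
  lam fun _ => lam fun _ => lam fun z => lam fun _ => lam fun p => ind p (lam fun _ =>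
    rfl (rfl z)))
  (by decide +kernel)

/-- The path types of a local type are local. -/
def localPathType : Tm := toTm <|
  Pi U fun K => Pi U fun Z => Pi (IsLocal K Z) fun _ => Pi Z fun z => Pi Z fun z' =>
  IsLocal K (Id z z')

/-- As `const` is an equivalence, `ap const` is surjective and injective on paths. Function
extensionality identifies paths between `const z` and `const z'` with maps from `K` to `z = z'`. -/
theorem localPath : Provable localPathType :=
  prove [⟨_, localOfExt⟩, ⟨_, constAp⟩, ⟨_, funExt⟩, ⟨_, funExtInj⟩, ⟨_, equivPathSurj⟩,
    ⟨_, retractPathInj⟩] (fun v =>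
  lam fun K => lam fun Z => lam fun l => lam fun z => lam fun z' =>
    let c := const K Z
    let B := fn K fun _ => Z
    v 0 [K, Id z z',
      lam fun q =>
        unpack (v 2 [K, B, c [z], c [z'], q]) fun e h =>
        unpack (v 4 [Z, arr K Z, c, fst (fst l), snd (fst l), fst (snd l), snd (snd l), z, z', e])
          fun p h' =>
        pair p (lam fun k =>
          concat (v 1 [K, Z, z, z', p, k])
            (concat (apFn (fun t => at' t k) h') (h [k]))),
      lam fun p => lam fun p' => lam fun α =>
        v 5 [Z, arr K Z, c, fst (snd l), snd (snd l), z, z', p, p',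
          v 3 [K, B, c [z], c [z'], ap c p, ap c p', lam fun k =>
            concat (inv (v 1 [K, Z, z, z', p, k]))
              (concat (α [k]) (v 1 [K, Z, z, z', p', k]))]]])
  (by decide +kernel)

end Ex
end HoTT

namespace HoTT
namespace Ex

/-! ### Cones and extensions along joins -/

/-- The type of points `z` with a homotopy from the constant map at `z` to `v : N → Z`. -/
def Cone (N Z v : Ex) : Ex := Sig Z fun z => Pi N fun n => Id z (v [n])

/-- For types `M N Z`: maps from the join of `M` and `N` to `Z` are constant,
expressed without reference to the join. -/
def JoinExt (M N Z : Ex) : Ex := Pi (arr N Z) fun v => Ext M (Cone N Z v)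

def conePairPathType : Tm := toTm <|
  Pi U fun N => Pi U fun Z => Pi (arr N Z) fun v => Pi Z fun z => Pi Z fun z' =>
  Pi (Id z z') fun p => Pi (Pi N fun n => Id z (v [n])) fun y =>
  Pi (Pi N fun n => Id z' (v [n])) fun y' =>
  arr (Pi N fun n => Id (concat p (y' [n])) (y [n]))
    (Id (asc (Cone N Z v) (pair z y)) (pair z' y'))

theorem conePairPath : Provable conePairPathType :=
  prove [⟨_, funExt⟩, ⟨_, reflConcat⟩] (fun w =>
  lam fun N => lam fun Z => lam fun v => lam fun z => lam fun _ => lam fun p =>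
  ind p (lam fun y => lam fun y' => lam fun h =>
    apFn (fun y => asc (Cone N Z v) (pair z y))
      (fst (w 0 [N, fn N fun n => Id z (v [n]), y, y', lam fun n =>
        concat (inv (h [n])) (w 1 [Z, z, v [n], y' [n]])]))))
  (by decide +kernel)

def conePathType : Tm := toTm <|
  Pi U fun N => Pi U fun Z => Pi (arr N Z) fun v => Pi (Cone N Z v) fun t =>
  Pi (Cone N Z v) fun t' => Pi (Id (fst t) (fst t')) fun p =>
  arr (Pi N fun n => Id (concat p (snd t' [n])) (snd t [n])) (Id t t')

theorem conePath : Provable conePathType := prove [⟨_, conePairPath⟩] (fun w =>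
  lam fun N => lam fun Z => lam fun v => lam fun t => cases t fun z y =>
  lam fun t' => cases t' fun z' y' => lam fun p => lam fun h =>
    w 0 [N, Z, v, z, z', p, y, y', h])
  (by decide +kernel)

/-- The path between the points of two equal cones. -/
def pathFst (τ : Ex) : Ex := apFn fst τ

def coneSndType : Tm := toTm <|
  Pi U fun N => Pi U fun Z => Pi (arr N Z) fun v => Pi (Cone N Z v) fun t =>
  Pi (Cone N Z v) fun t' => Pi (Id t t') fun τ => Pi N fun n =>
  Id (snd t [n]) (concat (pathFst τ) (snd t' [n]))

theorem coneSnd : Provable coneSndType := prove [⟨_, reflConcat⟩] (fun w =>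
  lam fun _ => lam fun Z => lam fun v => lam fun t => lam fun _ => lam fun τ =>
  ind τ (lam fun n => inv (w 0 [Z, fst t, v [n], snd t [n]])))
  (by decide +kernel)

def coneFstType : Tm := toTm <|
  Pi U fun N => Pi U fun Z => Pi (arr N Z) fun v => Pi (Cone N Z v) fun t =>
  Pi (Cone N Z v) fun t' => Pi (Id t t') fun τ => Pi N fun n =>
  Id (pathFst τ) (concat (snd t [n]) (inv (snd t' [n])))

theorem coneFst : Provable coneFstType := prove [⟨_, concatInv⟩] (fun w =>
  lam fun _ => lam fun Z => lam fun v => lam fun t => lam fun _ => lam fun τ =>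
  ind τ (lam fun n => w 0 [Z, fst t, v [n], snd t [n]]))
  (by decide +kernel)

/-- Every `K`-local type has unique extensions along the join of `M` and `N`. -/
def LocalJoinExt (K M N : Ex) : Ex := Pi U fun Z => arr (IsLocal K Z) (JoinExt M N Z)

def coneLocalType : Tm := toTm <|
  Pi U fun K => Pi U fun M => Pi U fun N => Pi (LocalJoinExt K M N) fun _ =>
  Pi U fun Z => Pi (IsLocal K Z) fun _ => Pi (arr N Z) fun v => IsLocal M (Cone N Z v)

/-- Extension of maps from `M` into the cone type is the hypothesis for `Z`. Uniqueness is the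
hypothesis for the path type of the apices, again `K`-local. -/
theorem coneLocal : Provable coneLocalType :=
  prove [⟨_, localOfExt⟩, ⟨_, localPath⟩, ⟨_, coneFst⟩, ⟨_, conePath⟩, ⟨_, moveInv⟩] (fun w =>
  lam fun K => lam fun M => lam fun N => lam fun j => lam fun Z => lam fun l => lam fun v =>
    w 0 [M, Cone N Z v, j [Z, l, v], lam fun t => lam fun t' => lam fun α =>
      let P := Id (fst t) (fst t')
      -- A path between the cones `t` and `t'` is a path of apices equal to `u n` for every `n`,
      -- that is, a cone over `u`. The paths `α m` form a map from `M` to such cones.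
      let u := fn N fun n => concat (snd t [n]) (inv (snd t' [n]))
      unpack
        (fst (j [P, w 1 [K, Z, l, fst t, fst t'], u, lam fun m =>
          pair (pathFst (α [m])) (lam fun n => w 2 [N, Z, v, t, t', α [m], n])])) fun r h =>
      w 3 [N, Z, v, t, t', r, lam fun n =>
        w 4 [Z, fst t, fst t', r, v [n], snd t' [n], snd t [n], h [n]]]])
  (by decide +kernel)

def joinExtOfConnType : Tm := toTm <|
  Pi U fun K => Pi U fun M => Pi U fun N => Pi U fun F => Pi (LocalJoinExt K M N) fun _ =>
  arr (IsConn M F) (LocalJoinExt K F N)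

theorem joinExtOfConn : Provable joinExtOfConnType :=
  prove [⟨_, localExt⟩, ⟨_, coneLocal⟩] (fun w =>
  lam fun K => lam fun M => lam fun N => lam fun F => lam fun j => lam fun c =>
  lam fun Z => lam fun l => lam fun v =>
    w 0 [F, Cone N Z v, c [Cone N Z v, w 1 [K, M, N, j, Z, l, v]]])
  (by decide +kernel)

def joinExtSwapType : Tm := toTm <|
  Pi U fun M => Pi U fun N => Pi U fun Z => arr (JoinExt M N Z) (JoinExt N M Z)

/-- The symmetry of the join: the family of paths indexed by `N` and `M` is transposed and inverted,
and `moveInv` undoes the inversion in the coherence. -/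
theorem joinExtSwap : Provable joinExtSwapType :=
  prove [⟨_, conePath⟩, ⟨_, coneSnd⟩, ⟨_, moveInv⟩] (fun x =>
  lam fun M => lam fun N => lam fun Z => lam fun j => lam fun v => lam fun w =>
    let v' := fn N fun n => fst (w [n])
    let w' := fn M fun m => asc (Cone N Z v')
      (pair (v [m]) (lam fun n => inv (snd (w [n]) [m])))
    unpack (j [v', w']) fun t ρ =>
    let s := asc (Cone M Z v) (pair (fst t) (lam fun m => pathFst (ρ [m])))
    pair s (lam fun n => x 0 [M, Z, v, s, w [n], snd t [n], lam fun m =>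
      x 2 [Z, fst t, fst (w [n]), snd t [n], v [m], snd (w [n]) [m], pathFst (ρ [m]),
        x 1 [N, Z, v', t, w' [m], ρ [m], n]]]))
  (by decide +kernel)

/-- The theorem, for a type `Q` in place of the join of `F` and `G`, and for a type `K` in place
of the join of `M` and `N`. -/
def connOfJoinExtType : Tm := toTm <|
  Pi U fun K => Pi U fun M => Pi U fun N => Pi U fun F => Pi U fun G => Pi U fun Q =>
  Pi (LocalJoinExt K M N) fun _ => Pi (IsConn M F) fun _ => Pi (IsConn N G) fun _ =>
  Pi (Pi U fun Z => arr (JoinExt F G Z) (Ext Q Z)) fun _ => IsConn K Q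

/-- Only the first argument of `JoinExt` can be replaced, so the pair `M N` passes through `F N`, `N
F`, `G F` to `F G`. The uniqueness part of locality for `Q` is the extension property for the path
types, which are `K`-local. -/
theorem connOfJoinExt : Provable connOfJoinExtType :=
  prove [⟨_, joinExtOfConn⟩, ⟨_, joinExtSwap⟩, ⟨_, localOfExt⟩, ⟨_, localPath⟩] (fun w =>
  lam fun K => lam fun M => lam fun N => lam fun F => lam fun G => lam fun Q =>
  lam fun j => lam fun c => lam fun d => lam fun q =>
    have' (LocalJoinExt K N F)
      (lam fun Z => lam fun l => w 1 [F, N, Z, w 0 [K, M, N, F, j, c, Z, l]]) fun j' =>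
    have' (Pi U fun Z => arr (IsLocal K Z) (Ext Q Z))
      (lam fun Z => lam fun l => q [Z, w 1 [G, F, Z, w 0 [K, N, F, G, j', d, Z, l]]]) fun e =>
    lam fun Z => lam fun l => w 2 [Q, Z, e [Z, l], lam fun z => lam fun z' => lam fun α =>
      fst (e [Id z z', w 3 [K, Z, l, z, z'], α])])
  (by decide +kernel)

end Ex
end HoTT

namespace HoTT
open Tm
namespace Ex

/-! ### Disjoint sums and pushouts -/

/-- A term, with its type, built from the terms of some expressions. -/
def node (F : List Tm → Tm × Tm) (args : List Ex) : Ex := ⟨fun Γ _ => do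
  .ok (F (← args.mapM fun e => (e.run Γ none).map Prod.fst))⟩

/-- Induction for disjoint sums, for a variable, with the expected type as motive. -/
def sumCases (p l r : Ex) : Ex := ⟨fun Γ T => do
  let T ← expected T
  match ← p.run Γ none with
  | (var i, sum A B) =>
    let C := T.subst fun n => cond (Nat.beq n i) (var 0) (var (n + 1))
    let (l, _) ← l.run Γ (some (pi A ((C.upUnder 1).inst (Tm.inl (A.up 1) (B.up 1) (var 0)))))
    let (r, _) ← r.run Γ (some (pi B ((C.upUnder 1).inst (Tm.inr (A.up 1) (B.up 1) (var 0)))))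
    .ok (sumInd A B C l r (var i), T)
  | (p, P) => .error (9, [p, P])⟩

/-- Induction for graph quotients, for a variable, with the expected type as motive. -/
def gqCases (q c d : Ex) : Ex := ⟨fun Γ T => do
  let T ← expected T
  match ← q.run Γ none with
  | (var i, gq V E) =>
    let C := T.subst fun n => cond (Nat.beq n i) (var 0) (var (n + 1))
    let (c, _) ← c.run Γ (some (pi V ((C.upUnder 1).inst (pt (V.up 1) (E.up 1) (var 0)))))
    let (d, _) ← d.run Γ (some (gqEdgeData V E C c))
    .ok (gqInd V E C c d (var i), T)
  | (q, Q) => .error (10, [q, Q])⟩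

/-- A span of types, from which a pushout is built. -/
structure Span where
  /-- The type at the left. -/
  left : Ex
  /-- The type at the right. -/
  right : Ex
  /-- The type in the middle. -/
  apex : Ex
  /-- The map to the left. -/
  toLeft : Ex
  /-- The map to the right. -/
  toRight : Ex

def Span.args (S : Span) : List Ex := [S.left, S.right, S.apex, S.toLeft, S.toRight]

/-- The edges of the graph whose quotient is the pushout. -/
def Span.edges (S : Span) : Ex := node (fun
  | [A, B, C, f, g] =>
    (pushoutRel A B C f g, arrow (sum A B) (arrow (sum A B) univ))
  | _ => (star, star)) S.args

def Span.inl (S : Span) (a : Ex) : Ex := node (fun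
  | [A, B, a] => (Tm.inl A B a, sum A B)
  | _ => (star, star)) [S.left, S.right, a]

def Span.inr (S : Span) (b : Ex) : Ex := node (fun
  | [A, B, b] => (Tm.inr A B b, sum A B)
  | _ => (star, star)) [S.left, S.right, b]

/-- The edge over a point of the apex. -/
def Span.edge (S : Span) (c : Ex) : Ex := node (fun
  | [c, A, B, C, f, g] =>
    let V := sum A B
    let v := Tm.inl A B (.app f c)
    let w := Tm.inr A B (.app g c)
    (Tm.pair C (pushoutEqs A B f g v w) c
      (Tm.pair (.Id V v v) (Tm.Id (V.up 1) (w.up 1) (w.up 1)) (.refl V v) (.refl V w)),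
      pushoutEdges A B C f g v w)
  | _ => (star, star)) (c :: S.args)

/-- The type of points of a graph quotient. -/
def Gq (V E : Ex) : Ex := type₂ Tm.gq V E

def point (V E i : Ex) : Ex := node (fun
  | [V, E, i] => (pt V E i, gq V E)
  | _ => (star, star)) [V, E, i]

/-- The path in a graph quotient over an edge. -/
def edgePath (V E i j e : Ex) : Ex := node (fun
  | [V, E, i, j, e] => (edge V E i j e, .Id (gq V E) (pt V E i) (pt V E j))
  | _ => (star, star)) [V, E, i, j, e]

def Span.verts (S : Span) : Ex := type₂ Tm.sum S.left S.right

def Pushout (S : Span) : Ex := Gq S.verts S.edges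

def inLeft (S : Span) (a : Ex) : Ex := point S.verts S.edges (S.inl a)

def inRight (S : Span) (b : Ex) : Ex := point S.verts S.edges (S.inr b)

/-- The path in a pushout over a point of the apex. -/
def glue (S : Span) (c : Ex) : Ex :=
  edgePath S.verts S.edges (S.inl (S.toLeft [c])) (S.inr (S.toRight [c])) (S.edge c)

/-- The map `h`, `k` from a disjoint sum to `T`. -/
def sumMap (A B T h k : Ex) : Ex := node (fun
  | [A, B, T, h, k] => (sumRec A B T h k, arrow (sum A B) T)
  | _ => (star, star)) [A, B, T, h, k]

/-- The map `h`, `k` from a pushout to `T`, for a homotopy `H`. -/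
def glueRec (S : Span) (T h k H : Ex) : Ex := node (fun
  | [T, h, k, H, A, B, C, f, g] =>
    (pushoutRec A B C f g T h k H, arrow (pushout A B C f g) T)
  | _ => (star, star)) (T :: h :: k :: H :: S.args)

/-- The action of a dependent function on a path, for a constant family. -/
def apdConst (T f p : Ex) : Ex := ⟨fun Γ _ => do
  let (T, _) ← T.run Γ none
  let (f, _) ← f.run Γ none
  let (p, P) ← p.run Γ none
  let (A, a, b) ← asId P
  .ok (Tm.apd A (T.up 1) f a b p,
    .Id T (Tm.tr A (T.up 1) a b p (.app f a)) (.app f b))⟩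

/-- The path from a transport in a constant family to the transported element. -/
def constTr (T p u : Ex) : Ex := ⟨fun Γ _ => do
  let (T, _) ← T.run Γ none
  let (u, _) ← u.run Γ none
  let (p, P) ← p.run Γ none
  let (A, a, b) ← asId P
  .ok (Tm.trConst A T a b p u, .Id T (Tm.tr A (T.up 1) a b p u) u)⟩

/-- The data over edges for the map from a graph quotient to `T` given by `m` and `d`. -/
def gqRecData (V E T m d : Ex) : Ex :=
  fn V fun i => fn V fun j => fn (E [i, j]) fun e =>
    concat (constTr T (edgePath V E i j e) (m [i])) (d [i, j, e])

/-- A map from a graph quotient to `T`. -/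
def gqRec (V E T m D : Ex) : Ex := node (fun
  | [V, E, T, m, D] => (gqSec V E (T.up 1) m D, arrow (gq V E) T)
  | _ => (star, star)) [V, E, T, m, D]

/-- The computation rule of `gqRec` on edges, for the dependent action on paths. -/
def gqRecEdge (V E T m D i j e : Ex) : Ex := node (fun
  | [V, E, T, m, D, i, j, e] =>
    let p := edge V E i j e
    (gqIndEdge V E (T.up 1) m D i j e,
      .Id (.Id T (Tm.tr (gq V E) (T.up 1) (pt V E i) (pt V E j) p (.app m i)) (.app m j))
        (Tm.apd (gq V E) (T.up 1) (gqSec V E (T.up 1) m D) (pt V E i) (pt V E j) p)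
        (.app (.app (.app D i) j) e))
  | _ => (star, star)) [V, E, T, m, D, i, j, e]

def pushoutIndType : Tm := toTm <|
  Pi U fun A => Pi U fun B => Pi U fun C => Pi (arr C A) fun f => Pi (arr C B) fun g =>
  let S : Span := ⟨A, B, C, f, g⟩
  Pi (arr (Pushout S) U) fun D => Pi (Pi A fun a => D [inLeft S a]) fun d₁ =>
  Pi (Pi B fun b => D [inRight S b]) fun d₂ =>
  Pi (Pi C fun c => Id (tr (fun y => D [y]) (glue S c) (d₁ [f [c]])) (d₂ [g [c]])) fun _ =>
  Pi (Pushout S) fun y => D [y]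

theorem pushoutInd : Provable pushoutIndType := prove [] (fun _ =>
  lam fun _ => lam fun _ => lam fun _ => lam fun _ => lam fun _ => lam fun _ =>
  lam fun d₁ => lam fun d₂ => lam fun d => lam fun y =>
    gqCases y (lam fun v => sumCases v d₁ d₂)
      -- An edge has free end vertices, tied to `c` by the paths `p` and `q`; induction on these
      -- leaves the standard edge over `c`.
      (lam fun _ => lam fun _ => lam fun e => cases e fun c s => cases s fun p q =>
        ind p (ind q (d [c]))))
  (by decide +kernel)

def apdConstConcatType : Tm := toTm <|
  Pi U fun A => Pi U fun T => Pi (arr A T) fun f => Pi A fun a => Pi A fun b =>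
  Pi (Id a b) fun p => Id (apdConst T f p) (concat (constTr T p (f [a])) (ap f p))

theorem apdConstConcat : Provable apdConstConcatType := prove [] (fun _ =>
  lam fun _ => lam fun _ => lam fun f => lam fun a => lam fun _ => lam fun p =>
    ind p (rfl (rfl (f [a]))))
  (by decide +kernel)

def concatCancelType : Tm := toTm <|
  Pi U fun A => Pi A fun x => Pi A fun y => Pi (Id x y) fun r => Pi A fun z =>
  Pi (Id y z) fun p => Pi (Id y z) fun q => arr (Id (concat r p) (concat r q)) (Id p q)

theorem concatCancel : Provable concatCancelType := prove [⟨_, reflConcat⟩] (fun v =>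
  lam fun _ => lam fun _ => lam fun _ => lam fun r => ind r (lam fun _ => lam fun p =>
  lam fun q => lam fun h =>
    concat (concat (inv (v 0 [imp, imp, imp, p])) h) (v 0 [imp, imp, imp, q])))
  (by decide +kernel)

def gqRecPathType : Tm := toTm <|
  Pi U fun V => Pi (arr V (arr V U)) fun E => Pi U fun T => Pi (arr V T) fun m =>
  Pi (Pi V fun i => Pi V fun j => arr (E [i, j]) (Id (m [i]) (m [j]))) fun d =>
  Pi V fun i => Pi V fun j => Pi (E [i, j]) fun e =>
  Id (d [i, j, e]) (ap (gqRec V E T m (gqRecData V E T m d)) (edgePath V E i j e))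

/-- The rule `gqIndEdge` computes `apd`, which for a constant family is `constTr` followed by `ap`.
The edge data also start with `constTr`, and cancelling it leaves `d`. -/
theorem gqRecPath : Provable gqRecPathType :=
  prove [⟨_, apdConstConcat⟩, ⟨_, concatCancel⟩] (fun v =>
  lam fun V => lam fun E => lam fun T => lam fun m => lam fun d =>
  lam fun i => lam fun j => lam fun e =>
    let D := gqRecData V E T m d
    let φ := gqRec V E T m D
    let p := edgePath V E i j e
    let x := m [i]
    v 1 [T, tr (fun _ => T) p x, x, constTr T p x, m [j], d [i, j, e], ap φ p,
      concat (inv (gqRecEdge V E T m D i j e))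
        (v 0 [Gq V E, T, φ, point V E i, point V E j, p])])
  (by decide +kernel)

/-- To show a property of `gqRec` it suffices to show it for maps with the same
propositional computation rules. -/
def gqMapType : Tm := toTm <|
  Pi U fun V => Pi (arr V (arr V U)) fun E => Pi U fun T => Pi (arr V T) fun m =>
  Pi (Pi V fun i => Pi V fun j => arr (E [i, j]) (Id (m [i]) (m [j]))) fun d =>
  Pi (arr (arr (Gq V E) T) U) fun P =>
  arr (Pi (arr (Gq V E) T) fun φ => Pi (Pi V fun i => Id (φ [point V E i]) (m [i])) fun α =>
    arr (Pi V fun i => Pi V fun j => Pi (E [i, j]) fun e =>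
      Id (concat (α [i]) (d [i, j, e])) (concat (ap φ (edgePath V E i j e)) (α [j])))
      (P [φ]))
    (P [gqRec V E T m (gqRecData V E T m d)])

/-- The recursor computes on points, so `α` is constant. Passing to a variable `φ` keeps the large
term of the recursor out of later arguments. -/
theorem gqMap : Provable gqMapType := prove [⟨_, gqRecPath⟩, ⟨_, reflConcat⟩] (fun v =>
  lam fun V => lam fun E => lam fun T => lam fun m => lam fun d => lam fun _ => lam fun q =>
    q [gqRec V E T m (gqRecData V E T m d), lam fun i => rfl (m [i]),
      lam fun i => lam fun j => lam fun e =>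
        concat (v 1 [T, m [i], m [j], d [i, j, e]]) (v 0 [V, E, T, m, d, i, j, e])])
  (by decide +kernel)

/-- To show a property of `glueRec` it suffices to show it for maps with the same
propositional computation rules. -/
def glueMapType : Tm := toTm <|
  Pi U fun A => Pi U fun B => Pi U fun C => Pi (arr C A) fun f => Pi (arr C B) fun g =>
  let S : Span := ⟨A, B, C, f, g⟩
  Pi U fun T => Pi (arr A T) fun h => Pi (arr B T) fun k =>
  Pi (Pi C fun c => Id (h [f [c]]) (k [g [c]])) fun H =>
  Pi (arr (arr (Pushout S) T) U) fun P =>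
  arr (Pi (arr (Pushout S) T) fun φ =>
    Pi (Pi A fun a => Id (φ [inLeft S a]) (h [a])) fun α =>
    Pi (Pi B fun b => Id (φ [inRight S b]) (k [b])) fun β =>
    arr (Pi C fun c => Id (concat (α [f [c]]) (H [c])) (concat (ap φ (glue S c)) (β [g [c]])))
      (P [φ]))
    (P [glueRec S T h k H])

theorem glueMap : Provable glueMapType :=
  prove [⟨_, gqMap⟩, ⟨_, reflConcat⟩] (fun v =>
  lam fun A => lam fun B => lam fun C => lam fun f => lam fun g => lam fun T =>
  lam fun h => lam fun k => lam fun H => lam fun P => lam fun q =>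
    let S : Span := ⟨A, B, C, f, g⟩
    let V := S.verts
    let E := S.edges
    let m := sumMap A B T h k
    v 0 [V, E, T, m,
      lam fun i => lam fun j => lam fun e =>
        -- This is `pushoutRecPath` without its initial `trConst`, so that `gqRec` for these data is
        -- convertible to `glueRec`.
        concat (inv (ap m (fst (snd e)))) (concat (H [fst e]) (ap m (snd (snd e)))),
      P, lam fun φ => lam fun α => lam fun γ =>
        q [φ, lam fun a => α [S.inl a], lam fun b => α [S.inr b], lam fun c =>
          -- On the standard edge both paths to `c` are constant, and the edge datum computes to
          -- `concat refl (H c)`.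
          concat
            (apFn (fun t => concat (α [S.inl (f [c])]) t)
              (inv (v 1 [T, h [f [c]], k [g [c]], H [c]])))
            (γ [S.inl (f [c]), S.inr (g [c]), S.edge c])]])
  (by decide +kernel)

/-- Maps from a pushout can be constructed. -/
def glueMapElimType : Tm := toTm <|
  Pi U fun A => Pi U fun B => Pi U fun C => Pi (arr C A) fun f => Pi (arr C B) fun g =>
  let S : Span := ⟨A, B, C, f, g⟩
  Pi U fun T => Pi (arr A T) fun h => Pi (arr B T) fun k =>
  Pi (Pi C fun c => Id (h [f [c]]) (k [g [c]])) fun H => Pi U fun Q =>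
  arr (Pi (arr (Pushout S) T) fun φ =>
    Pi (Pi A fun a => Id (φ [inLeft S a]) (h [a])) fun α =>
    Pi (Pi B fun b => Id (φ [inRight S b]) (k [b])) fun β =>
    arr (Pi C fun c => Id (concat (α [f [c]]) (H [c])) (concat (ap φ (glue S c)) (β [g [c]])))
      Q)
    Q

theorem glueMapElim : Provable glueMapElimType := prove [⟨_, glueMap⟩] (fun v =>
  lam fun A => lam fun B => lam fun C => lam fun f => lam fun g => lam fun T =>
  lam fun h => lam fun k => lam fun H => lam fun Q =>
    v 0 [A, B, C, f, g, T, h, k, H, fn (arr (Pushout ⟨A, B, C, f, g⟩) T) fun _ => Q])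
  (by decide +kernel)

/-! ### The join of types -/

def concatApType : Tm := toTm <|
  Pi U fun A => Pi U fun Z => Pi (arr A Z) fun φ => Pi Z fun z =>
  Pi (Pi A fun a => Id z (φ [a])) fun σ => Pi A fun a => Pi A fun b => Pi (Id a b) fun p =>
  Id (concat (σ [a]) (ap φ p)) (σ [b])

theorem concatAp : Provable concatApType := prove [] (fun _ =>
  lam fun _ => lam fun _ => lam fun _ => lam fun _ => lam fun σ => lam fun a => lam fun _ =>
  lam fun p => ind p (rfl (σ [a])))
  (by decide +kernel)

def assocType : Tm := toTm <|
  Pi U fun A => Pi A fun x => Pi A fun y => Pi (Id x y) fun p => Pi A fun z =>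
  Pi (Id y z) fun q => Pi A fun w => Pi (Id z w) fun r =>
  Id (concat (concat p q) r) (concat p (concat q r))

theorem assoc : Provable assocType := prove [] (fun _ =>
  lam fun _ => lam fun _ => lam fun _ => lam fun p => lam fun _ => lam fun q =>
  lam fun _ => lam fun r => ind r (rfl (concat p q)))
  (by decide +kernel)

/-- Paste a commuting triangle and a commuting square of paths. -/
def pasteType : Tm := toTm <|
  Pi U fun Z => Pi Z fun z => Pi Z fun x => Pi (Id z x) fun s => Pi Z fun y => Pi (Id x y) fun a =>
  Pi Z fun w => Pi (Id y w) fun h => Pi Z fun x' => Pi (Id x x') fun g => Pi (Id x' w) fun b =>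
  Pi (Id z x') fun s' => Pi (Id (concat a h) (concat g b)) fun _ => Pi (Id (concat s g) s') fun _ =>
  Id (concat (concat s a) h) (concat s' b)

/-- `(s ∙ a) ∙ h = s ∙ (a ∙ h) = s ∙ (g ∙ b) = (s ∙ g) ∙ b`, where `s ∙ g` is `s'`. -/
theorem paste : Provable pasteType := prove [⟨_, assoc⟩] (fun v =>
  lam fun Z => lam fun z => lam fun x => lam fun s => lam fun y => lam fun a =>
  lam fun w => lam fun h => lam fun x' => lam fun g => lam fun b => lam fun _ =>
  lam fun e => lam fun e' => ind e'
    (concat (v 0 [Z, z, x, s, y, a, w, h])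
      (concat (apFn (fun t => concat s t) e) (inv (v 0 [Z, z, x, s, x', g, w, b])))))
  (by decide +kernel)

/-- The span whose pushout is the join of types. -/
def prodSpan (M N : Ex) : Span :=
  let C := Sig M fun _ => N
  ⟨M, N, C, fn C fst, fn C snd⟩

def Join (M N : Ex) : Ex := type₂ Tm.join M N

/-- A cone over a map to `Z` from a type `K` with maps from `M` and `N` and paths between them. -/
def coneOfMapType : Tm := toTm <|
  Pi U fun M => Pi U fun N => Pi U fun Z => Pi (arr N Z) fun v => Pi (arr M (Cone N Z v)) fun w =>
  Pi U fun K => Pi (arr M K) fun i => Pi (arr N K) fun j =>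
  Pi (Pi M fun m => Pi N fun n => Id (i [m]) (j [n])) fun g =>
  Pi (arr K Z) fun φ => Pi Z fun z => Pi (Pi K fun c => Id z (φ [c])) fun _ =>
  Pi (Pi M fun m => Id (φ [i [m]]) (fst (w [m]))) fun α =>
  Pi (Pi N fun n => Id (φ [j [n]]) (v [n])) fun β =>
  Pi (Pi M fun m => Pi N fun n =>
    Id (concat (α [m]) (snd (w [m]) [n])) (concat (ap φ (g [m, n])) (β [n]))) fun _ =>
  Sig (Cone N Z v) fun t => Pi M fun m => Id t (w [m])

/-- The contraction `σ` of `φ` to `z`, composed with `β`, is a cone over `v`; composed with `α`, it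
links `z` to the apices of `w`. Naturality of `σ` along `g m n` is the triangle to be pasted to the
given square. -/
theorem coneOfMap : Provable coneOfMapType :=
  prove [⟨_, conePath⟩, ⟨_, concatAp⟩, ⟨_, paste⟩] (fun x =>
  lam fun M => lam fun N => lam fun Z => lam fun v => lam fun w => lam fun K => lam fun i =>
  lam fun j => lam fun g => lam fun φ => lam fun z => lam fun σ =>
  lam fun α => lam fun β => lam fun γ =>
    let t := asc (Cone N Z v) (pair z (lam fun n => concat (σ [j [n]]) (β [n])))
    pair t (lam fun m => x 0 [N, Z, v, t, w [m], concat (σ [i [m]]) (α [m]), lam fun n =>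
      x 2 [Z, z, φ [i [m]], σ [i [m]], fst (w [m]), α [m], v [n], snd (w [m]) [n],
        φ [j [n]], ap φ (g [m, n]), β [n], σ [j [n]], γ [m, n],
        x 1 [K, Z, φ, z, σ, i [m], j [n], g [m, n]]]]))
  (by decide +kernel)

def localJoinExtType : Tm := toTm <|
  Pi U fun M => Pi U fun N => LocalJoinExt (Join M N) M N

/-- The pair of `v` and `w` is exactly the datum of a map from the join to `Z`, and locality makes
that map constant. -/
theorem localJoinExt : Provable localJoinExtType :=
  prove [⟨_, localExt⟩, ⟨_, coneOfMap⟩, ⟨_, glueMapElim⟩] (fun x =>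
  lam fun M => lam fun N => lam fun Z => lam fun l => lam fun v => lam fun w =>
    let S := prodSpan M N
    let K := Join M N
    let c := fun m n => asc S.apex (pair m n)
    x 2 [M, N, S.apex, S.toLeft, S.toRight, Z, fn M fun m => fst (w [m]), v,
      fn S.apex fun c => snd (w [fst c]) [snd c],
      Sig (Cone N Z v) fun t => Pi M fun m => Id t (w [m]),
      lam fun φ => lam fun α => lam fun β => lam fun γ =>
        have' (Sig Z fun z => Pi K fun c => Id z (φ [c])) (x 0 [K, Z, l, φ]) fun e =>
        x 1 [M, N, Z, v, w, K, fn M (inLeft S), fn N (inRight S),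
          lam fun m => lam fun n => glue S (c m n), φ, fst e, snd e, α, β,
          lam fun m => lam fun n => γ [c m n]]])
  (by decide +kernel)

end Ex
end HoTT

namespace HoTT
namespace Ex

/-! ### The fibers of a map from a pushout -/

/-- The fiber of `m : K → X` at `x`. -/
def Fib (K m x : Ex) : Ex := Sig K fun k => Id (m [k]) x

/-- A lift `mk` of a path in `K` to the fibers of `m`, together with a description of transport
in a family of paths that depends on a point of the fiber. -/
def fibPathType : Tm := toTm <|
  Pi U fun K => Pi U fun X => Pi (arr K X) fun m => Pi X fun x => Pi K fun k => Pi K fun k' =>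
  Pi (Id k k') fun p =>
  let pt := fun (k r : Ex) => asc (Fib K m x) (pair k r)
  Sig (Pi (Id (m [k']) x) fun s => Id (pt k (concat (ap m p) s)) (pt k' s)) fun mk =>
  Pi U fun Z => Pi (arr (Fib K m x) Z) fun ψ => Pi Z fun z =>
  let D := fun (k : Ex) => Pi (Id (m [k]) x) fun r => Id z (ψ [pt k r])
  Pi (D k) fun d => Pi (D k') fun d' =>
  arr (Pi (Id (m [k']) x) fun s => Id (concat (d [concat (ap m p) s]) (ap ψ (mk [s]))) (d' [s]))
    (Id (tr D p d) d')

def fibNaturalType : Tm := toTm <|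
  Pi U fun K => Pi U fun X => Pi (arr K X) fun m => Pi X fun x => Pi U fun Z =>
  Pi (arr (Fib K m x) Z) fun ψ => Pi Z fun z => Pi K fun k =>
  let pt := fun (r : Ex) => asc (Fib K m x) (pair k r)
  Pi (Pi (Id (m [k]) x) fun r => Id z (ψ [pt r])) fun d =>
  Pi (Id (m [k]) x) fun r => Pi (Id (m [k]) x) fun r' => Pi (Id r r') fun q =>
  Id (concat (d [r]) (ap ψ (apFn pt q))) (d [r'])

theorem fibNatural : Provable fibNaturalType := prove [] (fun _ =>
  lam fun _ => lam fun _ => lam fun _ => lam fun _ => lam fun _ => lam fun _ => lam fun _ =>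
  lam fun _ => lam fun d => lam fun r => lam fun _ => lam fun q => ind q (rfl (d [r])))
  (by decide +kernel)

theorem fibPath : Provable fibPathType :=
  prove [⟨_, fibNatural⟩, ⟨_, reflConcat⟩, ⟨_, funExt⟩] (fun v =>
  lam fun K => lam fun X => lam fun m => lam fun x => lam fun k => lam fun k' => lam fun p =>
    let pt := fun (r : Ex) => asc (Fib K m x) (pair k r)
    let R := Id (m [k]) x
    let q := fun (s : Ex) => v 1 [X, m [k], x, s]
    -- For constant `p` the lift must still pass from `refl ∙ s` to `s`, hence `reflConcat`;
    -- transport then computes away and function extensionality applies.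
    ind p (pair (lam fun s => apFn pt (q s))
      (lam fun Z => lam fun ψ => lam fun z => lam fun d => lam fun d' => lam fun h =>
      fst (v 2 [R, fn R fun r => Id z (ψ [pt r]), d, d', lam fun s =>
        concat (inv (v 0 [K, X, m, x, Z, ψ, z, k, d, concat (rfl (m [k])) s, s, q s]))
          (h [s])]))))
  (by decide +kernel)

/-- A family of paths over all paths `x₀ = x`, from one over all paths `x₀ = y₀`. -/
def extendPathsType : Tm := toTm <|
  Pi U fun X => Pi X fun x₀ => Pi X fun y₀ => Pi X fun x => Pi (Id y₀ x) fun s =>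
  Pi U fun Y => Pi (arr (Id x₀ x) Y) fun f => Pi Y fun y =>
  Pi (Pi (Id x₀ y₀) fun e => Id (f [concat e s]) y) fun l =>
  Sig (Pi (Id x₀ x) fun r => Id (f [r]) y) fun k => Pi (Id x₀ y₀) fun e =>
  Id (k [concat e s]) (l [e])

/-- Composition with `s` is an equivalence; for constant `s` it computes to the identity, so `l`
itself is the extension. -/
theorem extendPaths : Provable extendPathsType := prove [] (fun _ =>
  lam fun _ => lam fun _ => lam fun _ => lam fun _ => lam fun s => ind s
    (lam fun _ => lam fun _ => lam fun _ => lam fun l => pair l (lam fun e => rfl (l [e]))))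
  (by decide +kernel)

def joinExtElimType : Tm := toTm <|
  Pi U fun F => Pi U fun G => Pi U fun Z => Pi (JoinExt F G Z) fun _ => Pi (arr F Z) fun h =>
  Pi (arr G Z) fun k => Pi (Pi F fun t => Pi G fun u => Id (h [t]) (k [u])) fun l => Pi U fun Q =>
  arr (Pi Z fun z => Pi (Pi F fun t => Id z (h [t])) fun d => Pi (Pi G fun u => Id z (k [u])) fun d' =>
    arr (Pi F fun t => Pi G fun u => Id (concat (d [t]) (l [t, u])) (d' [u])) Q) Q

/-- `JoinExt` unfolded into symmetric data: a point with homotopies to `h` and `k` that are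
compatible with `l`. The arbitrary conclusion `Q` stands in for a nested sum type. -/
theorem joinExtElim : Provable joinExtElimType := prove [⟨_, coneSnd⟩] (fun v =>
  lam fun F => lam fun G => lam fun Z => lam fun j => lam fun h => lam fun k => lam fun l =>
  lam fun _ => lam fun κ =>
    let w := fn F fun t => asc (Cone G Z k) (pair (h [t]) (lam fun u => l [t, u]))
    unpack (j [k, w]) fun s τ =>
    κ [fst s, lam fun t => pathFst (τ [t]), snd s,
      lam fun t => lam fun u => inv (v 0 [G, Z, k, s, w [t], τ [t], u])])
  (by decide +kernel)

/-- Induction for a type `K` with maps `i` and `j` to it and paths `l` between their values. -/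
def PushoutInd (S : Span) (K i j l : Ex) : Ex :=
  Pi (arr K U) fun D => Pi (Pi S.left fun a => D [i [a]]) fun d =>
  Pi (Pi S.right fun b => D [j [b]]) fun d' =>
  arr (Pi S.apex fun c =>
      Id (tr (fun y => D [y]) (l [c]) (d [S.toLeft [c]])) (d' [S.toRight [c]]))
    (Pi K fun y => D [y])

/-- Induction for the apex of a span, as pullback of `f` and `g`, with a path `H` between the
composites. -/
def PullbackInd (S : Span) (f g H : Ex) : Ex :=
  Pi (Pi S.left fun a => Pi S.right fun b => arr (Id (f [a]) (g [b])) U) fun Y =>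
  let Y' := fun (c : Ex) => Y [S.toLeft [c], S.toRight [c], H [c]]
  Pi (Pi S.apex fun c => Y' c) fun y =>
  Sig (Pi S.left fun a => Pi S.right fun b => Pi (Id (f [a]) (g [b])) fun e => Y [a, b, e])
    fun h => Pi S.apex fun c => Id (h [S.toLeft [c], S.toRight [c], H [c]]) (y [c])

/-- A family of paths from `z` to the values of `ψ` on pairs `pt y r`, for `y : K`. -/
def pathsOverIndType : Tm := toTm <|
  Pi U fun A => Pi U fun B => Pi U fun C => Pi (arr C A) fun p => Pi (arr C B) fun q =>
  let S : Span := ⟨A, B, C, p, q⟩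
  Pi U fun K => Pi (arr A K) fun i => Pi (arr B K) fun j =>
  Pi (Pi C fun c => Id (i [p [c]]) (j [q [c]])) fun l => Pi (PushoutInd S K i j l) fun _ =>
  Pi (arr K U) fun R => Pi U fun W => Pi (Pi K fun y => arr (R [y]) W) fun pt =>
  Pi (Pi C fun c => arr (R [j [q [c]]]) (R [i [p [c]]])) fun ε =>
  Pi (Pi C fun c => Pi (R [j [q [c]]]) fun s =>
    Id (pt [i [p [c]], ε [c, s]]) (pt [j [q [c]], s])) fun mk =>
  Pi (Pi A fun a => Pi (R [i [a]]) fun r => Pi B fun b => Pi (R [j [b]]) fun s =>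
    Id (pt [i [a], r]) (pt [j [b], s])) fun k =>
  Pi (Pi C fun c => Pi (R [j [q [c]]]) fun s =>
    Id (k [p [c], ε [c, s], q [c], s]) (mk [c, s])) fun _ =>
  Pi U fun Z => Pi (arr W Z) fun ψ => Pi Z fun z =>
  let D := fun (y : Ex) => Pi (R [y]) fun r => Id z (ψ [pt [y, r]])
  Pi (Pi C fun c => Pi (D (i [p [c]])) fun d => Pi (D (j [q [c]])) fun d' =>
    arr (Pi (R [j [q [c]]]) fun s =>
        Id (concat (d [ε [c, s]]) (ap ψ (mk [c, s]))) (d' [s]))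
      (Id (tr D (l [c]) d) d')) fun _ =>
  Pi (Pi A fun a => D (i [a])) fun d => Pi (Pi B fun b => D (j [b])) fun d' =>
  Pi (Pi A fun a => Pi (R [i [a]]) fun r => Pi B fun b => Pi (R [j [b]]) fun s =>
    Id (concat (d [a, r]) (ap ψ (k [a, r, b, s]))) (d' [b, s])) fun _ =>
  Pi K fun y => D y

/-- Pushout induction for the family `D`. Over the glue path of `c`, the transport reduces to
compatibility with `mk`, which is the assumed compatibility with `k` at the parameters coming from
`c`. Here `R y` plays the role of `m y = x`. -/
theorem pathsOverInd : Provable pathsOverIndType := prove [] (fun _ =>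
  lam fun _ => lam fun _ => lam fun _ => lam fun p => lam fun q => lam fun K => lam fun i =>
  lam fun j => lam fun _ => lam fun ind => lam fun R => lam fun _ => lam fun pt =>
  lam fun ε => lam fun _ => lam fun _ => lam fun h => lam fun _ => lam fun ψ => lam fun z =>
  lam fun t => lam fun d => lam fun d' => lam fun n =>
    ind [fn K fun y => Pi (R [y]) fun r => Id z (ψ [pt [y, r]]), d, d', lam fun c =>
      t [c, d [p [c]], d' [q [c]], lam fun s =>
        concat (inv (apFn (fun o => concat (d [p [c], ε [c, s]]) (ap ψ o)) (h [c, s])))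
          (n [p [c], ε [c, s], q [c], s])]])
  (by decide +kernel)

/-- Extension of a map `ψ`, from the values of `ψ` on pairs `pt y r` with `y` in the image of
`i` or `j`. -/
def extOfPathsType : Tm := toTm <|
  Pi U fun A => Pi U fun B => Pi U fun C => Pi (arr C A) fun p => Pi (arr C B) fun q =>
  let S : Span := ⟨A, B, C, p, q⟩
  Pi U fun K => Pi (arr A K) fun i => Pi (arr B K) fun j =>
  Pi (Pi C fun c => Id (i [p [c]]) (j [q [c]])) fun l => Pi (PushoutInd S K i j l) fun _ =>
  Pi (arr K U) fun R => Pi U fun W => Pi (Pi K fun y => arr (R [y]) W) fun pt =>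
  Pi (Pi C fun c => arr (R [j [q [c]]]) (R [i [p [c]]])) fun ε =>
  Pi (Pi C fun c => Pi (R [j [q [c]]]) fun s =>
    Id (pt [i [p [c]], ε [c, s]]) (pt [j [q [c]], s])) fun mk =>
  Pi (Pi A fun a => Pi (R [i [a]]) fun r => Pi B fun b => Pi (R [j [b]]) fun s =>
    Id (pt [i [a], r]) (pt [j [b], s])) fun k =>
  Pi (Pi C fun c => Pi (R [j [q [c]]]) fun s =>
    Id (k [p [c], ε [c, s], q [c], s]) (mk [c, s])) fun _ =>
  Pi U fun Z => Pi (arr W Z) fun ψ =>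
  Pi (Pi Z fun z =>
    let D := fun (y : Ex) => Pi (R [y]) fun r => Id z (ψ [pt [y, r]])
    Pi C fun c => Pi (D (i [p [c]])) fun d => Pi (D (j [q [c]])) fun d' =>
    arr (Pi (R [j [q [c]]]) fun s =>
        Id (concat (d [ε [c, s]]) (ap ψ (mk [c, s]))) (d' [s]))
      (Id (tr D (l [c]) d) d')) fun _ =>
  Pi (JoinExt (Sig A fun a => R [i [a]]) (Sig B fun b => R [j [b]]) Z) fun _ =>
  Sig Z fun z => Pi K fun y => Pi (R [y]) fun r => Id z (ψ [pt [y, r]])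

theorem extOfPaths : Provable extOfPathsType :=
  prove [⟨_, joinExtElim⟩, ⟨_, pathsOverInd⟩] (fun v =>
  lam fun A => lam fun B => lam fun C => lam fun p => lam fun q => lam fun K => lam fun i =>
  lam fun j => lam fun l => lam fun ind => lam fun R => lam fun W => lam fun pt =>
  lam fun ε => lam fun mk => lam fun k => lam fun h => lam fun Z => lam fun ψ =>
  lam fun t => lam fun n =>
    let F := Sig A fun a => R [i [a]]
    let G := Sig B fun b => R [j [b]]
    v 0 [F, G, Z, n, fn F fun t => ψ [pt [i [fst t], snd t]],
      fn G fun u => ψ [pt [j [fst u], snd u]],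
      lam fun t => lam fun u => ap ψ (k [fst t, snd t, fst u, snd u]),
      Sig Z fun z => Pi K fun y => Pi (R [y]) fun r => Id z (ψ [pt [y, r]]),
      -- The homotopies over `F` and `G` become the two point cases of the induction, and their
      -- compatibility `c` becomes the edge case.
      lam fun z => lam fun d => lam fun d' => lam fun c =>
        pair z
          (v 1 [A, B, C, p, q, K, i, j, l, ind, R, W, pt, ε, mk, k, h, Z, ψ, z, t [z],
            lam fun a => lam fun r => d [asc F (pair a r)],
            lam fun b => lam fun s => d' [asc G (pair b s)],
            lam fun a => lam fun r => lam fun b => lam fun s =>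
              c [asc F (pair a r), asc G (pair b s)]])])
  (by decide +kernel)

/-- Paths between points of fibers, from such paths over points of a pullback. -/
def fibPathsType : Tm := toTm <|
  Pi U fun A => Pi U fun B => Pi U fun C => Pi (arr C A) fun p => Pi (arr C B) fun q =>
  let S : Span := ⟨A, B, C, p, q⟩
  Pi U fun X => Pi (arr A X) fun f => Pi (arr B X) fun g =>
  Pi (Pi C fun c => Id (f [p [c]]) (g [q [c]])) fun H =>
  Pi (PullbackInd S f g H) fun _ => Pi X fun x => Pi U fun W =>
  Pi (Pi A fun a => arr (Id (f [a]) x) W) fun h => Pi (Pi B fun b => arr (Id (g [b]) x) W) fun k =>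
  Pi (Pi C fun c => Pi (Id (g [q [c]]) x) fun s =>
    Id (h [p [c], concat (H [c]) s]) (k [q [c], s])) fun l =>
  Pi U fun Q => arr
    (Pi (Pi A fun a => Pi (Id (f [a]) x) fun r => Pi B fun b => Pi (Id (g [b]) x) fun s =>
      Id (h [a, r]) (k [b, s])) fun n =>
      arr (Pi C fun c => Pi (Id (g [q [c]]) x) fun s =>
        Id (n [p [c], concat (H [c]) s, q [c], s]) (l [c, s])) Q)
    Q

/-- The paths `l` cover only triples `e ∙ s`, `s` over points of the pullback. Pullback induction
frees `a`, `b`, `e`, and `extendPaths` reaches every `r`, since each one has the form `e ∙ s`. -/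
theorem fibPaths : Provable fibPathsType := prove [⟨_, extendPaths⟩] (fun v =>
  lam fun A => lam fun B => lam fun C => lam fun p => lam fun q => lam fun X => lam fun f =>
  lam fun g => lam fun H => lam fun ind => lam fun x => lam fun W => lam fun h => lam fun k =>
  lam fun l => lam fun _ => lam fun κ =>
    let Y := fun (a b e : Ex) => Pi (Id (g [b]) x) fun s =>
      Id (h [a, concat e s]) (k [b, s])
    unpack (ind [fn A fun a => fn B fun b => fn (Id (f [a]) (g [b])) fun e => Y a b e, l]) fun y h' =>
    have' (Pi A fun a => Pi B fun b => Pi (Id (g [b]) x) fun s =>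
        Sig (Pi (Id (f [a]) x) fun r => Id (h [a, r]) (k [b, s])) fun n =>
        Pi (Id (f [a]) (g [b])) fun e => Id (n [concat e s]) (y [a, b, e, s]))
      (lam fun a => lam fun b => lam fun s =>
        v 0 [X, f [a], g [b], x, s, W, h [a], k [b, s],
          lam fun e => y [a, b, e, s]]) fun n =>
    κ [lam fun a => lam fun r => lam fun b => lam fun s => fst (n [a, b, s]) [r],
      lam fun c => lam fun s =>
        concat (snd (n [p [c], q [c], s]) [H [c]]) (at' (h' [c]) s)])
  (by decide +kernel)

/-- Maps from a fiber of `m : K → X` can be extended, for `K` the pushout of a pullback. -/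
def fibExtType : Tm := toTm <|
  Pi U fun A => Pi U fun B => Pi U fun C => Pi (arr C A) fun p => Pi (arr C B) fun q =>
  let S : Span := ⟨A, B, C, p, q⟩
  Pi U fun K => Pi (arr A K) fun i => Pi (arr B K) fun j =>
  Pi (Pi C fun c => Id (i [p [c]]) (j [q [c]])) fun l =>
  Pi (PushoutInd S K i j l) fun _ =>
  Pi U fun X => Pi (arr K X) fun m =>
  let f := fn A fun a => m [i [a]]
  let g := fn B fun b => m [j [b]]
  Pi (PullbackInd S f g (fn C fun c => ap m (l [c]))) fun _ => Pi X fun x => Pi U fun Z =>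
  arr (JoinExt (Fib A f x) (Fib B g x) Z) (Ext (Fib K m x) Z)

/-- Here `f` and `g` are by definition the restrictions of `m`, and the homotopy is `ap m` of the
glue paths. `fibPath` lifts glue paths to the fiber, `fibPaths` spreads the lifts over the product
of the two fibers, and `extOfPaths` concludes. -/
theorem fibExt : Provable fibExtType :=
  prove [⟨_, fibPath⟩, ⟨_, fibPaths⟩, ⟨_, extOfPaths⟩] (fun v =>
  lam fun A => lam fun B => lam fun C => lam fun p => lam fun q => lam fun K => lam fun i =>
  lam fun j => lam fun l => lam fun indK => lam fun X => lam fun m => lam fun indC =>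
  lam fun x => lam fun Z => lam fun n => lam fun ψ =>
    let f := fn A fun a => m [i [a]]
    let g := fn B fun b => m [j [b]]
    let W := Fib K m x
    let lift := fun (c : Ex) => v 0 [K, X, m, x, i [p [c]], j [q [c]], l [c]]
    let R := fn K fun y => Id (m [y]) x
    let ε := fn C fun c => fn (Id (m [j [q [c]]]) x) fun s => concat (ap m (l [c])) s
    let pt := fn K fun y => fn (Id (m [y]) x) fun r => asc W (pair y r)
    let T := Sig Z fun z => Pi K fun y => Pi (Id (m [y]) x) fun r => Id z (ψ [pt [y, r]])
    unpack
      (asc T (v 1 [A, B, C, p, q, X, f, g, fn C fun c => ap m (l [c]), indC, x, W,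
        fn A fun a => pt [i [a]], fn B fun b => pt [j [b]], lam fun c => fst (lift c), T,
        lam fun k => lam fun h =>
          v 2 [A, B, C, p, q, K, i, j, l, indK, R, W, pt, ε, lam fun c => fst (lift c), k, h,
            Z, ψ, lam fun z => lam fun c => snd (lift c) [Z, ψ, z], n]])) fun z e =>
    pair z (lam fun y => cases y fun y r => e [y, r]))
  (by decide +kernel)

end Ex
end HoTT

/-! ### Fibers of maps that are determined up to homotopy -/

namespace HoTT
open Tm
namespace Ex

/-- Maps from a fiber of `m` can be extended, for a map `m` with given restrictions. -/
def fibExtPathType : Tm := toTm <|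
  Pi U fun A => Pi U fun B => Pi U fun C => Pi (arr C A) fun p => Pi (arr C B) fun q =>
  let S : Span := ⟨A, B, C, p, q⟩
  Pi U fun K => Pi (arr A K) fun i => Pi (arr B K) fun j =>
  Pi (Pi C fun c => Id (i [p [c]]) (j [q [c]])) fun l =>
  Pi (PushoutInd S K i j l) fun _ =>
  Pi U fun X => Pi (arr K X) fun m =>
  Pi (arr A X) fun f => Pi (Id (fn A fun a => m [i [a]]) f) fun e =>
  Pi (arr B X) fun g => Pi (Id (fn B fun b => m [j [b]]) g) fun e' =>
  Pi (Pi C fun c => Id (f [p [c]]) (g [q [c]])) fun H =>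
  Pi (Pi C fun c =>
    Id (concat (at' e (p [c])) (H [c])) (concat (ap m (l [c])) (at' e' (q [c])))) fun _ =>
  Pi (PullbackInd S f g H) fun _ => Pi X fun x => Pi U fun Z =>
  arr (JoinExt (Fib A f x) (Fib B g x) Z) (Ext (Fib K m x) Z)

theorem fibExtPath : Provable fibExtPathType :=
  prove [⟨_, fibExt⟩, ⟨_, funExt⟩, ⟨_, reflConcat⟩] (fun v =>
  lam fun A => lam fun B => lam fun C => lam fun p => lam fun q => lam fun K => lam fun i =>
  lam fun j => lam fun l => lam fun ind' => lam fun X => lam fun m =>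
  lam fun _ => lam fun e => ind e (lam fun _ => lam fun e' => ind e' (lam fun H => lam fun γ =>
    let f := fn A fun a => m [i [a]]
    let g := fn B fun b => m [j [b]]
    let T := fn C fun c => Id (f [p [c]]) (g [q [c]])
    let h := fn C fun c => ap m (l [c])
    -- After induction on `e` and `e'`, the coherence `γ` says `refl ∙ H c = ap m (l c)`. So `H`
    -- equals the homotopy required by `fibExt`, and one more path induction replaces it.
    have' (Pi (Pi C fun c => T [c]) fun H => arr (Id h H) (Pi (PullbackInd ⟨A, B, C, p, q⟩ f g H)
        fun _ => Pi X fun x => Pi U fun Z =>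
        arr (JoinExt (Fib A f x) (Fib B g x) Z) (Ext (Fib K m x) Z)))
      (lam fun _ => lam fun t => ind t (v 0 [A, B, C, p, q, K, i, j, l, ind', X, m])) fun r =>
    r [H, fst (v 1 [C, T, h, H, lam fun c =>
      concat (inv (γ [c])) (v 2 [X, f [p [c]], g [q [c]], H [c]])])])))
  (by decide +kernel)

/-- Maps from a fiber of `m` can be extended, for a map `m` given by `f`, `g` and `H`. -/
def fibExtMapType : Tm := toTm <|
  Pi U fun A => Pi U fun B => Pi U fun C => Pi (arr C A) fun p => Pi (arr C B) fun q =>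
  let S : Span := ⟨A, B, C, p, q⟩
  Pi U fun K => Pi (arr A K) fun i => Pi (arr B K) fun j =>
  Pi (Pi C fun c => Id (i [p [c]]) (j [q [c]])) fun l =>
  Pi (PushoutInd S K i j l) fun _ =>
  Pi U fun X => Pi (arr K X) fun m =>
  Pi (arr A X) fun f => Pi (Pi A fun a => Id (m [i [a]]) (f [a])) fun α =>
  Pi (arr B X) fun g => Pi (Pi B fun b => Id (m [j [b]]) (g [b])) fun β =>
  Pi (Pi C fun c => Id (f [p [c]]) (g [q [c]])) fun H =>
  Pi (Pi C fun c =>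
    Id (concat (α [p [c]]) (H [c])) (concat (ap m (l [c])) (β [q [c]]))) fun _ =>
  Pi (PullbackInd S f g H) fun _ => Pi X fun x => Pi U fun Z =>
  arr (JoinExt (Fib A f x) (Fib B g x) Z) (Ext (Fib K m x) Z)

theorem fibExtMap : Provable fibExtMapType :=
  prove [⟨_, fibExtPath⟩, ⟨_, funExt⟩] (fun v =>
  lam fun A => lam fun B => lam fun C => lam fun p => lam fun q => lam fun K => lam fun i =>
  lam fun j => lam fun l => lam fun ind' => lam fun X => lam fun m =>
  lam fun f => lam fun α => lam fun g => lam fun β => lam fun H => lam fun γ =>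
    let f' := fn A fun a => m [i [a]]
    let g' := fn B fun b => m [j [b]]
    unpack (v 1 [A, fn A fun _ => X, f', f, α]) fun e h =>
    unpack (v 1 [B, fn B fun _ => X, g', g, β]) fun e' h' =>
    v 0 [A, B, C, p, q, K, i, j, l, ind', X, m, f, e, g, e', H, lam fun c =>
      concat (apFn (fun t => concat t (H [c])) (h [p [c]]))
        (concat (γ [c]) (inv (apFn (fun t => concat (ap m (l [c])) t) (h' [q [c]]))))])
  (by decide +kernel)

/-- Maps from a fiber of the map from a pushout given by `f`, `g` and `H` can be extended. -/
def fibExtGlueRecType : Tm := toTm <|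
  Pi U fun A => Pi U fun B => Pi U fun X => Pi (arr A X) fun f => Pi (arr B X) fun g =>
  Pi U fun C => Pi (arr C A) fun p => Pi (arr C B) fun q =>
  let S : Span := ⟨A, B, C, p, q⟩
  Pi (Pi C fun c => Id (f [p [c]]) (g [q [c]])) fun H =>
  Pi (PullbackInd S f g H) fun _ => Pi X fun x => Pi U fun Z =>
  arr (JoinExt (Fib A f x) (Fib B g x) Z)
    (Ext (Fib (Pushout S) (glueRec S X f g H) x) Z)

/-- `glueMap` replaces the recursor by a map `φ` with propositional computation rules, which is the
situation of `fibExtMap`. -/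
theorem fibExtGlueRec : Provable fibExtGlueRecType :=
  prove [⟨_, glueMap⟩, ⟨_, fibExtMap⟩, ⟨_, pushoutInd⟩] (fun v =>
  lam fun A => lam fun B => lam fun X => lam fun f => lam fun g =>
  lam fun C => lam fun p => lam fun q => lam fun H => lam fun ind' => lam fun x => lam fun Z =>
    let S : Span := ⟨A, B, C, p, q⟩
    let K := Pushout S
    v 0 [A, B, C, p, q, X, f, g, H,
      fn (arr K X) fun φ => arr (JoinExt (Fib A f x) (Fib B g x) Z) (Ext (Fib K φ x) Z),
      lam fun φ => lam fun α => lam fun β => lam fun γ =>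
        v 1 [A, B, C, p, q, K, fn A (inLeft S), fn B (inRight S), fn C (glue S),
          v 2 [A, B, C, p, q], X, φ, f, α, g, β, H, γ, ind', x, Z]])
  (by decide +kernel)

end Ex
end HoTT

/-! ### Conclusion for the join of maps -/

namespace HoTT
open Tm

namespace Tm

theorem cong_eq {r : Tm → Tm → Bool} (hr : ∀ t u, r t u = true → t = u) {t u : Tm}
    (h : cong r t u = true) : t = u := by
  unfold cong at h
  split at h <;> try split at h
  all_goals try simp only [Bool.and_eq_true, Bool.false_eq_true] at h
  · rw [Nat.eq_of_beq_eq_true h]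
  all_goals try rfl
  all_goals casesm* _ ∧ _
  all_goals congr 1 <;> exact hr _ _ ‹_›

theorem beq_eq (k : ℕ) : ∀ t u, beq k t u = true → t = u := by
  induction k with
  | zero => simp [beq]
  | succ k ih => exact fun t u h => cong_eq ih h

end Tm

/-- Elaborate a term, whose inferred type is `T`. -/
def checkTerm (Γ : Ctx) (T : Tm) (e : (ℕ → Ex) → Ex) : Bool :=
  T.closedAt 0 && match (e Ex.lvl).run Γ (some T) with
    | .ok (t, _) => match infer fuel Γ t with
      | some S => beq fuel S T
      | none => false
    | .error _ => false

/-- The inferred type must agree with `T` syntactically. No conversion takes place, and so, unlike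
in `prove`, `T` need not be checked to be a type. -/
theorem proveTerm (l : List Fact) {T : Tm} (e : (ℕ → Ex) → Ex)
    (h : checkTerm (hyps l) T e = true) : ∃ t, HasType [] t T := by
  rw [checkTerm, Bool.and_eq_true] at h
  obtain ⟨hc, h⟩ := h
  split at h
  · next t _ _ =>
    split at h
    · next S hS =>
      obtain rfl := beq_eq _ _ _ h
      have hΓ : ∀ T ∈ hyps l, Provable T := fun S hS => by
        obtain ⟨x, -, rfl⟩ := List.mem_map.mp (List.mem_reverse.mp hS)
        exact x.2
      exact cut hΓ hc (infer_sound _ _ _ _ (WfCtx.of_provable hΓ) hS).1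
    · cases h
  · cases h

namespace Ex

/-! ### The join of maps -/

/-- The map `m : A → X` is `M`-connected. -/
def IsConnMap (M A X m : Ex) : Ex := node (fun
  | [M, A, X, m] => (isConnMap M A X m, sort .large)
  | _ => (star, star)) [M, A, X, m]

def connMapOfExtType : Tm := toTm <|
  Pi U fun M => Pi U fun N => Pi U fun A => Pi U fun B => Pi U fun X =>
  Pi (arr A X) fun f => Pi (arr B X) fun g => Pi U fun P => Pi (arr P X) fun m =>
  Pi (Pi X fun x => Pi U fun Z => arr (JoinExt (Fib A f x) (Fib B g x) Z) (Ext (Fib P m x) Z))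
    fun _ => Pi (IsConnMap M A X f) fun _ => Pi (IsConnMap N B X g) fun _ =>
  IsConnMap (Join M N) P X m

theorem connMapOfExt : Provable connMapOfExtType :=
  prove [⟨_, localJoinExt⟩, ⟨_, connOfJoinExt⟩] (fun v =>
  lam fun M => lam fun N => lam fun A => lam fun B => lam fun X => lam fun f => lam fun g =>
  lam fun P => lam fun m => lam fun e => lam fun c => lam fun d => lam fun x =>
    v 1 [Join M N, M, N, Fib A f x, Fib B g x, Fib P m x, v 0 [M, N], c [x], d [x], e [x]])
  (by decide +kernel)

/-- The span of the projections of a pullback. -/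
def pullbackSpan (A B X f g : Ex) : Span :=
  let C := Sig A fun a => Sig B fun b => Id (f [a]) (g [b])
  ⟨A, B, C, fn C fst, fn C fun c => fst (snd c)⟩

def pullbackPathOf (A B X f g : Ex) : Ex := fn (pullbackSpan A B X f g).apex fun c => snd (snd c)

def pullbackIndType : Tm := toTm <|
  Pi U fun A => Pi U fun B => Pi U fun X => Pi (arr A X) fun f => Pi (arr B X) fun g =>
  PullbackInd (pullbackSpan A B X f g) f g (pullbackPathOf A B X f g)

/-- Without an `η` rule a point of the pullback is not judgementally a triple; the computation rule
follows by induction on pairs. -/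
theorem pullbackInd : Provable pullbackIndType := prove [] (fun _ =>
  lam fun _ => lam fun _ => lam fun _ => lam fun _ => lam fun _ => lam fun _ => lam fun y =>
    pair (lam fun a => lam fun b => lam fun e => y [pair a (pair b e)])
      (lam fun c => cases c fun a c => cases c fun b e => rfl (y [pair a (pair b e)])))
  (by decide +kernel)

/-- The join connectivity theorem, for closed types in the formal type theory. -/
theorem joinConnectivity_inhabited : ∃ t, HasType [] t joinConnectivity :=
  proveTerm [⟨_, connMapOfExt⟩, ⟨_, fibExtGlueRec⟩, ⟨_, pullbackInd⟩] (fun v =>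
  fn U fun M => fn U fun N => fn U fun A => fn U fun B => fn U fun X =>
  fn (arr A X) fun f => fn (arr B X) fun g =>
    let S := pullbackSpan A B X f g
    let H := pullbackPathOf A B X f g
    v 0 [M, N, A, B, X, f, g, Pushout S, glueRec S X f g H,
      v 1 [A, B, X, f, g, S.apex, S.toLeft, S.toRight, H, v 2 [A, B, X, f, g]]])
  (by decide +kernel)

end Ex
end HoTT

theorem mainTheorem6 : HoTT.IsInhabited HoTT.Tm.joinConnectivity :=
  HoTT.Ex.joinConnectivity_inhabited
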